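/- **Model.** Consider a $K$-tier cellular network in $\mathbb{R}^2$. The base stations (BSs) of tier $j\in\{1,\dots,K\}$ form a homogeneous Poisson point process $\Phi_j$ of density $\lambda_j>0$, and the users form a homogeneous Poisson point process $\Phi_u$ of density $\lambda_u>0$. Each BS of tier $j$ is available with probability $\rho_j\in[0,1]$; the available BSs of tier $j$ form the process $\Phi_j^{(a)}$. The link from a tier-$j$ BS at $x$ to a location $z$ has a shadowing gain $\mathcal X_{jx}^{(z)}$ distributed like $\mathcal X_j\ge 0$, where $\mathcal X_j$ has an arbitrary distribution with $0<\mathbb E[\mathcal X_j^{2/\alpha}]<\infty$, and a fading gain $h_{jx}^{(z)}$ that is exponential with mean $1$. The point processes, the availabilities, the shadowing gains and the fading gains are independent, also for different BSs; the gains from one BS to different locations may depend on each other. The transmit power of tier $j$ is $P_j>0$, the path loss exponent is $\alpha>0$, and the target signal-to-interference ratio is $\beta>0$. A location $z$ is served by the available BS for which the long-term received power $P_j\mathcal X_{jx}^{(z)}\|x-z\|^{-\alpha}$ is largest among the available BSs of all tiers, and the service region $\mathcal A_k(x)$ of an available tier-$k$ BS at $x$ is the set of locations that it serves. The mean of a quantity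 attached to a *typical* BS of tier $k$ is the Palm expectation with respect to $\Phi_k^{(a)}$: for any Borel set $B$ with $0<|B|<\infty$, the expected total of the quantity over the BSs of $\Phi_k^{(a)}$ in $B$, divided by the expected number of these BSs (part of the claim is that the quotients below do not depend on $B$). The signal-to-interference ratio of a receiver at $z$ connected to $x\in\Phi_k^{(a)}$ is $$\mathrm{SIR}=\frac{P_kh_{kx}^{(z)}\mathcal X_{kx}^{(z)}\|x-z\|^{-\alpha}}{\sum_{j}\sum_{y\in\Phi_j^{(a)}\setminus\{x\}}P_jh_{jy}^{(z)}\mathcal X_{jy}^{(z)}\|y-z\|^{-\alpha}},$$ and a receiver is in coverage if its SIR with respect to its serving BS exceeds $\beta$. Let $\mathtt{P_c}$ be the coverage probability of a typical user, located at the origin. The energy utilization rate $\nu_k$ is the mean number of units of energy per second required at a typical BS of tier $k$, where every user that is served by this BS and is in coverage requires one unit per second; that is, $\nu_k$ is the mean number of such users. **Claim.** Let $k$ be a tier with $\rho_k>0$. 1. The mean area of the service region of a typical tier-$k$ BS is $$\mathbb E[|\mathcal A_k|]=\frac{\mathbb E[\mathcal X_k^{2/\alpha}]\,P_k^{2/\alpha}}{\sum_{j=1}^K\rho_j\lambda_j\,\mathbb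 E[\mathcal X_j^{2/\alpha}]\,P_j^{2/\alpha}}.$$ 2. If $\alpha>2$, then $$\nu_k=\mathtt{P_c}\,\lambda_u\,\mathbb E[|\mathcal A_k|]=\frac{\mathtt{P_c}\,\lambda_u\,\mathbb E[\mathcal X_k^{2/\alpha}]\,P_k^{2/\alpha}}{\sum_{j=1}^K\rho_j\lambda_j\,\mathbb E[\mathcal X_j^{2/\alpha}]\,P_j^{2/\alpha}},$$ where the coverage probability does not depend on the availabilities and is given by $$\mathtt{P_c}=\frac1{1+\mathcal F(\beta,\alpha)},\qquad \mathcal F(\beta,\alpha)=\frac{2\beta}{\alpha-2}\;{}_2F_1\!\left[1,1-\tfrac2\alpha,2-\tfrac2\alpha,-\beta\right],$$ with ${}_2F_1[a,b,c,z]=\frac{\Gamma(c)}{\Gamma(b)\Gamma(c-b)}\int_0^1\frac{t^{b-1}(1-t)^{c-b-1}}{(1-tz)^a}\,dt$. -/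

import Mathlib

open MeasureTheory ProbabilityTheory
open scoped ENNReal

noncomputable section

namespace HetNet

/-- The Euclidean plane. -/
abbrev Plane : Type := EuclideanSpace ℝ (Fin 2)

/-! ### Poisson point processes -/

section Poisson

variable {Ω E : Type*}

/-- The number of points in `B`, counted with multiplicity, of the point process whose points are
enumerated by `Y`. -/
def count (Y : ℕ → Ω → E) (B : Set E) (ω : Ω) : ℕ∞ := {n | Y n ω ∈ B}.encard

/-- The random points `Y 0, Y 1, …` form a Poisson point process with intensity measure `Λ`: the
number of points in a set of finite intensity is Poisson distributed, and the numbers of points in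
disjoint sets are independent. (The enumeration by `ℕ` is no restriction for a process with
infinitely many points, such as a homogeneous one of positive density on the plane.) -/
structure IsPoissonProcess [MeasurableSpace Ω] [MeasurableSpace E]
    (Y : ℕ → Ω → E) (Λ : Measure E) (μ : Measure Ω) : Prop where
  measurable (n : ℕ) : Measurable (Y n)
  poisson (B : Set E) (hB : MeasurableSet B) (hfin : Λ B ≠ ∞) (c : ℕ) :
    μ {ω | count Y B ω = c} = poissonMeasure (Λ B).toNNReal {c}
  indep (m : ℕ) (B : Fin m → Set E) (hB : ∀ i, MeasurableSet (B i)) (hfin : ∀ i, Λ (B i) ≠ ∞)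
    (hdisj : Pairwise (Function.onFun Disjoint B)) :
    iIndepFun (fun i => count Y (B i)) μ

end Poisson

/-! ### Parameters -/

/-- The deterministic parameters of a `K`-tier network. -/
structure Params (K : ℕ) where
  /-- density `λ_j` of the base stations of tier `j` -/
  density : Fin K → ℝ
  /-- availability `ρ_j` of the base stations of tier `j` -/
  avail : Fin K → ℝ
  /-- transmit power `P_j` of the base stations of tier `j` -/
  power : Fin K → ℝ
  /-- distribution of the shadowing gain `X_j` from a base station of tier `j` -/
  shadowLaw : Fin K → Measure ℝ
  /-- density `λ_u` of the users -/
  userDensity : ℝ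
  /-- path loss exponent `α` -/
  alpha : ℝ
  /-- target SIR `β` -/
  beta : ℝ

namespace Params

variable {K : ℕ} (p : Params K)

/-- The fractional moment `E[X_j ^ (2/α)]`. -/
def moment (j : Fin K) : ℝ := ∫ x, x ^ (2 / p.alpha) ∂(p.shadowLaw j)

/-- Standing assumptions on the parameters. The shadowing gains have an arbitrary distribution on
`[0, ∞)`, other than the unit mass at `0`, with finite moment of order `2/α`. -/
structure Admissible : Prop where
  density_pos (j : Fin K) : 0 < p.density j
  avail_nonneg (j : Fin K) : 0 ≤ p.avail j
  avail_le_one (j : Fin K) : p.avail j ≤ 1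
  power_pos (j : Fin K) : 0 < p.power j
  shadow_prob (j : Fin K) : IsProbabilityMeasure (p.shadowLaw j)
  shadow_nonneg (j : Fin K) : ∀ᵐ x ∂(p.shadowLaw j), 0 ≤ x
  shadow_integrable (j : Fin K) : Integrable (fun x : ℝ => x ^ (2 / p.alpha)) (p.shadowLaw j)
  shadow_ne_zero (j : Fin K) : p.shadowLaw j ≠ Measure.dirac 0
  userDensity_pos : 0 < p.userDensity
  alpha_pos : 0 < p.alpha
  beta_pos : 0 < p.beta

end Params

/-! ### The random network -/

/-- A receiver: `some i` is the `i`-th user, `none` is the typical user, located at the origin. -/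
abbrev Receiver : Type := Option ℕ

/-- The random elements of a `K`-tier network on a sample space `Ω`. The `n`-th base station of
tier `j` is referred to by the pair `(j, n)`. -/
structure Network (K : ℕ) (Ω S : Type*) where
  /-- location of base station `(j, n)` -/
  bs : Fin K → ℕ → Ω → Plane
  /-- whether base station `(j, n)` is available -/
  on : Fin K → ℕ → Ω → Bool
  /-- the random environment of base station `(j, n)`, which determines its shadowing gains -/
  env : Fin K → ℕ → Ω → S
  /-- `gain j x z s` is the shadowing gain from a base station of tier `j` at `x` with
  environment `s` to the location `z` -/
  gain : Fin K → Plane → Plane → S → ℝ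
  /-- location of the `i`-th user -/
  user : ℕ → Ω → Plane
  /-- small scale fading gain from base station `(j, n)` to a receiver -/
  fading : Fin K → ℕ → Receiver → Ω → ℝ

/-- Labels for the independent sources of randomness. -/
inductive Source (K : ℕ) : Type
  | bs (j : Fin K)
  | user
  | on (j : Fin K) (n : ℕ)
  | env (j : Fin K) (n : ℕ)
  | fading (j : Fin K) (n : ℕ)

namespace Network

variable {K : ℕ} {Ω S : Type*} (net : Network K Ω S)

/-- The σ-algebra generated by a source of randomness. -/
@[reducible] def sigma [MeasurableSpace S] : Source K → MeasurableSpace Ω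
  | .bs j => MeasurableSpace.comap (fun ω n => net.bs j n ω) inferInstance
  | .user => MeasurableSpace.comap (fun ω i => net.user i ω) inferInstance
  | .on j n => MeasurableSpace.comap (net.on j n) inferInstance
  | .env j n => MeasurableSpace.comap (net.env j n) inferInstance
  | .fading j n => MeasurableSpace.comap (fun ω r => net.fading j n r ω) inferInstance

/-- The probabilistic model: the base stations of tier `j` form a homogeneous Poisson point process
of density `λ_j`, the users one of density `λ_u`, base stations of tier `j` are available with
probability `ρ_j`, the shadowing gain of each link from tier `j` has the distribution of `X_j`, the
fading gains are exponential with mean `1`, and the locations of the different tiers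
and of the users, the availabilities, the environments and the fading gains of the different base
stations are all independent. No assumption is made on the dependence between the shadowing gains
(or the fading gains) from one base station to different receivers. -/
structure IsModel [MeasurableSpace Ω] [MeasurableSpace S] (p : Params K) (μ : Measure Ω) :
    Prop where
  bs_poisson (j : Fin K) :
    IsPoissonProcess (net.bs j) (ENNReal.ofReal (p.density j) • (volume : Measure Plane)) μ
  user_poisson :
    IsPoissonProcess net.user (ENNReal.ofReal p.userDensity • (volume : Measure Plane)) μ
  on_measurable (j : Fin K) (n : ℕ) : Measurable (net.on j n)
  on_prob (j : Fin K) (n : ℕ) : μ {ω | net.on j n ω = true} = ENNReal.ofReal (p.avail j)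
  env_measurable (j : Fin K) (n : ℕ) : Measurable (net.env j n)
  gain_measurable (j : Fin K) :
    Measurable (fun q : Plane × Plane × S => net.gain j q.1 q.2.1 q.2.2)
  gain_law (j : Fin K) (n : ℕ) (x z : Plane) :
    μ.map (fun ω => net.gain j x z (net.env j n ω)) = p.shadowLaw j
  fading_measurable (j : Fin K) (n : ℕ) (r : Receiver) : Measurable (net.fading j n r)
  fading_law (j : Fin K) (n : ℕ) (r : Receiver) : μ.map (net.fading j n r) = expMeasure 1
  indep : iIndep net.sigma μ

/-! ### Association and service regions -/

/-- The long term received power `P_j X_j ‖x - z‖ ^ (-α)` at `z` from base station `b = (j, n)`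
located at `x`. -/
def longTermPower (p : Params K) (b : Fin K × ℕ) (z : Plane) (ω : Ω) : ℝ :=
  p.power b.1 * net.gain b.1 (net.bs b.1 b.2 ω) z (net.env b.1 b.2 ω) *
    ‖net.bs b.1 b.2 ω - z‖ ^ (-p.alpha)

/-- Base station `b` serves the location `z`: it is available and its long term received power
at `z` is maximal among all available base stations of all tiers. -/
def Serves (p : Params K) (b : Fin K × ℕ) (z : Plane) (ω : Ω) : Prop :=
  net.on b.1 b.2 ω = true ∧
    ∀ b' : Fin K × ℕ, net.on b'.1 b'.2 ω = true →
      net.longTermPower p b' z ω ≤ net.longTermPower p b z ω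

/-- The service region of a base station. -/
def serviceRegion (p : Params K) (b : Fin K × ℕ) (ω : Ω) : Set Plane :=
  {z | net.Serves p b z ω}

/-! ### Signal-to-interference ratio and coverage -/

/-- The location of a receiver. -/
def location (ω : Ω) : Receiver → Plane
  | none => 0
  | some i => net.user i ω

/-- The received power, including fading, from base station `b` at receiver `r`. -/
def receivedPower (p : Params K) (b : Fin K × ℕ) (r : Receiver) (ω : Ω) : ℝ :=
  net.fading b.1 b.2 r ω * net.longTermPower p b (net.location ω r) ω

open Classical in
/-- The signal-to-interference ratio at receiver `r` when it is connected to `b` and all the other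
available base stations interfere. -/
def sir (p : Params K) (b : Fin K × ℕ) (r : Receiver) (ω : Ω) : ℝ≥0∞ :=
  ENNReal.ofReal (net.receivedPower p b r ω) /
    ∑' b' : Fin K × ℕ,
      if net.on b'.1 b'.2 ω = true ∧ b' ≠ b then ENNReal.ofReal (net.receivedPower p b' r ω) else 0

/-- Receiver `r` is served by base station `b` and is in control channel coverage: its
signal-to-interference ratio exceeds the target. -/
def CoveredBy (p : Params K) (b : Fin K × ℕ) (r : Receiver) (ω : Ω) : Prop :=
  net.Serves p b (net.location ω r) ω ∧ ENNReal.ofReal p.beta < net.sir p b r ω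

variable [MeasurableSpace Ω]

/-- The coverage probability `P_c` of the typical user. -/
def coverageProb (p : Params K) (μ : Measure Ω) : ℝ :=
  μ.real {ω | ∃ b, net.CoveredBy p b none ω}

/-! ### The typical base station -/

open Classical in
/-- The expectation of the sum of `f n` over the available base stations `(k, n)` in `B`. -/
def campbell (μ : Measure Ω) (k : Fin K) (B : Set Plane) (f : ℕ → Ω → ℝ≥0∞) : ℝ≥0∞ :=
  ∫⁻ ω, ∑' n, (if net.bs k n ω ∈ B ∧ net.on k n ω = true then f n ω else 0) ∂μ

/-- The (Palm) mean of a characteristic `f` of a typical available base station of tier `k`, as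
observed in the window `B`: the mean total of `f` over the available base stations of tier `k` in
`B`, per mean number of these base stations. If this does not depend on `B`, it is the Palm
expectation of `f` at (almost) every location. -/
def typicalMean (μ : Measure Ω) (k : Fin K) (B : Set Plane) (f : ℕ → Ω → ℝ≥0∞) : ℝ≥0∞ :=
  net.campbell μ k B f / net.campbell μ k B (fun _ _ => 1)

/-- The mean area of the service region of a typical base station of tier `k`. -/
def meanServiceArea (p : Params K) (μ : Measure Ω) (k : Fin K) (B : Set Plane) : ℝ≥0∞ :=
  net.typicalMean μ k B (fun n ω => volume (net.serviceRegion p (k, n) ω))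

/-- The energy utilization rate `ν_k`: the mean number of units of energy per second required at a
typical base station of tier `k`. Each user in control channel coverage which is served by the base
station requires one unit per second. -/
def energyUtilization (p : Params K) (μ : Measure Ω) (k : Fin K) (B : Set Plane) : ℝ≥0∞ :=
  net.typicalMean μ k B (fun n ω => ({i : ℕ | net.CoveredBy p (k, n) (some i) ω}.encard : ℝ≥0∞))

end Network

/-! ### The closed forms -/

/-- The Gauss hypergeometric function, by its Euler integral. -/
def hyp2F1 (a b c z : ℝ) : ℝ :=
  Real.Gamma c / (Real.Gamma b * Real.Gamma (c - b)) *
    ∫ t in (0 : ℝ)..1, t ^ (b - 1) * (1 - t) ^ (c - b - 1) / (1 - t * z) ^ a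

namespace Params

variable {K : ℕ} (p : Params K)

/-- The function `F(β, α)` in the coverage probability `1 / (1 + F(β, α))`. -/
def coverageF : ℝ :=
  2 * p.beta / (p.alpha - 2) * hyp2F1 1 (1 - 2 / p.alpha) (2 - 2 / p.alpha) (-p.beta)

end Params

end HetNet

end

/-! Fix a receiver location `z` and replace the long-term power `u` of a station by its effective
distance `w = u ^ (-2/α)`, infinite if the station is unavailable. The serving station is the one
with minimal `w`. At distance `r` and gain `g` one has `w = r² (P g) ^ (-2/α)`, so area in the plane
turns into a constant multiple of length on the half-line. Whatever the law of the shadowing, the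
effective distances therefore have constant intensity on `(0, ∞)`: tier `j` contributes the rate
`λ_j ρ_j π E[X_j ^ (2/α)] P_j ^ (2/α)`, and these rates add up to `C = totalRate`
(`lintegral_dataIntensity_snd`).

For a candidate server with effective distance `w` and fading gain `h`, "no station is nearer" and
"the SIR exceeds `β`" together say that `h` exceeds the sum of `loss` over the other stations
(`coveredBy_iff`). As `h` is exponential, this has conditional probability `exp (-∑ loss)`.
Averaging over a Poisson process gives `exp (-C w (1 + F))`, by `lintegral_one_sub_nexp_loss`, where
`F` is an integral that becomes Euler's hypergeometric integral (`coverageInt_ofReal`). Integration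
over `w` shows that a server of tier `j` covers the receiver with probability `rate_j / (C (1 +
F))`. Summation over `j` cancels `C`, and with it all availabilities, and leaves `1 / (1 + F)`. The
case `β = 0`, where `F = 0`, describes the association alone.

The passage to a typical station is an exchange of integrals. The total area served from a window
`B` is the integral over `z` of the expected number of servers of `z` located in `B`. Integrating
over `z` first gives the same value for every station location, so `λ_k |B| ρ_k` cancels in the Palm
quotient (`lintegral_serverMean`, `serverMean_div`). Users are independent of the network, so
Campbell's formula reduces the count of covered users to the same integral times `λ_u`. Only one
receiver is considered at a time, which is why gains towards different locations may be dependent.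

All point process theory comes from Laplace functionals: that of a Poisson process
(`IsPoissonProcess.lintegral_nexp`), its extension to stations with their links
(`IsModel.hasLaplace_data`), and, by differentiation, Mecke's formula (`HasLaplace.mecke`). The sum
in that formula includes the point itself. The server thus contributes a spurious factor `exp (-β
h)` of mean `1 / (1 + β)`, and `IsModel.measure_coverSet` compensates it by `1 + β`. -/

noncomputable section

namespace HetNet

open Filter Topology

/-! ### The function `x ↦ e⁻ˣ` on `[0, ∞]` -/

/-- The function `x ↦ e⁻ˣ` on `[0, ∞]`. -/
def nexp (x : ℝ≥0∞) : ℝ≥0∞ := EReal.exp (-(x : EReal))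

@[simp] lemma nexp_zero : nexp 0 = 1 := by simp [nexp]

@[simp] lemma nexp_top : nexp ∞ = 0 := by simp [nexp]

lemma nexp_ofReal {x : ℝ} (hx : 0 ≤ x) : nexp (ENNReal.ofReal x) = ENNReal.ofReal (Real.exp (-x)) := by
  rw [nexp, EReal.coe_ennreal_ofReal, max_eq_left hx, ← EReal.coe_neg, EReal.exp_coe]

lemma nexp_eq_ofReal {x : ℝ≥0∞} (hx : x ≠ ∞) : nexp x = ENNReal.ofReal (Real.exp (-x.toReal)) := by
  rw [← nexp_ofReal ENNReal.toReal_nonneg, ENNReal.ofReal_toReal hx]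

lemma nexp_add (x y : ℝ≥0∞) : nexp (x + y) = nexp x * nexp y := by
  simp only [nexp, EReal.exp_neg, EReal.coe_ennreal_add, EReal.exp_add]
  refine ENNReal.mul_inv (Or.inl ?_) (Or.inr ?_) <;> simp

lemma antitone_nexp : Antitone nexp := fun _ _ h =>
  EReal.exp_monotone (EReal.neg_le_neg_iff.2 (EReal.coe_ennreal_le_coe_ennreal_iff.2 h))

lemma nexp_le_one (x : ℝ≥0∞) : nexp x ≤ 1 := nexp_zero ▸ antitone_nexp (zero_le (a := x))

lemma nexp_ne_top (x : ℝ≥0∞) : nexp x ≠ ∞ := ne_top_of_le_ne_top ENNReal.one_ne_top (nexp_le_one x)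

lemma continuous_nexp : Continuous nexp :=
  ENNReal.continuous_exp.comp (continuous_neg.comp continuous_coe_ennreal_ereal)

@[fun_prop]
lemma measurable_nexp : Measurable nexp := continuous_nexp.measurable

lemma nexp_sum {ι : Type*} (s : Finset ι) (f : ι → ℝ≥0∞) :
    nexp (∑ i ∈ s, f i) = ∏ i ∈ s, nexp (f i) := by
  classical
  induction s using Finset.induction_on with
  | empty => simp
  | insert a s ha ih => rw [Finset.sum_insert ha, Finset.prod_insert ha, nexp_add, ih]

lemma nexp_mul_natCast (v : ℝ≥0∞) (c : ℕ) : nexp (v * c) = nexp v ^ c := by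
  have := nexp_sum (Finset.range c) (fun _ => v)
  simpa [mul_comm] using this

lemma tendsto_nexp_sum {ι : Type*} (f : ι → ℝ≥0∞) :
    Tendsto (fun s : Finset ι => nexp (∑ i ∈ s, f i)) atTop (𝓝 (nexp (∑' i, f i))) :=
  (continuous_nexp.tendsto _).comp ENNReal.summable.hasSum

/-- The inverse of `nexp` on `[0, 1]`. -/
def nlog (y : ℝ≥0∞) : ℝ≥0∞ := (-(ENNReal.log y)).toENNReal

@[fun_prop]
lemma measurable_nlog : Measurable nlog := by
  unfold nlog; fun_prop

lemma nexp_nlog {y : ℝ≥0∞} (hy : y ≤ 1) : nexp (nlog y) = y := by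
  have h : 0 ≤ -(ENNReal.log y) := by
    rw [EReal.neg_nonneg]; simpa using hy
  rw [nexp, nlog, EReal.coe_toENNReal h, neg_neg, ENNReal.exp_log]

/-! ### The Laplace functional of a Poisson process -/

section Poisson

lemma coe_count {Ω E : Type*} (Y : ℕ → Ω → E) (B : Set E) (ω : Ω) :
    ((count Y B ω : ℕ∞) : ℝ≥0∞) = ∑' n, B.indicator 1 (Y n ω) := by
  rw [count, ← ENNReal.tsum_set_one, tsum_subtype {n | Y n ω ∈ B} (fun _ => (1 : ℝ≥0∞))]
  rfl

variable {Ω E : Type*} [MeasurableSpace Ω] [MeasurableSpace E] {Y : ℕ → Ω → E} {Λ : Measure E}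
  {μ : Measure Ω}

lemma IsPoissonProcess.measurable_coe_count (hY : IsPoissonProcess Y Λ μ) {B : Set E}
    (hB : MeasurableSet B) : Measurable fun ω => ((count Y B ω : ℕ∞) : ℝ≥0∞) := by
  simp_rw [coe_count]
  exact Measurable.tsum fun n => (measurable_one.indicator hB).comp (hY.measurable n)

lemma IsPoissonProcess.measurableSet_count_eq (hY : IsPoissonProcess Y Λ μ) {B : Set E}
    (hB : MeasurableSet B) (c : ℕ∞) : MeasurableSet {ω | count Y B ω = c} := by
  convert hY.measurable_coe_count hB (measurableSet_singleton ((c : ℕ∞) : ℝ≥0∞)) using 1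
  ext ω; simp

lemma IsPoissonProcess.measurable_count (hY : IsPoissonProcess Y Λ μ) {B : Set E}
    (hB : MeasurableSet B) : Measurable (count Y B) :=
  measurable_to_countable' fun c => hY.measurableSet_count_eq hB c

lemma tsum_poissonMeasure_mul_pow (r : NNReal) (s : NNReal) :
    ∑' c : ℕ, poissonMeasure r {c} * (s : ℝ≥0∞) ^ c
      = ENNReal.ofReal (Real.exp (-(r : ℝ) + r * s)) := by
  have h : HasSum (fun c : ℕ => Real.exp (-r) * ((r * s : ℝ) ^ c / (c.factorial : ℝ)))
      (Real.exp (-r) * Real.exp (r * s)) := by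
    refine HasSum.mul_left _ ?_
    rw [Real.exp_eq_exp_ℝ]
    exact NormedSpace.expSeries_div_hasSum_exp (r * s : ℝ)
  rw [Real.exp_add, ← h.tsum_eq, ENNReal.ofReal_tsum_of_nonneg (fun c => by positivity) h.summable]
  refine tsum_congr fun c => ?_
  rw [poissonMeasure_singleton, ← ENNReal.ofReal_coe_nnreal, ← ENNReal.ofReal_pow (by positivity),
    ← ENNReal.ofReal_mul (by positivity)]
  congr 1
  rw [mul_pow]; ring

/-- This is the Poisson generating function at `s = nexp v`. The value `v = ∞` is allowed: then `s =
0` and the identity is the void probability. -/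
lemma IsPoissonProcess.lintegral_nexp_count [IsProbabilityMeasure μ] (hY : IsPoissonProcess Y Λ μ)
    {B : Set E} (hB : MeasurableSet B) (hfin : Λ B ≠ ∞) (v : ℝ≥0∞) :
    ∫⁻ ω, nexp (v * (count Y B ω : ℕ∞)) ∂μ = nexp ((1 - nexp v) * Λ B) := by
  have hsum : ∀ s : NNReal, ∑' c : ℕ, μ {ω | count Y B ω = c} * (s : ℝ≥0∞) ^ c
      = ENNReal.ofReal (Real.exp (-(Λ B).toReal + (Λ B).toReal * s)) := fun s => by
    rw [← ENNReal.coe_toNNReal_eq_toReal, ← tsum_poissonMeasure_mul_pow]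
    exact tsum_congr fun c => by rw [hY.poisson B hB hfin c]
  have hdisj : Pairwise (Function.onFun Disjoint fun c : ℕ => {ω | count Y B ω = c}) := by
    intro a b hab
    refine Set.disjoint_left.2 fun ω h1 h2 => hab ?_
    have h3 : (a : ℕ∞) = b := h1.symm.trans h2
    exact_mod_cast h3
  -- The generating function at `s = 1` says that the probabilities of the finite values add up to
  -- one.
  have hfinite : ∀ᵐ ω ∂μ, ∃ c : ℕ, count Y B ω = c := by
    have h1 := hsum 1
    simp only [ENNReal.coe_one, one_pow, mul_one, NNReal.coe_one, neg_add_cancel, Real.exp_zero,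
      ENNReal.ofReal_one] at h1
    rw [← measure_iUnion hdisj (fun c => hY.measurableSet_count_eq hB c)] at h1
    have h2 := (prob_compl_eq_zero_iff
      (MeasurableSet.iUnion fun c : ℕ => hY.measurableSet_count_eq hB c)).2 h1
    filter_upwards [measure_eq_zero_iff_ae_notMem.1 h2] with ω hω
    simpa using hω
  have hae : ∀ᵐ ω ∂μ, nexp (v * (count Y B ω : ℕ∞))
      = ∑' c : ℕ, {ω | count Y B ω = c}.indicator (fun _ => nexp v ^ c) ω := by
    filter_upwards [hfinite] with ω ⟨c, hc⟩
    rw [tsum_eq_single c]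
    · simp [hc, nexp_mul_natCast]
    · intro b hb
      refine Set.indicator_of_notMem (fun h => hb ?_) _
      have h3 : (b : ℕ∞) = c := h.symm.trans hc
      exact_mod_cast h3
  rw [lintegral_congr_ae hae, lintegral_tsum fun (c : ℕ) =>
    (measurable_const.indicator (hY.measurableSet_count_eq hB (c : ℕ∞))).aemeasurable]
  simp_rw [lintegral_indicator_const (hY.measurableSet_count_eq hB _)]
  lift nexp v to NNReal using nexp_ne_top v with s hs
  have hs1 : s ≤ 1 := by
    have := nexp_le_one v
    rw [← hs] at this
    exact_mod_cast this
  simp_rw [mul_comm ((s : ℝ≥0∞) ^ _)]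
  rw [hsum s, nexp_eq_ofReal (ENNReal.mul_ne_top (by simp) hfin), ENNReal.toReal_mul,
    ENNReal.toReal_sub_of_le (by exact_mod_cast hs1) ENNReal.one_ne_top]
  congr 2
  simp; ring

/-- The Laplace functional of a Poisson process at a simple function. -/
lemma IsPoissonProcess.lintegral_nexp_simpleFunc [IsProbabilityMeasure μ]
    (hY : IsPoissonProcess Y Λ μ) (f : SimpleFunc E ℝ≥0∞) (hf : Λ (Function.support f) ≠ ∞) :
    ∫⁻ ω, nexp (∑' n, f (Y n ω)) ∂μ = nexp (∫⁻ y, (1 - nexp (f y)) ∂Λ) := by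
  classical
  -- The value `0` is dropped because its level set may have infinite intensity; it contributes to
  -- neither side.
  set V : Finset ℝ≥0∞ := f.range.erase 0 with hV
  have hV0 : ∀ v ∈ V, v ≠ 0 := fun v hv => Finset.ne_of_mem_erase hv
  have hfin : ∀ v ∈ V, Λ (f ⁻¹' {v}) ≠ ∞ := fun v hv => by
    refine ne_top_of_le_ne_top hf (measure_mono fun y hy => ?_)
    simp only [Set.mem_preimage, Set.mem_singleton_iff] at hy
    simpa [hy] using hV0 v hv
  have hexp : ∀ y, ∀ g : ℝ≥0∞ → ℝ≥0∞, g 0 = 0 →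
      g (f y) = ∑ v ∈ V, g v * (f ⁻¹' {v}).indicator 1 y := by
    intro y g hg
    by_cases h0 : f y = 0
    · rw [h0, hg, eq_comm]
      refine Finset.sum_eq_zero fun v hv => ?_
      have : y ∉ f ⁻¹' {v} := fun h => hV0 v hv (by simpa [h0] using h.symm)
      simp [this]
    · rw [Finset.sum_eq_single_of_mem (f y) (by simp [hV, h0])]
      · simp
      · intro b _ hb
        have : y ∉ f ⁻¹' {b} := fun h => hb (by simpa using h.symm)
        simp [this]
  have h1 : ∀ ω, nexp (∑' n, f (Y n ω)) = ∏ v ∈ V, nexp (v * (count Y (f ⁻¹' {v}) ω : ℕ∞)) := by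
    intro ω
    rw [← nexp_sum]
    congr 1
    simp_rw [coe_count, ← ENNReal.tsum_mul_left]
    rw [← Summable.tsum_finsetSum fun _ _ => ENNReal.summable]
    exact tsum_congr fun n => hexp (Y n ω) id rfl
  simp_rw [h1]
  have h2 : ∫⁻ y, (1 - nexp (f y)) ∂Λ = ∑ v ∈ V, (1 - nexp v) * Λ (f ⁻¹' {v}) := by
    rw [lintegral_congr fun y => hexp y (fun v => 1 - nexp v) (by simp),
      lintegral_finsetSum _ fun v _ =>
        (measurable_one.indicator (f.measurableSet_fiber v)).const_mul _]
    refine Finset.sum_congr rfl fun v _ => ?_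
    rw [lintegral_const_mul _ (measurable_one.indicator (f.measurableSet_fiber v)),
      lintegral_indicator_one (f.measurableSet_fiber v)]
  rw [h2, nexp_sum]
  set e := V.equivFin with he
  have hind : iIndepFun (fun i : Fin V.card => count Y (f ⁻¹' {((e.symm i : V) : ℝ≥0∞)})) μ := by
    refine hY.indep _ _ (fun i => f.measurableSet_fiber _) (fun i => hfin _ (e.symm i).2) ?_
    intro i j hij
    refine Set.disjoint_left.2 fun y h1 h2 => hij ?_
    have : ((e.symm i : V) : ℝ≥0∞) = (e.symm j : V) := by
      simp only [Set.mem_preimage, Set.mem_singleton_iff] at h1 h2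
      rw [← h1, ← h2]
    exact e.symm.injective (Subtype.ext this)
  have hprod : ∀ F : ℝ≥0∞ → ℝ≥0∞, ∏ v ∈ V, F v = ∏ i : Fin V.card, F (e.symm i : V) := fun F => by
    rw [← Finset.prod_coe_sort, ← e.symm.prod_comp]
  simp_rw [hprod]
  have hind2 := hind.comp (fun i (c : ℕ∞) => nexp (((e.symm i : V) : ℝ≥0∞) * (c : ℝ≥0∞)))
    (fun i => measurable_from_top)
  have := lintegral_prod_eq_prod_lintegral_of_indepFun Finset.univ _ hind2
    (fun i => measurable_from_top.comp (hY.measurable_count (f.measurableSet_fiber _)))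
  refine this.trans (Finset.prod_congr rfl fun i _ => ?_)
  exact hY.lintegral_nexp_count (f.measurableSet_fiber _) (hfin _ (e.symm i).2) _

/-- The Laplace functional of a Poisson process. -/
theorem IsPoissonProcess.lintegral_nexp [IsProbabilityMeasure μ] [SigmaFinite Λ]
    (hY : IsPoissonProcess Y Λ μ) {f : E → ℝ≥0∞} (hf : Measurable f) :
    ∫⁻ ω, nexp (∑' n, f (Y n ω)) ∂μ = nexp (∫⁻ y, (1 - nexp (f y)) ∂Λ) := by
  -- Cutting off at the spanning sets makes the supports have finite intensity and keeps the
  -- increasing convergence to `f`.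
  set g : ℕ → SimpleFunc E ℝ≥0∞ := fun m =>
    (SimpleFunc.eapprox f m).restrict (spanningSets Λ m) with hg
  have hgapp : ∀ m y, g m y = (spanningSets Λ m).indicator (SimpleFunc.eapprox f m) y := fun m y =>
    SimpleFunc.restrict_apply _ (measurableSet_spanningSets Λ m) y
  have hmono : ∀ y, Monotone fun m => g m y := fun y m m' h => by
    simp only [hgapp]
    refine (Set.indicator_le_indicator (SimpleFunc.monotone_eapprox f h y)).trans ?_
    exact Set.indicator_le_indicator_of_subset (monotone_spanningSets Λ h)
      (fun _ => zero_le) y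
  have hlim : ∀ y, Tendsto (fun m => g m y) atTop (𝓝 (f y)) := fun y => by
    refine (SimpleFunc.tendsto_eapprox hf y).congr' ?_
    obtain ⟨i, hi⟩ : ∃ i, y ∈ spanningSets Λ i := by
      rw [← Set.mem_iUnion, iUnion_spanningSets]; trivial
    filter_upwards [eventually_ge_atTop i] with m hm
    rw [hgapp, Set.indicator_of_mem (monotone_spanningSets Λ hm hi)]
  have hstep : ∀ m, ∫⁻ ω, nexp (∑' n, g m (Y n ω)) ∂μ = nexp (∫⁻ y, (1 - nexp (g m y)) ∂Λ) := by
    refine fun m => hY.lintegral_nexp_simpleFunc (g m) ?_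
    refine ne_top_of_le_ne_top (measure_spanningSets_lt_top Λ m).ne (measure_mono fun y hy => ?_)
    by_contra h
    exact hy (by rw [hgapp, Set.indicator_of_notMem h])
  have hsum : ∀ ω, Tendsto (fun m => ∑' n, g m (Y n ω)) atTop (𝓝 (∑' n, f (Y n ω))) := fun ω => by
    simp_rw [← lintegral_count]
    exact lintegral_tendsto_of_tendsto_of_monotone (fun m => (measurable_of_countable _).aemeasurable)
      (ae_of_all _ fun n => hmono (Y n ω)) (ae_of_all _ fun n => hlim (Y n ω))
  have hL : Tendsto (fun m => ∫⁻ ω, nexp (∑' n, g m (Y n ω)) ∂μ) atTop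
      (𝓝 (∫⁻ ω, nexp (∑' n, f (Y n ω)) ∂μ)) := by
    refine tendsto_lintegral_of_dominated_convergence (fun _ => 1) (fun m => ?_)
      (fun m => ae_of_all _ fun ω => nexp_le_one _) (by simp)
      (ae_of_all _ fun ω => (continuous_nexp.tendsto _).comp (hsum ω))
    exact measurable_nexp.comp (Measurable.tsum fun n =>
      (g m).measurable.comp (hY.measurable n))
  have hR : Tendsto (fun m => nexp (∫⁻ y, (1 - nexp (g m y)) ∂Λ)) atTop
      (𝓝 (nexp (∫⁻ y, (1 - nexp (f y)) ∂Λ))) := by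
    refine (continuous_nexp.tendsto _).comp ?_
    refine lintegral_tendsto_of_tendsto_of_monotone
      (fun m => (measurable_const.sub (measurable_nexp.comp (g m).measurable)).aemeasurable)
      (ae_of_all _ fun y m m' h => tsub_le_tsub_left (antitone_nexp (hmono y h)) 1)
      (ae_of_all _ fun y => ?_)
    exact ENNReal.Tendsto.sub tendsto_const_nhds ((continuous_nexp.tendsto _).comp (hlim y))
      (Or.inl ENNReal.one_ne_top)
  exact tendsto_nhds_unique hL ((tendsto_congr hstep).2 hR)

end Poisson

end HetNet

end

noncomputable section

namespace HetNet

open Filter Topology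

/-! ### Palm calculus from the Laplace functional -/

/-- The difference quotient `2ⁿ (1 - exp (-x / 2ⁿ))`, which increases to `x`. -/
def expQuot (n : ℕ) (x : ℝ≥0∞) : ℝ≥0∞ := 2 ^ n * (1 - nexp (x / 2 ^ n))

lemma measurable_expQuot (n : ℕ) : Measurable (expQuot n) := by
  unfold expQuot
  exact (measurable_const.sub (measurable_nexp.comp (measurable_id.div_const _))).const_mul _

lemma monotone_expQuot (n : ℕ) : Monotone (expQuot n) := fun x y h => by
  unfold expQuot
  gcongr
  exact antitone_nexp (by gcongr)

/-- With `y = exp (-x / 2 ^ (n + 1))` this is `1 - y² ≤ 2 (1 - y)`, which holds because `1 - y² = (1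
+ y) (1 - y)` and `y ≤ 1`. -/
lemma expQuot_le_succ (n : ℕ) (x : ℝ≥0∞) : expQuot n x ≤ expQuot (n + 1) x := by
  have hx : x / 2 ^ n = x / 2 ^ (n + 1) + x / 2 ^ (n + 1) := by
    rw [← two_mul, pow_succ', ← mul_div_assoc, ENNReal.mul_div_mul_left _ _ (by simp) (by simp)]
  unfold expQuot
  rw [hx, nexp_add, pow_succ, mul_assoc]
  gcongr
  set y := nexp (x / 2 ^ (n + 1)) with hy
  have hy1 : y ≤ 1 := nexp_le_one _
  have hyt : y ≠ ∞ := nexp_ne_top _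
  rw [tsub_le_iff_right]
  calc (1 : ℝ≥0∞) = (1 - y) + y := (tsub_add_cancel_of_le hy1).symm
    _ = (1 - y) + (y * (1 - y) + y * y) := by
        rw [← mul_add, tsub_add_cancel_of_le hy1, mul_one, tsub_add_cancel_of_le hy1]
    _ ≤ (1 - y) + (1 * (1 - y) + y * y) := by gcongr
    _ = 2 * (1 - y) + y * y := by ring

lemma monotone_expQuot_left (x : ℝ≥0∞) : Monotone fun n => expQuot n x :=
  monotone_nat_of_le_succ fun n => expQuot_le_succ n x

/-- For finite `x` this is the derivative of `h ↦ -exp (-h x)` at `0` along `h = 2 ^ (-n)`; for `x =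
∞` the quotient equals `2 ^ n`. -/
lemma tendsto_expQuot (x : ℝ≥0∞) : Tendsto (fun n => expQuot n x) atTop (𝓝 x) := by
  by_cases hx : x = ∞
  · subst hx
    have h : ∀ n, expQuot n ∞ = 2 ^ n := fun n => by
      rw [expQuot, ENNReal.top_div_of_ne_top (by simp)]; simp
    simp_rw [h]
    refine ENNReal.tendsto_nhds_top fun n => ?_
    filter_upwards [eventually_ge_atTop n] with m hm
    exact_mod_cast (hm.trans_lt (Nat.lt_two_pow_self))
  · lift x to NNReal using hx
    have h1 : HasDerivAt (fun h : ℝ => -Real.exp (-(h * x))) (x : ℝ) 0 := by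
      have := (((hasDerivAt_id' (0 : ℝ)).mul_const (x : ℝ)).fun_neg.exp).fun_neg
      simpa using this
    have h2 := h1.tendsto_slope_zero
    have h3 : Tendsto (fun n : ℕ => ((2 : ℝ)⁻¹) ^ n) atTop (𝓝[≠] 0) :=
      tendsto_nhdsWithin_iff.2 ⟨tendsto_pow_atTop_nhds_zero_of_lt_one (by norm_num) (by norm_num),
        .of_forall fun n => by simp⟩
    have h4 := ENNReal.tendsto_ofReal (h2.comp h3)
    rw [ENNReal.ofReal_coe_nnreal] at h4
    refine h4.congr fun n => ?_
    have hd : (x : ℝ≥0∞) / 2 ^ n = ENNReal.ofReal ((2⁻¹) ^ n * (x : ℝ)) := by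
      rw [ENNReal.ofReal_mul (by positivity), ENNReal.ofReal_coe_nnreal,
        ENNReal.ofReal_pow (by positivity), ENNReal.ofReal_inv_of_pos (by norm_num), div_eq_mul_inv,
        mul_comm, ENNReal.inv_pow]
      simp
    rw [expQuot, hd, nexp_ofReal (by positivity), ← ENNReal.ofReal_one,
      ← ENNReal.ofReal_sub _ (by positivity)]
    have h2n : (2 : ℝ≥0∞) ^ n = ENNReal.ofReal (2 ^ n) := by
      rw [ENNReal.ofReal_pow (by norm_num)]; simp
    rw [h2n, ← ENNReal.ofReal_mul (by positivity)]
    congr 1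
    simp
    ring

lemma iSup_expQuot (x : ℝ≥0∞) : ⨆ n, expQuot n x = x :=
  iSup_eq_of_tendsto (monotone_expQuot_left x) (tendsto_expQuot x)

lemma expQuot_le (n : ℕ) (x : ℝ≥0∞) : expQuot n x ≤ x :=
  (le_iSup (fun n => expQuot n x) n).trans_eq (iSup_expQuot x)

lemma iSup_expQuot_diag {y : ℕ → ℝ≥0∞} (hy : Monotone y) :
    ⨆ n, expQuot n (y n) = ⨆ n, y n := by
  refine le_antisymm (iSup_mono fun n => expQuot_le n _) (iSup_le fun m => ?_)
  rw [← iSup_expQuot (y m)]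
  refine iSup_le fun n => (le_trans ?_ (le_iSup _ (max n m)))
  exact (monotone_expQuot_left _ (le_max_left n m)).trans
    (monotone_expQuot _ (hy (le_max_right n m)))

section Laplace

variable {ι Ω T : Type*} [MeasurableSpace Ω] [MeasurableSpace T]

/-- The points `X b`, `b : ι`, have the Laplace functional of a Poisson process with intensity
measure `M`. -/
def HasLaplace (X : ι → Ω → T) (M : Measure T) (μ : Measure Ω) : Prop :=
  ∀ φ : T → ℝ≥0∞, Measurable φ →
    ∫⁻ ω, nexp (∑' b, φ (X b ω)) ∂μ = nexp (∫⁻ t, (1 - nexp (φ t)) ∂M)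

variable [Countable ι] {X : ι → Ω → T} {M : Measure T} {μ : Measure Ω}

/-- This is the derivative of the Laplace functional at `φ` in the direction `a`. The difference
quotients with step `2 ^ (-n)` increase on both sides, so monotone convergence suffices and `a` need
not be integrable. -/
lemma HasLaplace.lintegral_tsum_mul_nexp [IsProbabilityMeasure μ] (hX : HasLaplace X M μ)
    (hm : ∀ b, Measurable (X b)) {a φ : T → ℝ≥0∞} (ha : Measurable a) (hφ : Measurable φ) :
    ∫⁻ ω, (∑' b, a (X b ω)) * nexp (∑' b, φ (X b ω)) ∂μ
      = (∫⁻ t, a t * nexp (φ t) ∂M) * nexp (∫⁻ t, (1 - nexp (φ t)) ∂M) := by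
  have hS : ∀ {g : T → ℝ≥0∞}, Measurable g → Measurable fun ω => ∑' b, g (X b ω) :=
    fun hg => Measurable.tsum fun b => hg.comp (hm b)
  set c := ∫⁻ t, (1 - nexp (φ t)) ∂M with hc
  set y : ℕ → ℝ≥0∞ := fun n => ∫⁻ t, expQuot n (a t) * nexp (φ t) ∂M with hy
  have hymono : Monotone y := fun n m h =>
    lintegral_mono fun t => mul_le_mul_left (monotone_expQuot_left _ h) _
  have hysup : ⨆ n, y n = ∫⁻ t, a t * nexp (φ t) ∂M := by
    refine (lintegral_iSup (fun n => ((measurable_expQuot n).comp ha).mul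
      (measurable_nexp.comp hφ))
      (fun n m h t => mul_le_mul_left (monotone_expQuot_left _ h) _)).symm.trans ?_
    refine lintegral_congr fun t => ?_
    simp only [Pi.mul_apply, Function.comp_apply, ← ENNReal.iSup_mul, iSup_expQuot]
  -- Subtract the Laplace functionals at `φ` and `φ + a / 2 ^ n`. The exponents differ by `y n / 2 ^
  -- n`, so the right side is again a difference quotient, now at `y n`.
  have hstep : ∀ n, ∫⁻ ω, expQuot n (∑' b, a (X b ω)) * nexp (∑' b, φ (X b ω)) ∂μ
      = expQuot n (y n) * nexp c := by
    intro n
    have h2 : (2 : ℝ≥0∞) ^ n ≠ 0 := by simp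
    have h2t : (2 : ℝ≥0∞) ^ n ≠ ∞ := by simp
    have hsub : ∀ u v : ℝ≥0∞, (1 - nexp u) * nexp v = nexp v - nexp (v + u) := fun u v => by
      rw [ENNReal.sub_mul (fun _ _ => nexp_ne_top _), one_mul, nexp_add, mul_comm]
    have hyn : y n = 2 ^ n * ∫⁻ t, (1 - nexp (a t / 2 ^ n)) * nexp (φ t) ∂M := by
      rw [hy, ← lintegral_const_mul]
      · simp only [expQuot, mul_assoc]
      · fun_prop
    have hR : expQuot n (y n) * nexp c = 2 ^ n *
        (nexp c - nexp (c + ∫⁻ t, (1 - nexp (a t / 2 ^ n)) * nexp (φ t) ∂M)) := by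
      rw [expQuot, mul_assoc, hsub, hyn, mul_div_assoc, ENNReal.mul_div_cancel h2 h2t]
    have hint : c + ∫⁻ t, (1 - nexp (a t / 2 ^ n)) * nexp (φ t) ∂M
        = ∫⁻ t, (1 - nexp (φ t + a t / 2 ^ n)) ∂M := by
      rw [hc, ← lintegral_add_left (by fun_prop)]
      refine lintegral_congr fun t => ?_
      rw [hsub, tsub_add_tsub_cancel (nexp_le_one _) (antitone_nexp le_self_add)]
    rw [hR, hint, ← hX φ hφ, ← hX (fun t => φ t + a t / 2 ^ n) (by fun_prop)]
    have hd : ∀ ω, ∑' b, (φ (X b ω) + a (X b ω) / 2 ^ n)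
        = ∑' b, φ (X b ω) + (∑' b, a (X b ω)) / 2 ^ n := fun ω => by
      rw [ENNReal.tsum_add]; simp_rw [div_eq_mul_inv, ENNReal.tsum_mul_right]
    simp_rw [hd]
    have hm1 : Measurable fun ω => nexp (∑' b, φ (X b ω) + (∑' b, a (X b ω)) / 2 ^ n) :=
      measurable_nexp.comp ((hS hφ).add ((hS ha).div_const _))
    rw [← lintegral_sub hm1 (ne_top_of_le_ne_top ENNReal.one_ne_top ?_)
      (ae_of_all _ fun ω => antitone_nexp le_self_add), ← lintegral_const_mul]
    · refine lintegral_congr fun ω => ?_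
      rw [expQuot, mul_assoc, hsub]
    · exact (measurable_nexp.comp (hS hφ)).sub hm1
    · exact (lintegral_mono fun ω => nexp_le_one _).trans (by simp)
  calc ∫⁻ ω, (∑' b, a (X b ω)) * nexp (∑' b, φ (X b ω)) ∂μ
      = ∫⁻ ω, ⨆ n, expQuot n (∑' b, a (X b ω)) * nexp (∑' b, φ (X b ω)) ∂μ := by
        simp_rw [← ENNReal.iSup_mul, iSup_expQuot]
    _ = ⨆ n, ∫⁻ ω, expQuot n (∑' b, a (X b ω)) * nexp (∑' b, φ (X b ω)) ∂μ :=
        lintegral_iSup (fun n => ((measurable_expQuot n).comp (hS ha)).mul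
          (measurable_nexp.comp (hS hφ)))
          (fun n m h t => mul_le_mul_left (monotone_expQuot_left _ h) _)
    _ = _ := by
        simp_rw [hstep, ← ENNReal.iSup_mul, iSup_expQuot_diag hymono, hysup]

/-- Campbell's formula. -/
lemma HasLaplace.lintegral_tsum [IsProbabilityMeasure μ] (hX : HasLaplace X M μ)
    (hm : ∀ b, Measurable (X b)) {a : T → ℝ≥0∞} (ha : Measurable a) :
    ∫⁻ ω, ∑' b, a (X b ω) ∂μ = ∫⁻ t, a t ∂M := by
  simpa using hX.lintegral_tsum_mul_nexp hm ha (measurable_const (a := (0 : ℝ≥0∞)))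

lemma tendsto_tsum_of_monotone {v : ℕ → ι → ℝ≥0∞} {w : ι → ℝ≥0∞} (hmono : ∀ b, Monotone (v · b))
    (hlim : ∀ b, Tendsto (v · b) atTop (𝓝 (w b))) :
    Tendsto (fun n => ∑' b, v n b) atTop (𝓝 (∑' b, w b)) := by
  let _ : MeasurableSpace ι := ⊤
  simp_rw [← lintegral_count]
  exact lintegral_tendsto_of_tendsto_of_monotone (fun m => (measurable_of_countable _).aemeasurable)
      (ae_of_all _ hmono) (ae_of_all _ hlim)

lemma tendsto_tsum_of_dominated {v : ℕ → ι → ℝ≥0∞} {w : ι → ℝ≥0∞} {g : ι → ℝ≥0∞}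
    (hg : ∑' b, g b ≠ ∞) (hle : ∀ n b, v n b ≤ g b)
    (hlim : ∀ b, Tendsto (v · b) atTop (𝓝 (w b))) :
    Tendsto (fun n => ∑' b, v n b) atTop (𝓝 (∑' b, w b)) := by
  let _ : MeasurableSpace ι := ⊤
  simp_rw [← lintegral_count] at hg ⊢
  exact tendsto_lintegral_of_dominated_convergence g (fun m => measurable_of_countable _)
    (fun n => ae_of_all _ (hle n)) hg (ae_of_all _ hlim)

/-- Mecke's formula for functionals of the form `f (t) exp (- ∑ φ (κ t) (·))`, where the sum includes
the point `t`. -/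
theorem HasLaplace.mecke [IsProbabilityMeasure μ] [SFinite M] (hX : HasLaplace X M μ)
    (hm : ∀ b, Measurable (X b)) {f κ : T → ℝ≥0∞} (hf : Measurable f) (hκ : Measurable κ)
    (hfin : ∫⁻ t, f t ∂M ≠ ∞) {φ : ℝ≥0∞ → T → ℝ≥0∞} (hφ : Measurable (Function.uncurry φ))
    (hmono : ∀ t, Monotone (φ · t))
    (hsup : ∀ t (v : ℕ → ℝ≥0∞), Monotone v → φ (⨆ n, v n) t = ⨆ n, φ (v n) t) :
    ∫⁻ ω, ∑' b, f (X b ω) * nexp (∑' b', φ (κ (X b ω)) (X b' ω)) ∂μ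
      = ∫⁻ t, f t * (nexp (φ (κ t) t) * nexp (∫⁻ t', (1 - nexp (φ (κ t) t')) ∂M)) ∂M := by
  classical
  -- If `κ` takes finitely many values, the sum splits over its level sets; on each of them the
  -- exponent no longer depends on the chosen point and `lintegral_tsum_mul_nexp` applies. The
  -- general case follows by approximating `κ` from below.
  set e : ℕ → SimpleFunc ℝ≥0∞ ℝ≥0∞ := SimpleFunc.eapprox id with he
  have hemono : ∀ v, Monotone fun n => e n v := fun v n m h => SimpleFunc.monotone_eapprox id h v
  have hφv : ∀ v, Measurable (φ v) := fun v => hφ.comp measurable_prodMk_left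
  have hlimφ : ∀ v t, Tendsto (fun n => φ (e n v) t) atTop (𝓝 (φ v t)) := fun v t => by
    have := hsup t _ (hemono v)
    rw [SimpleFunc.iSup_eapprox_apply measurable_id, id] at this
    rw [this]
    exact tendsto_atTop_iSup ((hmono t).comp (hemono v))
  have hS : ∀ {κ' : T → ℝ≥0∞}, Measurable κ' → ∀ b,
      Measurable fun ω => f (X b ω) * nexp (∑' b', φ (κ' (X b ω)) (X b' ω)) := fun hκ' b =>
    (hf.comp (hm b)).mul (measurable_nexp.comp (Measurable.tsum fun b' =>
      hφ.comp ((hκ'.comp (hm b)).prodMk (hm b'))))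
  have hI : ∀ {κ' : T → ℝ≥0∞}, Measurable κ' →
      Measurable fun t => f t * (nexp (φ (κ' t) t) * nexp (∫⁻ t', (1 - nexp (φ (κ' t) t')) ∂M)) := by
    intro κ' hκ'
    refine hf.mul ((measurable_nexp.comp (hφ.comp (hκ'.prodMk measurable_id))).mul
      (measurable_nexp.comp ?_))
    exact Measurable.lintegral_prod_right' (f := fun q : T × T => 1 - nexp (φ (κ' q.1) q.2))
      (measurable_const.sub (measurable_nexp.comp
        (hφ.comp ((hκ'.comp measurable_fst).prodMk measurable_snd))))
  have hstep : ∀ n, ∫⁻ ω, ∑' b, f (X b ω) * nexp (∑' b', φ (e n (κ (X b ω))) (X b' ω)) ∂μ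
      = ∫⁻ t, f t * (nexp (φ (e n (κ t)) t) *
          nexp (∫⁻ t', (1 - nexp (φ (e n (κ t)) t')) ∂M)) ∂M := by
    intro n
    set A : ℝ≥0∞ → Set T := fun v => {t | e n (κ t) = v} with hA
    have hAm : ∀ v, MeasurableSet (A v) := fun v => hκ ((e n).measurableSet_fiber v)
    have hsplit : ∀ (F : ℝ≥0∞ → ℝ≥0∞) (t : T), f t * F (e n (κ t))
        = ∑ v ∈ (e n).range, (A v).indicator f t * F v := fun F t => by
      rw [Finset.sum_eq_single_of_mem (e n (κ t)) (by simp)]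
      · rw [Set.indicator_of_mem (show t ∈ A (e n (κ t)) from rfl)]
      · intro v _ hv
        rw [Set.indicator_of_notMem (fun h : t ∈ A v => hv h.symm), zero_mul]
    have hL : ∀ ω, ∑' b, f (X b ω) * nexp (∑' b', φ (e n (κ (X b ω))) (X b' ω))
        = ∑ v ∈ (e n).range, (∑' b, (A v).indicator f (X b ω)) * nexp (∑' b', φ v (X b' ω)) := by
      intro ω
      rw [tsum_congr fun b => hsplit (fun v => nexp (∑' b', φ v (X b' ω))) (X b ω),
        Summable.tsum_finsetSum fun _ _ => ENNReal.summable]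
      simp_rw [ENNReal.tsum_mul_right]
    have hRt : ∀ t, f t * (nexp (φ (e n (κ t)) t) * nexp (∫⁻ t', (1 - nexp (φ (e n (κ t)) t')) ∂M))
        = ∑ v ∈ (e n).range, (A v).indicator f t *
          (nexp (φ v t) * nexp (∫⁻ t', (1 - nexp (φ v t')) ∂M)) := fun t =>
      hsplit (fun v => nexp (φ v t) * nexp (∫⁻ t', (1 - nexp (φ v t')) ∂M)) t
    rw [lintegral_congr hL, lintegral_finsetSum]
    · rw [lintegral_congr hRt, lintegral_finsetSum]
      · refine Finset.sum_congr rfl fun v _ => ?_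
        rw [hX.lintegral_tsum_mul_nexp hm (hf.indicator (hAm v)) (hφv v)]
        refine (lintegral_mul_const _ ((hf.indicator (hAm v)).mul
          (measurable_nexp.comp (hφv v)))).symm.trans (lintegral_congr fun t => ?_)
        exact mul_assoc _ _ _
      · exact fun v _ => (hf.indicator (hAm v)).mul ((measurable_nexp.comp (hφv v)).mul_const _)
    · exact fun v _ => (Measurable.tsum fun b => (hf.indicator (hAm v)).comp (hm b)).mul
        (measurable_nexp.comp (Measurable.tsum fun b => (hφv v).comp (hm b)))
  have hle : ∀ u v : ℝ≥0∞, u * nexp v ≤ u := fun u v => mul_le_of_le_one_right' (nexp_le_one v)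
  have hfin' : ∫⁻ ω, ∑' b, f (X b ω) ∂μ ≠ ∞ := by rwa [hX.lintegral_tsum hm hf]
  have hcont : ∀ {u : ℕ → ℝ≥0∞} {w : ℝ≥0∞}, Tendsto u atTop (𝓝 w) →
      Tendsto (fun n => nexp (u n)) atTop (𝓝 (nexp w)) :=
    fun h => (continuous_nexp.tendsto _).comp h
  have hL : Tendsto (fun n => ∫⁻ ω, ∑' b, f (X b ω) *
        nexp (∑' b', φ (e n (κ (X b ω))) (X b' ω)) ∂μ) atTop
      (𝓝 (∫⁻ ω, ∑' b, f (X b ω) * nexp (∑' b', φ (κ (X b ω)) (X b' ω)) ∂μ)) := by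
    -- The integrands decrease as the approximation of `κ` increases, so a dominating function is
    -- needed; this is the role of `hfin`.
    refine tendsto_lintegral_of_dominated_convergence (fun ω => ∑' b, f (X b ω))
      (fun n => Measurable.tsum (hS ((e n).measurable.comp hκ)))
      (fun n => ae_of_all _ fun ω => ENNReal.tsum_le_tsum fun b => hle _ _) hfin' ?_
    filter_upwards [ae_lt_top (Measurable.tsum fun b => hf.comp (hm b)) hfin'] with ω hω
    refine tendsto_tsum_of_dominated hω.ne (fun n b => hle _ _) fun b => ?_
    have hb : f (X b ω) ≠ ∞ := ne_top_of_le_ne_top hω.ne (ENNReal.le_tsum b)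
    refine ENNReal.Tendsto.const_mul (hcont ?_) (Or.inr hb)
    exact tendsto_tsum_of_monotone (fun b' => (hmono _).comp (hemono _)) fun b' => hlimφ _ _
  have hR : Tendsto (fun n => ∫⁻ t, f t * (nexp (φ (e n (κ t)) t) *
        nexp (∫⁻ t', (1 - nexp (φ (e n (κ t)) t')) ∂M)) ∂M) atTop
      (𝓝 (∫⁻ t, f t * (nexp (φ (κ t) t) * nexp (∫⁻ t', (1 - nexp (φ (κ t) t')) ∂M)) ∂M)) := by
    refine tendsto_lintegral_of_dominated_convergence f
      (fun n => hI ((e n).measurable.comp hκ))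
      (fun n => ae_of_all _ fun t => by simp only [← nexp_add]; exact hle _ _) hfin ?_
    filter_upwards [ae_lt_top hf hfin] with t ht
    refine ENNReal.Tendsto.const_mul ?_ (Or.inr ht.ne)
    refine ENNReal.Tendsto.mul (hcont (hlimφ _ _)) (Or.inr (nexp_ne_top _)) (hcont ?_)
      (Or.inr (nexp_ne_top _))
    refine lintegral_tendsto_of_tendsto_of_monotone
      (fun n => (measurable_const.sub (measurable_nexp.comp (hφv _))).aemeasurable)
      (ae_of_all _ fun t' n m h =>
        tsub_le_tsub_left (antitone_nexp (hmono _ (hemono _ h))) 1) (ae_of_all _ fun t' => ?_)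
    exact ENNReal.Tendsto.sub tendsto_const_nhds (hcont (hlimφ _ _)) (Or.inl ENNReal.one_ne_top)
  exact tendsto_nhds_unique hL ((tendsto_congr hstep).2 hR)

end Laplace

end HetNet

end

/-! ### Independent links: the stations with their marks form a Poisson process -/

noncomputable section

namespace HetNet

open Filter Topology

section Indep

variable {Ω E F : Type*} [MeasurableSpace Ω] {μ : Measure Ω}

/-- Integration of a function of two independent random elements. -/
lemma lintegral_comp_of_indepFun [IsProbabilityMeasure μ] [MeasurableSpace E] [MeasurableSpace F]
    {V : Ω → E} {W : Ω → F}
    (hV : Measurable V) (hW : Measurable W) (h : IndepFun V W μ) {g : E × F → ℝ≥0∞}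
    (hg : Measurable g) :
    ∫⁻ ω, g (V ω, W ω) ∂μ = ∫⁻ ω, ∫⁻ ω', g (V ω, W ω') ∂μ ∂μ := by
  have h1 := (indepFun_iff_map_prod_eq_prod_map_map hV.aemeasurable hW.aemeasurable).1 h
  have := Measure.isProbabilityMeasure_map (μ := μ) hV.aemeasurable
  have := Measure.isProbabilityMeasure_map (μ := μ) hW.aemeasurable
  rw [← lintegral_map hg (hV.prodMk hW), h1, lintegral_prod _ hg.aemeasurable,
    lintegral_map hg.lintegral_prod_right' hV]
  exact lintegral_congr fun ω => lintegral_map (hg.comp measurable_prodMk_left) hW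

end Indep

/-- Integration of a function of a random element `W` which is independent of a σ-algebra `m`. -/
lemma lintegral_comp_of_indep {Ω F : Type*} {m m' mΩ : MeasurableSpace Ω}
    {μ : Measure Ω} [IsProbabilityMeasure μ] [MeasurableSpace F] (hm : m ≤ mΩ) (hm' : m' ≤ mΩ)
    (h : Indep m' m μ) {W : Ω → F} (hW : Measurable[m'] W) {g : F × Ω → ℝ≥0∞}
    (hg : Measurable[Prod.instMeasurableSpace (m₂ := m)] g) :
    ∫⁻ ω, g (W ω, ω) ∂μ = ∫⁻ ω, ∫⁻ ω', g (W ω, ω') ∂μ ∂μ := by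
  refine @lintegral_comp_of_indepFun Ω F Ω mΩ μ _ _ m W id (hW.mono hm' le_rfl)
    (fun s hs => hm s hs) ?_ g hg
  exact indep_of_indep_of_le_right
    (indep_of_indep_of_le_left h hW.comap_le) (le_of_eq MeasurableSpace.comap_id)

namespace Params

variable {K : ℕ} (p : Params K)

/-- The distribution of the availability of a base station. -/
def onLaw (j : Fin K) : Measure Bool :=
  ENNReal.ofReal (p.avail j) • Measure.dirac true +
    ENNReal.ofReal (1 - p.avail j) • Measure.dirac false

lemma isProbabilityMeasure_onLaw (hp : p.Admissible) (j : Fin K) :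
    IsProbabilityMeasure (p.onLaw j) := by
  constructor
  simp only [onLaw, Measure.add_apply, Measure.smul_apply, measure_univ, smul_eq_mul, mul_one]
  rw [← ENNReal.ofReal_add (hp.avail_nonneg j) (by linarith [hp.avail_le_one j])]
  simp

/-- The intensity measure of the base stations of tier `j`. -/
abbrev bsIntensity (j : Fin K) : Measure Plane :=
  ENNReal.ofReal (p.density j) • (volume : Measure Plane)

instance sigmaFinite_ofReal_smul (c : ℝ) :
    SigmaFinite (ENNReal.ofReal c • (volume : Measure Plane)) :=
  inferInstanceAs (SigmaFinite (Real.toNNReal c • (volume : Measure Plane)))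

/-- The distribution of availability, shadowing gain and fading gain of a link. -/
def linkLaw (j : Fin K) : Measure (Bool × ℝ × ℝ) :=
  (p.onLaw j).prod ((p.shadowLaw j).prod (expMeasure 1))

lemma isProbabilityMeasure_linkLaw (hp : p.Admissible) (j : Fin K) :
    IsProbabilityMeasure (p.linkLaw j) := by
  have := p.isProbabilityMeasure_onLaw hp j
  have := hp.shadow_prob j
  have := isProbabilityMeasure_expMeasure one_pos
  unfold linkLaw; infer_instance

/-- The power `u ^ (-2/α)` of the long term received power `u`, a measure of the distance between
the location `z` and a base station of tier `j` at `x` with shadowing gain `g`; it is infinite if the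
base station is not available. -/
def effDist (z : Plane) (j : Fin K) (x : Plane) (o : Bool) (g : ℝ) : ℝ≥0∞ :=
  if o = true then ENNReal.ofReal (p.power j * g * ‖x - z‖ ^ (-p.alpha)) ^ (-(2 / p.alpha)) else ∞

/-- The data of a base station that matter for a receiver: tier, location, effective distance, and
fading gain. -/
abbrev Data (K : ℕ) : Type := Fin K × Plane × ℝ≥0∞ × ℝ≥0∞

/-- The data of a base station of tier `j` at `x` for a receiver at `z`. -/
def data (z : Plane) (j : Fin K) (x : Plane) (q : Bool × ℝ × ℝ) : Data K :=
  (j, x, p.effDist z j x q.1 q.2.1, ENNReal.ofReal q.2.2)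

lemma measurable_effDist (j : Fin K) :
    Measurable fun q : Plane × Plane × Bool × ℝ => p.effDist q.1 j q.2.1 q.2.2.1 q.2.2.2 := by
  unfold effDist
  refine Measurable.ite ?_ (by fun_prop) measurable_const
  exact (measurable_fst.comp (measurable_snd.comp measurable_snd)) (measurableSet_singleton true)

lemma measurable_data (j : Fin K) :
    Measurable fun q : Plane × Plane × Bool × ℝ × ℝ => p.data q.1 j q.2.1 q.2.2 := by
  unfold data
  have := (p.measurable_effDist j).comp (f := fun q : Plane × Plane × Bool × ℝ × ℝ =>
    (q.1, q.2.1, q.2.2.1, q.2.2.2.1)) (by fun_prop)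
  exact measurable_const.prodMk ((by fun_prop : Measurable fun q : Plane × Plane × Bool × ℝ × ℝ =>
    q.2.1).prodMk (this.prodMk (by fun_prop)))

lemma measurable_data_right (z : Plane) (j : Fin K) :
    Measurable fun q : Plane × Bool × ℝ × ℝ => p.data z j q.1 q.2 :=
  (p.measurable_data j).comp measurable_prodMk_left

/-- The intensity measure of the data of all base stations, for a receiver at `z`. -/
def dataIntensity (z : Plane) : Measure (Data K) :=
  Measure.sum fun j => ((p.bsIntensity j).prod (p.linkLaw j)).map fun q => p.data z j q.1 q.2

lemma sFinite_dataIntensity (hp : p.Admissible) (z : Plane) : SFinite (p.dataIntensity z) := by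
  have := p.isProbabilityMeasure_linkLaw hp
  unfold dataIntensity; infer_instance

lemma lintegral_dataIntensity (hp : p.Admissible) (z : Plane) {f : Data K → ℝ≥0∞}
    (hf : Measurable f) : ∫⁻ t, f t ∂(p.dataIntensity z)
      = ∑ j, ∫⁻ x, ∫⁻ q, f (p.data z j x q) ∂(p.linkLaw j) ∂(p.bsIntensity j) := by
  have := p.isProbabilityMeasure_linkLaw hp
  rw [dataIntensity, lintegral_sum_measure, tsum_fintype]
  refine Finset.sum_congr rfl fun j _ => ?_
  rw [lintegral_map hf (p.measurable_data_right z j), lintegral_prod]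
  exact (hf.comp (p.measurable_data_right z j)).aemeasurable

end Params

namespace Network

variable {K : ℕ} {Ω S : Type*} (net : Network K Ω S)

/-- The data of base station `b` for a receiver at `z` with the fading gains of receiver `r`. -/
def data (p : Params K) (z : Plane) (r : Receiver) (b : Fin K × ℕ) (ω : Ω) : Params.Data K :=
  p.data z b.1 (net.bs b.1 b.2 ω) (net.on b.1 b.2 ω,
    net.gain b.1 (net.bs b.1 b.2 ω) z (net.env b.1 b.2 ω), net.fading b.1 b.2 r ω)

/-- The σ-algebra generated by a set of sources. -/
@[reducible]
def sigmaOf [MeasurableSpace S] (A : Set (Source K)) : MeasurableSpace Ω := ⨆ s ∈ A, net.sigma s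

section

variable [MeasurableSpace S] {A : Set (Source K)}

lemma measurable_bs_sigmaOf {j : Fin K} (h : Source.bs j ∈ A) (n : ℕ) :
    Measurable[net.sigmaOf A] (net.bs j n) := by
  have h1 : Measurable[net.sigma (.bs j)] (fun ω n => net.bs j n ω) := comap_measurable _
  exact ((measurable_pi_apply n).comp h1).mono (le_iSup₂ (f := fun s _ => net.sigma s) _ h) le_rfl

lemma measurable_user_sigmaOf (h : Source.user ∈ A) (n : ℕ) :
    Measurable[net.sigmaOf A] (net.user n) := by
  have h1 : Measurable[net.sigma .user] (fun ω n => net.user n ω) := comap_measurable _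
  exact ((measurable_pi_apply n).comp h1).mono (le_iSup₂ (f := fun s _ => net.sigma s) _ h) le_rfl

lemma measurable_on_sigmaOf {j : Fin K} {n : ℕ} (h : Source.on j n ∈ A) :
    Measurable[net.sigmaOf A] (net.on j n) := by
  have h1 : Measurable[net.sigma (.on j n)] (net.on j n) := comap_measurable _
  exact h1.mono (le_iSup₂ (f := fun s _ => net.sigma s) _ h) le_rfl

lemma measurable_env_sigmaOf {j : Fin K} {n : ℕ} (h : Source.env j n ∈ A) :
    Measurable[net.sigmaOf A] (net.env j n) := by
  have h1 : Measurable[net.sigma (.env j n)] (net.env j n) := comap_measurable _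
  exact h1.mono (le_iSup₂ (f := fun s _ => net.sigma s) _ h) le_rfl

lemma measurable_fading_sigmaOf {j : Fin K} {n : ℕ} (h : Source.fading j n ∈ A) (r : Receiver) :
    Measurable[net.sigmaOf A] (net.fading j n r) := by
  have h1 : Measurable[net.sigma (.fading j n)] (fun ω r => net.fading j n r ω) :=
    comap_measurable _
  exact ((measurable_pi_apply r).comp h1).mono (le_iSup₂ (f := fun s _ => net.sigma s) _ h) le_rfl

end

variable {net}

lemma measurable_data_uncurry {Ω' : Type*} [MeasurableSpace Ω'] [MeasurableSpace S]
    (hg : ∀ j, Measurable (fun q : Plane × Plane × S => net.gain j q.1 q.2.1 q.2.2))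
    (p : Params K) {z : Ω' → Plane} {b : Fin K × ℕ} {r : Receiver} {g : Ω' → Ω} (hz : Measurable z)
    (hbs : Measurable fun ω => net.bs b.1 b.2 (g ω)) (hon : Measurable fun ω => net.on b.1 b.2 (g ω))
    (henv : Measurable fun ω => net.env b.1 b.2 (g ω))
    (hfad : Measurable fun ω => net.fading b.1 b.2 r (g ω)) :
    Measurable fun ω => net.data p (z ω) r b (g ω) :=
  (p.measurable_data b.1).comp (hz.prodMk (hbs.prodMk (hon.prodMk
    (((hg b.1).comp (hbs.prodMk (hz.prodMk henv))).prodMk hfad))))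

variable [MeasurableSpace Ω] [MeasurableSpace S] {p : Params K} {μ : Measure Ω}

lemma IsModel.sigma_le (hnet : net.IsModel p μ) (s : Source K) :
    net.sigma s ≤ ‹MeasurableSpace Ω› := by
  cases s with
  | bs j => exact (measurable_pi_lambda _ fun n => (hnet.bs_poisson j).measurable n).comap_le
  | user => exact (measurable_pi_lambda _ fun n => hnet.user_poisson.measurable n).comap_le
  | on j n => exact (hnet.on_measurable j n).comap_le
  | env j n => exact (hnet.env_measurable j n).comap_le
  | fading j n => exact (measurable_pi_lambda _ fun r => hnet.fading_measurable j n r).comap_le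

lemma IsModel.sigmaOf_le (hnet : net.IsModel p μ) (A : Set (Source K)) :
    net.sigmaOf A ≤ ‹MeasurableSpace Ω› := iSup₂_le fun s _ => hnet.sigma_le s

lemma IsModel.indep_sigmaOf (hnet : net.IsModel p μ) {A B : Set (Source K)} (h : Disjoint A B) :
    Indep (net.sigmaOf A) (net.sigmaOf B) μ :=
  indep_iSup_of_disjoint hnet.sigma_le hnet.indep h

lemma IsModel.measurable_data (hnet : net.IsModel p μ) (z : Plane) (r : Receiver) (b : Fin K × ℕ) :
    Measurable (net.data p z r b) :=
  measurable_data_uncurry (g := id) hnet.gain_measurable p measurable_const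
    ((hnet.bs_poisson b.1).measurable b.2) (hnet.on_measurable _ _) (hnet.env_measurable _ _)
    (hnet.fading_measurable _ _ _)

lemma IsModel.map_on (hnet : net.IsModel p μ) [IsProbabilityMeasure μ] (hp : p.Admissible)
    (j : Fin K) (n : ℕ) : μ.map (net.on j n) = p.onLaw j := by
  have h1 : μ.map (net.on j n) {true} = ENNReal.ofReal (p.avail j) := by
    rw [Measure.map_apply (hnet.on_measurable j n) (measurableSet_singleton _)]
    exact hnet.on_prob j n
  have hpr := Measure.isProbabilityMeasure_map (μ := μ) (hnet.on_measurable j n).aemeasurable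
  refine Measure.ext_of_singleton fun o => ?_
  cases o with
  | true => rw [h1]; simp [Params.onLaw]
  | false =>
    have h2 : ({false} : Set Bool) = {true}ᶜ := by ext o; cases o <;> simp
    rw [h2, prob_compl_eq_one_sub (measurableSet_singleton _), h1, ← h2]
    rw [← ENNReal.ofReal_one, ← ENNReal.ofReal_sub _ (hp.avail_nonneg j)]
    simp [Params.onLaw]

/-- The law of the link from a base station to `z`, given that the base station is at `x`. -/
lemma IsModel.lintegral_link (hnet : net.IsModel p μ) [IsProbabilityMeasure μ] (hp : p.Admissible)
    (b : Fin K × ℕ) (x z : Plane) (r : Receiver) {f : Bool × ℝ × ℝ → ℝ≥0∞} (hf : Measurable f) :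
    ∫⁻ ω, f (net.on b.1 b.2 ω, net.gain b.1 x z (net.env b.1 b.2 ω), net.fading b.1 b.2 r ω) ∂μ
      = ∫⁻ q, f q ∂(p.linkLaw b.1) := by
  have := p.isProbabilityMeasure_onLaw hp b.1
  have := hp.shadow_prob b.1
  have := isProbabilityMeasure_expMeasure one_pos
  have hgain : Measurable (net.gain b.1 x z) :=
    (hnet.gain_measurable b.1).comp (measurable_const.prodMk (measurable_const.prodMk measurable_id))
  have hg : Measurable fun ω => net.gain b.1 x z (net.env b.1 b.2 ω) :=
    hgain.comp (hnet.env_measurable _ _)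
  have h1 : IndepFun (fun ω => net.gain b.1 x z (net.env b.1 b.2 ω)) (net.fading b.1 b.2 r) μ := by
    refine indep_of_indep_of_le_left (indep_of_indep_of_le_right
      (hnet.indep_sigmaOf (A := {.env b.1 b.2}) (B := {.fading b.1 b.2}) (by simp)) ?_) ?_
    · exact (net.measurable_fading_sigmaOf (by simp) r).comap_le
    · exact (hgain.comp (net.measurable_env_sigmaOf (by simp))).comap_le
  have h2 : IndepFun (net.on b.1 b.2)
      (fun ω => (net.gain b.1 x z (net.env b.1 b.2 ω), net.fading b.1 b.2 r ω)) μ := by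
    refine indep_of_indep_of_le_left (indep_of_indep_of_le_right
      (hnet.indep_sigmaOf (A := {.on b.1 b.2}) (B := {.env b.1 b.2, .fading b.1 b.2})
        (by simp)) ?_) ?_
    · exact ((hgain.comp (net.measurable_env_sigmaOf (by simp))).prodMk
        (net.measurable_fading_sigmaOf (by simp) r)).comap_le
    · exact (net.measurable_on_sigmaOf (by simp)).comap_le
  have hfm := hnet.fading_measurable b.1 b.2 r
  have hon := hnet.on_measurable b.1 b.2
  rw [Params.linkLaw, ← hnet.map_on hp b.1 b.2, ← hnet.gain_law b.1 b.2 x z,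
    ← hnet.fading_law b.1 b.2 r,
    ← (indepFun_iff_map_prod_eq_prod_map_map hg.aemeasurable hfm.aemeasurable).1 h1,
    ← (indepFun_iff_map_prod_eq_prod_map_map hon.aemeasurable (hg.prodMk hfm).aemeasurable).1 h2,
    lintegral_map hf (hon.prodMk (hg.prodMk hfm))]

/-- The sources of randomness of the link of a base station. -/
def linkSources (b : Fin K × ℕ) : Set (Source K) :=
  {.on b.1 b.2, .env b.1 b.2, .fading b.1 b.2}

/-- The mean of a function of the data of a base station of tier `j` at `x`. -/
def dataMean (p : Params K) (z : Plane) (g : Params.Data K → ℝ≥0∞) (j : Fin K) (x : Plane) : ℝ≥0∞ :=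
  ∫⁻ q, g (p.data z j x q) ∂(p.linkLaw j)

lemma measurable_dataMean (hp : p.Admissible) (z : Plane) {g : Params.Data K → ℝ≥0∞}
    (hg : Measurable g) (j : Fin K) : Measurable (dataMean p z g j) := by
  have := p.isProbabilityMeasure_linkLaw hp j
  exact (hg.comp (p.measurable_data_right z j)).lintegral_prod_right'

/-- Averaging over the link of one base station. -/
lemma IsModel.lintegral_mul_data (hnet : net.IsModel p μ) [IsProbabilityMeasure μ]
    (hp : p.Admissible) (z : Plane) (r : Receiver) (b : Fin K × ℕ) {g : Params.Data K → ℝ≥0∞}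
    (hg : Measurable g) {R : Ω → ℝ≥0∞} (hR : Measurable[net.sigmaOf (linkSources b)ᶜ] R) :
    ∫⁻ ω, R ω * g (net.data p z r b ω) ∂μ
      = ∫⁻ ω, R ω * dataMean p z g b.1 (net.bs b.1 b.2 ω) ∂μ := by
  -- `W` carries the environment and not the gain, because the gain also depends on the random
  -- location. Independence first freezes the location, and then the law of the gain at fixed
  -- endpoints applies.
  set W : Ω → Bool × S × ℝ := fun ω => (net.on b.1 b.2 ω, net.env b.1 b.2 ω, net.fading b.1 b.2 r ω)
    with hWdef
  have hW : Measurable[net.sigmaOf (linkSources b)] W :=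
    (net.measurable_on_sigmaOf (by simp [linkSources])).prodMk
      ((net.measurable_env_sigmaOf (by simp [linkSources])).prodMk
        (net.measurable_fading_sigmaOf (by simp [linkSources]) r))
  set G : (ℝ≥0∞ × Plane) × (Bool × S × ℝ) → ℝ≥0∞ := fun q =>
    q.1.1 * g (p.data z b.1 q.1.2 (q.2.1, net.gain b.1 q.1.2 z q.2.2.1, q.2.2.2)) with hGdef
  have hG : Measurable G := by
    refine (by fun_prop : Measurable fun q : (ℝ≥0∞ × Plane) × (Bool × S × ℝ) => q.1.1).mul
      (hg.comp ((p.measurable_data_right z b.1).comp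
        (f := fun q : (ℝ≥0∞ × Plane) × (Bool × S × ℝ) =>
          (q.1.2, q.2.1, net.gain b.1 q.1.2 z q.2.2.1, q.2.2.2)) ?_))
    refine (by fun_prop : Measurable fun q : (ℝ≥0∞ × Plane) × (Bool × S × ℝ) => q.1.2).prodMk
      ((by fun_prop : Measurable fun q : (ℝ≥0∞ × Plane) × (Bool × S × ℝ) => q.2.1).prodMk
      (((hnet.gain_measurable b.1).comp (f := fun q : (ℝ≥0∞ × Plane) × (Bool × S × ℝ) =>
        (q.1.2, z, q.2.2.1)) (by fun_prop)).prodMk (by fun_prop)))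
  have hY : Measurable[net.sigmaOf (linkSources b)ᶜ] (net.bs b.1 b.2) :=
    net.measurable_bs_sigmaOf (by simp [linkSources]) _
  have hind : IndepFun (fun ω => (R ω, net.bs b.1 b.2 ω)) W μ :=
    indep_of_indep_of_le_left (indep_of_indep_of_le_right
      (hnet.indep_sigmaOf disjoint_compl_left) hW.comap_le) (hR.prodMk hY).comap_le
  have h1 := lintegral_comp_of_indepFun ((hR.prodMk hY).mono (hnet.sigmaOf_le _) le_rfl)
    (hW.mono (hnet.sigmaOf_le _) le_rfl) hind hG
  refine h1.trans (lintegral_congr fun ω => ?_)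
  simp only [hGdef, hWdef, dataMean]
  have hgx : Measurable fun q => g (p.data z b.1 (net.bs b.1 b.2 ω) q) :=
    hg.comp ((p.measurable_data_right z b.1).comp measurable_prodMk_left)
  rw [lintegral_const_mul]
  · rw [hnet.lintegral_link hp b (net.bs b.1 b.2 ω) z r hgx]
  · refine hgx.comp ((hnet.on_measurable _ _).prodMk (Measurable.prodMk ?_
      (hnet.fading_measurable _ _ _)))
    exact ((hnet.gain_measurable b.1).comp
      (measurable_const.prodMk (measurable_const.prodMk measurable_id))).comp
        (hnet.env_measurable _ _)

/-- The links are averaged out one at a time. The set `t` collects stations whose links have already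
been replaced by their means, so that the induction hypothesis can absorb the new factor. -/
lemma IsModel.lintegral_prod_data (hnet : net.IsModel p μ) [IsProbabilityMeasure μ]
    (hp : p.Admissible) (z : Plane) (r : Receiver) {g : Params.Data K → ℝ≥0∞}
    (hg : Measurable g) (s t : Finset (Fin K × ℕ)) (hst : Disjoint s t) :
    ∫⁻ ω, (∏ b ∈ t, dataMean p z g b.1 (net.bs b.1 b.2 ω)) * ∏ b ∈ s, g (net.data p z r b ω) ∂μ
      = ∫⁻ ω, (∏ b ∈ t, dataMean p z g b.1 (net.bs b.1 b.2 ω)) *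
          ∏ b ∈ s, dataMean p z g b.1 (net.bs b.1 b.2 ω) ∂μ := by
  classical
  induction s using Finset.induction_on generalizing t with
  | empty => simp
  | insert a s ha ih =>
    have hat : a ∉ t := fun h => (Finset.disjoint_left.1 hst) (Finset.mem_insert_self a s) h
    have hst' : Disjoint s (insert a t) := by
      rw [Finset.disjoint_insert_right]
      exact ⟨ha, (Finset.disjoint_insert_left.1 hst).2⟩
    have h2 := ih (insert a t) hst'
    simp_rw [Finset.prod_insert ha]
    simp_rw [Finset.prod_insert hat] at h2
    have h3 : ∀ ω, (∏ b ∈ t, dataMean p z g b.1 (net.bs b.1 b.2 ω)) *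
        (g (net.data p z r a ω) * ∏ b ∈ s, g (net.data p z r b ω))
        = ((∏ b ∈ t, dataMean p z g b.1 (net.bs b.1 b.2 ω)) * ∏ b ∈ s, g (net.data p z r b ω)) *
          g (net.data p z r a ω) := fun ω => by ring
    simp_rw [h3]
    rw [hnet.lintegral_mul_data hp z r a hg]
    · convert h2 using 3 <;> ring
    · refine Measurable.mul ?_ ?_
      · refine Finset.measurable_fun_prod _ fun b _ => (measurable_dataMean hp z hg _).comp
          (net.measurable_bs_sigmaOf (by simp [linkSources]) _)
      · refine Finset.measurable_fun_prod _ fun b hb => hg.comp ?_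
        have hba : b ≠ a := fun h => ha (h ▸ hb)
        have hba' : ¬ (b.1 = a.1 ∧ b.2 = a.2) := fun h => hba (Prod.ext h.1 h.2)
        refine @measurable_data_uncurry K Ω S net Ω (net.sigmaOf (linkSources a)ᶜ) _
          hnet.gain_measurable p (fun _ => z) b r id measurable_const ?_ ?_ ?_ ?_
        · exact net.measurable_bs_sigmaOf (by simp [linkSources]) _
        · exact net.measurable_on_sigmaOf (by simpa [linkSources] using hba')
        · exact net.measurable_env_sigmaOf (by simpa [linkSources] using hba')
        · exact net.measurable_fading_sigmaOf (by simpa [linkSources] using hba') _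

/-- The data of the base stations, as seen by a receiver, form a Poisson process. -/
theorem IsModel.hasLaplace_data (hnet : net.IsModel p μ) [IsProbabilityMeasure μ]
    (hp : p.Admissible) (z : Plane) (r : Receiver) :
    HasLaplace (net.data p z r) (p.dataIntensity z) μ := by
  intro φ hφ
  have hprob := p.isProbabilityMeasure_linkLaw hp
  have hg : Measurable fun t => nexp (φ t) := measurable_nexp.comp hφ
  -- Given the locations, each factor `exp (-φ)` is replaced by its mean `gm` over the link. Writing
  -- `gm` as `nexp (nlog gm)` turns the product into a Laplace functional of the locations alone.
  set gm := dataMean p z (fun t => nexp (φ t)) with hgm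
  have hgm' : ∀ j, Measurable (gm j) := measurable_dataMean hp z hg
  have hgm1 : ∀ j x, gm j x ≤ 1 := fun j x =>
    (lintegral_mono fun q => nexp_le_one _).trans (by simp)
  have hd := hnet.measurable_data z r
  have hbs : ∀ j n, Measurable (net.bs j n) := fun j n => (hnet.bs_poisson j).measurable n
  -- Averaging works for finitely many stations; bounded convergence along finite sets reaches all
  -- of them.
  have hdom : ∀ u : Finset (Fin K × ℕ) → Ω → ℝ≥0∞, (∀ s, Measurable (u s)) → ∀ w : Ω → ℝ≥0∞,
      (∀ ω, Tendsto (fun s => nexp (u s ω)) atTop (𝓝 (nexp (w ω)))) →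
      Tendsto (fun s => ∫⁻ ω, nexp (u s ω) ∂μ) atTop (𝓝 (∫⁻ ω, nexp (w ω) ∂μ)) := fun u hu w h =>
    tendsto_lintegral_filter_of_dominated_convergence (fun _ => 1)
      (.of_forall fun s => measurable_nexp.comp (hu s))
      (.of_forall fun s => ae_of_all _ fun ω => nexp_le_one _) (by simp) (ae_of_all _ h)
  have h1 := hdom (fun s ω => ∑ b ∈ s, φ (net.data p z r b ω))
    (fun s => Finset.measurable_fun_sum _ fun b _ => hφ.comp (hd b)) _ (fun ω => tendsto_nexp_sum _)
  have h2 := hdom (fun s ω => ∑ b ∈ s, nlog (gm b.1 (net.bs b.1 b.2 ω)))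
    (fun s => Finset.measurable_fun_sum _ fun b _ => measurable_nlog.comp ((hgm' _).comp (hbs _ _)))
    _ (fun ω => tendsto_nexp_sum _)
  have h12 : ∀ s : Finset (Fin K × ℕ), ∫⁻ ω, nexp (∑ b ∈ s, φ (net.data p z r b ω)) ∂μ
      = ∫⁻ ω, nexp (∑ b ∈ s, nlog (gm b.1 (net.bs b.1 b.2 ω))) ∂μ := fun s => by
    simp_rw [nexp_sum, nexp_nlog (hgm1 _ _)]
    simpa using hnet.lintegral_prod_data hp z r hg s ∅ (by simp)
  simp_rw [h12] at h1
  rw [tendsto_nhds_unique h1 h2]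
  have h3 : ∀ ω, nexp (∑' b : Fin K × ℕ, nlog (gm b.1 (net.bs b.1 b.2 ω)))
      = ∏ j, nexp (∑' n, nlog (gm j (net.bs j n ω))) := fun ω => by
    rw [ENNReal.tsum_prod' (f := fun b : Fin K × ℕ => nlog (gm b.1 (net.bs b.1 b.2 ω))),
      tsum_fintype, nexp_sum]
  simp_rw [h3]
  -- The location processes of the tiers are independent, so the functional factorises over tiers.
  have hind : iIndepFun (fun (j : Fin K) ω => fun n => net.bs j n ω) μ :=
    hnet.indep.precomp (g := Source.bs) fun a b h => by simpa using h
  have hm4 : ∀ j, Measurable fun y : ℕ → Plane => nexp (∑' n, nlog (gm j (y n))) := fun j =>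
    measurable_nexp.comp (Measurable.tsum fun n =>
      measurable_nlog.comp ((hgm' j).comp (measurable_pi_apply n)))
  have h4 := lintegral_prod_eq_prod_lintegral_of_indepFun Finset.univ _ (hind.comp _ hm4)
    (fun j => (hm4 j).comp (measurable_pi_lambda _ fun n => hbs j n))
  refine h4.trans ?_
  have h5 : Measurable fun t => 1 - nexp (φ t) := measurable_const.sub hg
  rw [p.lintegral_dataIntensity hp z h5, nexp_sum]
  refine Finset.prod_congr rfl fun j _ => ?_
  refine ((hnet.bs_poisson j).lintegral_nexp (measurable_nlog.comp (hgm' j))).trans ?_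
  congr 1
  refine lintegral_congr fun x => ?_
  rw [Function.comp_apply, nexp_nlog (hgm1 _ _), lintegral_sub]
  · simp [hgm, dataMean]
  · exact hg.comp ((p.measurable_data_right z j).comp measurable_prodMk_left)
  · exact ne_top_of_le_ne_top ENNReal.one_ne_top (hgm1 j x)
  · exact ae_of_all _ fun q => nexp_le_one _

end Network

end HetNet

end

noncomputable section

namespace HetNet

open Filter Topology

/-! ### Integrals -/

lemma lintegral_expMeasure_one {f : ℝ → ℝ≥0∞} (hf : Measurable f) :
    ∫⁻ h, f h ∂(expMeasure 1) = ∫⁻ h in Set.Ioi (0 : ℝ), ENNReal.ofReal (Real.exp (-h)) * f h := by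
  have hd : expMeasure 1 = volume.withDensity (exponentialPDF 1) := rfl
  have hm : Measurable (exponentialPDF 1) := (measurable_exponentialPDFReal 1).ennreal_ofReal
  rw [hd, lintegral_withDensity_eq_lintegral_mul _ hm hf, restrict_Ioi_eq_restrict_Ici,
    ← lintegral_indicator measurableSet_Ici]
  refine lintegral_congr fun h => ?_
  by_cases hh : 0 ≤ h
  · rw [Set.indicator_of_mem (Set.mem_Ici.2 hh), Pi.mul_apply, exponentialPDF_of_nonneg hh]
    simp
  · rw [Set.indicator_of_notMem (by simpa using hh), Pi.mul_apply,
      exponentialPDF_of_neg (not_le.1 hh), zero_mul]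

lemma lintegral_nexp_mul {A : ℝ≥0∞} (hA : A ≠ 0) (hA' : A ≠ ∞) :
    ∫⁻ v in Set.Ioi (0 : ℝ), nexp (A * ENNReal.ofReal v) = A⁻¹ := by
  have hpos : 0 < A.toReal := ENNReal.toReal_pos hA hA'
  have h1 : ∀ v ∈ Set.Ioi (0 : ℝ), nexp (A * ENNReal.ofReal v)
      = ENNReal.ofReal (Real.exp (-A.toReal * v)) := fun v hv => by
    conv_lhs => rw [← ENNReal.ofReal_toReal hA', ← ENNReal.ofReal_mul hpos.le]
    rw [nexp_ofReal (mul_nonneg hpos.le (le_of_lt hv)), neg_mul]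
  rw [setLIntegral_congr_fun measurableSet_Ioi h1,
    ← ofReal_integral_eq_lintegral_ofReal (integrableOn_exp_mul_Ioi (by linarith) 0)
      (ae_of_all _ fun v => (Real.exp_pos _).le), integral_exp_mul_Ioi (by linarith)]
  rw [mul_zero, Real.exp_zero, neg_div_neg_eq, one_div, ENNReal.ofReal_inv_of_pos hpos,
    ENNReal.ofReal_toReal hA']

/-- The Laplace transform of the exponential distribution. -/
lemma lintegral_nexp_mul_expMeasure {s : ℝ≥0∞} (hs : s ≠ ∞) :
    ∫⁻ h, nexp (s * ENNReal.ofReal h) ∂(expMeasure 1) = (1 + s)⁻¹ := by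
  rw [lintegral_expMeasure_one (by fun_prop), ← lintegral_nexp_mul (by simp) (by simpa using hs)]
  refine setLIntegral_congr_fun measurableSet_Ioi fun h hh => ?_
  rw [← nexp_ofReal (le_of_lt hh), ← nexp_add]
  congr 1
  ring

/-- The tail of the exponential distribution. -/
lemma expMeasure_one_lt_ofReal (x : ℝ≥0∞) : expMeasure 1 {h | x < ENNReal.ofReal h} = nexp x := by
  by_cases hx : x = ∞
  · simp [hx]
  have hm : MeasurableSet {h : ℝ | x < ENNReal.ofReal h} :=
    measurableSet_lt measurable_const ENNReal.measurable_ofReal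
  have hset : {h : ℝ | x < ENNReal.ofReal h} = Set.Ioi x.toReal := by
    ext h
    rw [Set.mem_ofPred_eq, Set.mem_Ioi, ENNReal.lt_ofReal_iff_toReal_lt hx]
  rw [← lintegral_indicator_one hm, lintegral_expMeasure_one (measurable_one.indicator hm), hset]
  have h1 : ∀ h : ℝ, ENNReal.ofReal (Real.exp (-h)) * (Set.Ioi x.toReal).indicator 1 h
      = (Set.Ioi x.toReal).indicator (fun h => ENNReal.ofReal (Real.exp (-h))) h := fun h => by
    by_cases hh : h ∈ Set.Ioi x.toReal <;> simp [hh]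
  simp_rw [h1]
  rw [setLIntegral_indicator measurableSet_Ioi,
    Set.inter_eq_left.2 (Set.Ioi_subset_Ioi ENNReal.toReal_nonneg),
    ← ofReal_integral_eq_lintegral_ofReal, integral_exp_neg_Ioi, nexp_eq_ofReal hx]
  · have h2 := integrableOn_exp_mul_Ioi (a := -1) (by norm_num) x.toReal
    simp only [neg_mul, one_mul] at h2
    exact h2
  · exact ae_of_all _ fun v => (Real.exp_pos _).le

/-- Integration of a function of the squared distance to a point of the plane. -/
lemma lintegral_norm_sq_mul (x : Plane) {c : ℝ} (hc : 0 < c) {F : ℝ → ℝ≥0∞} (hF : Measurable F) :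
    ∫⁻ z : Plane, F (‖x - z‖ ^ 2 * c)
      = ENNReal.ofReal (Real.pi / c) * ∫⁻ v in Set.Ioi (0 : ℝ), F v := by
  have hm : Measurable fun z : Plane => ‖x - z‖ ^ 2 * c := by fun_prop
  have hmap : (volume : Measure Plane).map (fun z => ‖x - z‖ ^ 2 * c)
      = ENNReal.ofReal (Real.pi / c) • (volume : Measure ℝ).restrict (Set.Ioi 0) := by
    -- The preimage of `(-∞, t)` is a disc of area `π t / c`, linear in `t`, so the image measure is
    -- a multiple of length. Half-lines form a generating π-system.
    have hball : ∀ t : ℝ, (volume : Measure Plane).map (fun z => ‖x - z‖ ^ 2 * c) (Set.Iio t)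
        = ENNReal.ofReal t * ENNReal.ofReal (Real.pi / c) := fun t => by
      rw [Measure.map_apply hm measurableSet_Iio]
      rcases le_or_gt t 0 with ht | ht
      · rw [ENNReal.ofReal_of_nonpos ht, zero_mul]
        convert measure_empty (μ := (volume : Measure Plane))
        ext z
        simp only [Set.mem_preimage, Set.mem_Iio, Set.mem_empty_iff_false, iff_false, not_lt]
        exact ht.trans (by positivity)
      · have hset : (fun z : Plane => ‖x - z‖ ^ 2 * c) ⁻¹' Set.Iio t
            = Metric.ball x (Real.sqrt (t / c)) := by
          ext z
          rw [Set.mem_preimage, Set.mem_Iio, Metric.mem_ball, dist_comm, dist_eq_norm,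
            Real.lt_sqrt (norm_nonneg _), lt_div_iff₀ hc]
        rw [hset, EuclideanSpace.volume_ball_fin_two, ← ENNReal.ofReal_pow (Real.sqrt_nonneg _),
          Real.sq_sqrt (by positivity), ← ENNReal.ofReal_mul (by positivity),
          ← ENNReal.ofReal_mul ht.le]
        congr 1
        ring
    refine Measure.ext_of_generateFrom_of_iUnion (Set.range Set.Iio) (fun n : ℕ => Set.Iio (n : ℝ))
      (BorelSpace.measurable_eq.trans (borel_eq_generateFrom_Iio ℝ)) isPiSystem_Iio ?_
      (fun n => ⟨n, rfl⟩) (fun n => ?_) ?_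
    · exact Set.iUnion_eq_univ_iff.2 fun y => exists_nat_gt y
    · rw [hball]; exact ENNReal.mul_ne_top ENNReal.ofReal_ne_top ENNReal.ofReal_ne_top
    · rintro _ ⟨t, rfl⟩
      rw [hball, Measure.smul_apply, Measure.restrict_apply measurableSet_Iio, Set.inter_comm,
        Set.Ioi_inter_Iio, Real.volume_Ioo, smul_eq_mul, sub_zero, mul_comm]
  rw [← lintegral_map hF hm, hmap, lintegral_smul_measure, smul_eq_mul]

/-! ### Effective distances and their constant intensity -/

namespace Params

variable {K : ℕ} (p : Params K)

lemma effDist_ne_zero {p : Params K} (hp : p.Admissible) (z : Plane) (j : Fin K) (x : Plane)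
    (o : Bool) (g : ℝ) : p.effDist z j x o g ≠ 0 := by
  have := hp.alpha_pos
  have h2 : 0 < 2 / p.alpha := by positivity
  unfold effDist
  split_ifs
  · rw [ENNReal.rpow_neg, ENNReal.inv_ne_zero]
    exact ENNReal.rpow_ne_top_of_nonneg h2.le ENNReal.ofReal_ne_top
  · simp

/-- The exponent `-2/α` makes the effective distance quadratic in the distance, which is what makes
area correspond to length. -/
lemma effDist_of_pos {p : Params K} (hp : p.Admissible) {z : Plane} (j : Fin K) {x : Plane}
    (hxz : x ≠ z) {g : ℝ} (hg : 0 < g) : p.effDist z j x true g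
      = ENNReal.ofReal (‖x - z‖ ^ 2 * (p.power j * g) ^ (-(2 / p.alpha))) := by
  have hα := hp.alpha_pos
  have hP := hp.power_pos j
  have hn : 0 < ‖x - z‖ := norm_pos_iff.2 (sub_ne_zero.2 hxz)
  rw [effDist, if_pos rfl, ENNReal.ofReal_rpow_of_pos (by positivity),
    Real.mul_rpow (by positivity) (by positivity), ← Real.rpow_mul hn.le, mul_comm,
    show -p.alpha * -(2 / p.alpha) = ((2 : ℕ) : ℝ) by push_cast; field_simp, Real.rpow_natCast]

lemma effDist_of_nonpos {p : Params K} (hp : p.Admissible) (z : Plane) (j : Fin K) (x : Plane)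
    {g : ℝ} (hg : g ≤ 0) : p.effDist z j x true g = ∞ := by
  have hα := hp.alpha_pos
  have h2 : 0 < 2 / p.alpha := by positivity
  rw [effDist, if_pos rfl, ENNReal.ofReal_of_nonpos, ENNReal.zero_rpow_of_neg (by linarith)]
  exact mul_nonpos_of_nonpos_of_nonneg (mul_nonpos_of_nonneg_of_nonpos (hp.power_pos j).le hg)
    (by positivity)

lemma effDist_comm (z : Plane) (j : Fin K) (x : Plane) (o : Bool) (g : ℝ) :
    p.effDist z j x o g = p.effDist x j z o g := by
  unfold effDist
  rw [norm_sub_rev]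

/-- The gain enters only through the factor `g ^ (2/α)`, hence through its moment of order `2/α`
after averaging. A gain that is not positive gives infinite effective distance everywhere, so `F ∞ =
0` is needed. -/
lemma lintegral_effDist {p : Params K} (hp : p.Admissible) (j : Fin K) (x : Plane) (g : ℝ)
    {F : ℝ≥0∞ → ℝ≥0∞} (hF : Measurable F) (hF0 : F ∞ = 0) :
    ∫⁻ z, F (p.effDist z j x true g) = ENNReal.ofReal (Real.pi * p.power j ^ (2 / p.alpha)) *
      ENNReal.ofReal g ^ (2 / p.alpha) * ∫⁻ v in Set.Ioi (0 : ℝ), F (ENNReal.ofReal v) := by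
  have hα := hp.alpha_pos
  have hP := hp.power_pos j
  have h2 : 0 < 2 / p.alpha := by positivity
  rcases le_or_gt g 0 with hg | hg
  · simp_rw [effDist_of_nonpos hp _ j x hg, hF0, ENNReal.ofReal_of_nonpos hg,
      ENNReal.zero_rpow_of_pos h2]
    simp
  · have hae : ∀ᵐ z : Plane, F (p.effDist z j x true g)
        = F (ENNReal.ofReal (‖x - z‖ ^ 2 * (p.power j * g) ^ (-(2 / p.alpha)))) := by
      -- At `z = x` the real power `0 ^ (-α)` is `0`, so the effective distance there is `∞` and the
      -- quadratic formula fails.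
      have : ∀ᵐ z : Plane, z ≠ x := by
        rw [ae_iff]; simp
      filter_upwards [this] with z hz
      rw [effDist_of_pos hp j hz.symm hg]
    rw [lintegral_congr_ae hae, lintegral_norm_sq_mul x (c := (p.power j * g) ^ (-(2 / p.alpha)))
      (by positivity) (F := fun v => F (ENNReal.ofReal v)) (by fun_prop),
      ENNReal.ofReal_rpow_of_pos hg, ← ENNReal.ofReal_mul (by positivity)]
    congr 2
    rw [Real.rpow_neg (by positivity), div_inv_eq_mul, Real.mul_rpow hP.le hg.le, mul_assoc]

lemma lintegral_onLaw (j : Fin K) (f : Bool → ℝ≥0∞) : ∫⁻ o, f o ∂(p.onLaw j)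
    = ENNReal.ofReal (p.avail j) * f true + ENNReal.ofReal (1 - p.avail j) * f false := by
  rw [onLaw, lintegral_add_measure, lintegral_smul_measure, lintegral_smul_measure]
  simp

lemma lintegral_shadow_rpow {p : Params K} (hp : p.Admissible) (j : Fin K) :
    ∫⁻ g, ENNReal.ofReal g ^ (2 / p.alpha) ∂(p.shadowLaw j) = ENNReal.ofReal (p.moment j) := by
  have hα := hp.alpha_pos
  rw [moment, ofReal_integral_eq_lintegral_ofReal (hp.shadow_integrable j)]
  · refine lintegral_congr_ae ?_
    filter_upwards [hp.shadow_nonneg j] with g hg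
    rw [ENNReal.ofReal_rpow_of_nonneg hg (by positivity)]
  · filter_upwards [hp.shadow_nonneg j] with g hg
    exact Real.rpow_nonneg hg _

lemma moment_nonneg {p : Params K} (hp : p.Admissible) (j : Fin K) : 0 ≤ p.moment j := by
  refine integral_nonneg_of_ae ?_
  filter_upwards [hp.shadow_nonneg j] with g hg
  exact Real.rpow_nonneg hg _

lemma moment_pos {p : Params K} (hp : p.Admissible) (j : Fin K) : 0 < p.moment j := by
  have hα := hp.alpha_pos
  have := hp.shadow_prob j
  refine lt_of_le_of_ne (moment_nonneg hp j) fun h => hp.shadow_ne_zero j ?_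
  have h0 : 0 ≤ᵐ[p.shadowLaw j] fun x : ℝ => x ^ (2 / p.alpha) := by
    filter_upwards [hp.shadow_nonneg j] with g hg
    exact Real.rpow_nonneg hg _
  have h1 := (integral_eq_zero_iff_of_nonneg_ae h0 (hp.shadow_integrable j)).1 h.symm
  have h2 : ∀ᵐ g ∂(p.shadowLaw j), g = 0 := by
    filter_upwards [h1, hp.shadow_nonneg j] with g hg hg0
    exact (Real.rpow_eq_zero hg0 (by positivity)).1 hg
  have h3 : (p.shadowLaw j).map id = (p.shadowLaw j).map fun _ => 0 := Measure.map_congr h2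
  rw [Measure.map_id, Measure.map_const, measure_univ, one_smul] at h3
  exact h3

/-- The intensity of the effective distances of the base stations of tier `j`, if their locations
have intensity `1`. -/
def effRate (j : Fin K) : ℝ :=
  p.avail j * (Real.pi * p.moment j * p.power j ^ (2 / p.alpha))

/-- The intensity of the effective distances of all base stations. -/
def totalRate : ℝ := ∑ j, p.density j * p.effRate j

lemma effRate_nonneg {p : Params K} (hp : p.Admissible) (j : Fin K) : 0 ≤ p.effRate j := by
  have := hp.avail_nonneg j
  have := moment_nonneg hp j
  have := hp.power_pos j
  unfold effRate; positivity

lemma totalRate_pos {p : Params K} (hp : p.Admissible) {k : Fin K} (hk : 0 < p.avail k) :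
    0 < p.totalRate := by
  refine Finset.sum_pos' (fun j _ => mul_nonneg (hp.density_pos j).le (effRate_nonneg hp j))
    ⟨k, Finset.mem_univ k, mul_pos (hp.density_pos k) ?_⟩
  have := moment_pos hp k
  have := hp.power_pos k
  unfold effRate; positivity

/-- Integration over the locations of the receiver, and the law of the link. -/
lemma lintegral_link_effDist {p : Params K} (hp : p.Admissible) (j : Fin K) (x : Plane)
    {F : ℝ≥0∞ → ℝ≥0∞ → ℝ≥0∞} (hF : Measurable (Function.uncurry F)) (hF0 : ∀ h, F ∞ h = 0) :
    ∫⁻ z, ∫⁻ q, F (p.effDist z j x q.1 q.2.1) (ENNReal.ofReal q.2.2) ∂(p.linkLaw j)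
      = ENNReal.ofReal (p.effRate j) * ∫⁻ v in Set.Ioi (0 : ℝ), ∫⁻ h,
          F (ENNReal.ofReal v) (ENNReal.ofReal h) ∂(expMeasure 1) := by
  have := p.isProbabilityMeasure_onLaw hp j
  have := hp.shadow_prob j
  have := isProbabilityMeasure_expMeasure one_pos
  have := p.isProbabilityMeasure_linkLaw hp j
  have hm : Measurable fun q : Plane × Bool × ℝ × ℝ =>
      F (p.effDist q.1 j x q.2.1 q.2.2.1) (ENNReal.ofReal q.2.2.2) :=
    hF.comp (((p.measurable_effDist j).comp (f := fun q : Plane × Bool × ℝ × ℝ =>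
      (q.1, x, q.2.1, q.2.2.1)) (by fun_prop)).prodMk
        (ENNReal.measurable_ofReal.comp (by fun_prop)))
  rw [lintegral_lintegral_swap hm.aemeasurable]
  have hz : ∀ q : Bool × ℝ × ℝ, Measurable fun z : Plane =>
      F (p.effDist z j x q.1 q.2.1) (ENNReal.ofReal q.2.2) :=
    fun q => hm.comp (measurable_id.prodMk measurable_const)
  have hm2 : Measurable fun q : Bool × ℝ × ℝ =>
      ∫⁻ z, F (p.effDist z j x q.1 q.2.1) (ENNReal.ofReal q.2.2) := hm.lintegral_prod_left'
  rw [linkLaw, lintegral_prod _ hm2.aemeasurable, lintegral_onLaw]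
  have hm3 : Measurable fun q : ℝ × ℝ =>
      ∫⁻ z, F (p.effDist z j x true q.1) (ENNReal.ofReal q.2) := hm2.comp measurable_prodMk_left
  have hoff : ∀ q : ℝ × ℝ, ∫⁻ z, F (p.effDist z j x false q.1) (ENNReal.ofReal q.2) = 0 := by
    intro q; simp [effDist, hF0]
  have hFv : Measurable fun q : ℝ × ℝ => F (ENNReal.ofReal q.1) (ENNReal.ofReal q.2) :=
    hF.comp (f := fun q : ℝ × ℝ => (ENNReal.ofReal q.1, ENNReal.ofReal q.2)) (by fun_prop)
  have hon : ∀ q : ℝ × ℝ, ∫⁻ z, F (p.effDist z j x true q.1) (ENNReal.ofReal q.2)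
      = (ENNReal.ofReal (Real.pi * p.power j ^ (2 / p.alpha)) * ENNReal.ofReal q.1 ^ (2 / p.alpha)) *
        ∫⁻ v in Set.Ioi (0 : ℝ), F (ENNReal.ofReal v) (ENNReal.ofReal q.2) := fun q =>
    lintegral_effDist hp j x q.1 (F := fun w => F w (ENNReal.ofReal q.2))
      (hF.comp (measurable_id.prodMk measurable_const)) (hF0 _)
  simp_rw [hoff, hon]
  have hI : Measurable fun h : ℝ => ∫⁻ v in Set.Ioi (0 : ℝ), F (ENNReal.ofReal v) (ENNReal.ofReal h) :=
    hFv.lintegral_prod_left'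
  rw [lintegral_zero, mul_zero, add_zero, lintegral_prod_mul
    (f := fun g : ℝ => ENNReal.ofReal (Real.pi * p.power j ^ (2 / p.alpha)) *
      ENNReal.ofReal g ^ (2 / p.alpha)) (by fun_prop) hI.aemeasurable,
    lintegral_const_mul _ (by fun_prop), lintegral_shadow_rpow hp,
    lintegral_lintegral_swap (f := fun (h v : ℝ) => F (ENNReal.ofReal v) (ENNReal.ofReal h))
      (hFv.comp measurable_swap).aemeasurable, ← mul_assoc]
  congr 1
  have := hp.power_pos j
  rw [effRate, ← ENNReal.ofReal_mul (by positivity), ← ENNReal.ofReal_mul (hp.avail_nonneg j)]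
  congr 1
  ring

/-- Integration of a function of the effective distance and the fading gain of a base station. -/
lemma lintegral_dataIntensity_snd {p : Params K} (hp : p.Admissible) (z : Plane)
    {F : ℝ≥0∞ → ℝ≥0∞ → ℝ≥0∞} (hF : Measurable (Function.uncurry F)) (hF0 : ∀ h, F ∞ h = 0) :
    ∫⁻ t, F t.2.2.1 t.2.2.2 ∂(p.dataIntensity z)
      = ENNReal.ofReal p.totalRate * ∫⁻ v in Set.Ioi (0 : ℝ), ∫⁻ h,
          F (ENNReal.ofReal v) (ENNReal.ofReal h) ∂(expMeasure 1) := by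
  rw [p.lintegral_dataIntensity hp z (f := fun t => F t.2.2.1 t.2.2.2)
    (hF.comp (measurable_snd.comp measurable_snd)), totalRate,
    ENNReal.ofReal_sum_of_nonneg fun j _ =>
      mul_nonneg (hp.density_pos j).le (effRate_nonneg hp j), Finset.sum_mul]
  refine Finset.sum_congr rfl fun j _ => ?_
  rw [lintegral_smul_measure, smul_eq_mul, ENNReal.ofReal_mul (hp.density_pos j).le, mul_assoc,
    ← lintegral_link_effDist hp j z hF hF0]
  -- Receiver and station play symmetric roles in the distance, so an integral over receivers serves
  -- as one over stations.
  simp only [data, effDist_comm p z]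

end Params

end HetNet

end

/-! ### Association and interference as one exponential functional -/

noncomputable section

namespace HetNet

open Filter Topology

namespace Params

variable {K : ℕ} (p : Params K)

/-- A receiver whose server has effective distance `w` is in coverage with conditional probability
`exp (- ∑ loss)`, where the sum extends over the effective distances `w'` and the fading gains `h'`
of the other available base stations. -/
def loss (β w w' h' : ℝ≥0∞) : ℝ≥0∞ :=
  (if w' < w then ∞ else 0) + β * h' * (w / w') ^ (p.alpha / 2)

lemma measurable_loss (β : ℝ≥0∞) :
    Measurable fun q : ℝ≥0∞ × ℝ≥0∞ × ℝ≥0∞ => p.loss β q.1 q.2.1 q.2.2 := by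
  unfold loss
  refine Measurable.add (Measurable.ite (measurableSet_lt ?_ ?_) measurable_const measurable_const)
    ?_ <;> fun_prop

variable {p}

lemma loss_top (hp : p.Admissible) (β w h : ℝ≥0∞) : p.loss β w ∞ h = 0 := by
  have := hp.alpha_pos
  simp [loss, show 0 < p.alpha / 2 by positivity]

/-- This evaluates the server's own term in the sum of Mecke's formula. -/
lemma loss_self (β h : ℝ≥0∞) {w : ℝ≥0∞} (h0 : w ≠ 0) (h1 : w ≠ ∞) :
    p.loss β w w h = β * h := by
  simp [loss, ENNReal.div_self h0 h1]

lemma monotone_loss (hp : p.Admissible) (β w' h : ℝ≥0∞) : Monotone fun w => p.loss β w w' h := by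
  have := hp.alpha_pos
  intro w v hwv
  simp only [loss]
  have h1 : (if w' < w then ∞ else 0 : ℝ≥0∞) ≤ if w' < v then ∞ else 0 := by
    split_ifs with h2 h3
    · rfl
    · exact absurd (h2.trans_le hwv) h3
    · simp
    · rfl
  gcongr

/-- This is the left continuity in `w` required by Mecke's formula; it relies on the strict
inequality `w' < w` in `loss`. -/
lemma loss_iSup (hp : p.Admissible) (β w' h : ℝ≥0∞) {v : ℕ → ℝ≥0∞} (hv : Monotone v) :
    p.loss β (⨆ n, v n) w' h = ⨆ n, p.loss β (v n) w' h := by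
  have hα : 0 < p.alpha / 2 := by have := hp.alpha_pos; positivity
  have hpow : Monotone fun x : ℝ≥0∞ => x ^ (p.alpha / 2) := ENNReal.monotone_rpow_of_nonneg hα.le
  have h1 : (if w' < ⨆ n, v n then ∞ else 0 : ℝ≥0∞) = ⨆ n, if w' < v n then ∞ else 0 := by
    split_ifs with h2
    · obtain ⟨n, hn⟩ := lt_iSup_iff.1 h2
      refine le_antisymm (le_iSup_of_le n (by simp [hn])) le_top
    · rw [lt_iSup_iff, not_exists] at h2
      simp [h2]
  have h2 : β * h * ((⨆ n, v n) / w') ^ (p.alpha / 2)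
      = ⨆ n, β * h * (v n / w') ^ (p.alpha / 2) := by
    rw [ENNReal.iSup_div, hpow.map_iSup_of_continuousAt
      (ENNReal.continuous_rpow_const).continuousAt (by simp [hα]), ENNReal.mul_iSup]
  simp only [loss]
  rw [h1, h2]
  refine ENNReal.iSup_add_iSup_of_monotone (fun m n hmn => ?_) (fun m n hmn => ?_)
  · split_ifs with h3 h4
    · rfl
    · exact absurd (h3.trans_le (hv hmn)) h4
    · simp
    · rfl
  · have := hv hmn
    gcongr

variable (p) in
/-- The integral `∫₁^∞ (1 - 1 / (1 + β u ^ (-α/2))) du`. -/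
def coverageInt (β : ℝ≥0∞) : ℝ≥0∞ :=
  ∫⁻ u in Set.Ioi (1 : ℝ), (1 - (1 + β * ENNReal.ofReal u ^ (-(p.alpha / 2)))⁻¹)

@[simp] lemma coverageInt_zero : p.coverageInt 0 = 0 := by simp [coverageInt]

/-- The Laplace exponent of the interference and the association. -/
lemma lintegral_one_sub_nexp_loss (hp : p.Admissible) (z : Plane) {β w : ℝ≥0∞} (hβ : β ≠ ∞)
    (hw : w ≠ ∞) (hw0 : w ≠ 0) :
    ∫⁻ t, (1 - nexp (p.loss β w t.2.2.1 t.2.2.2)) ∂(p.dataIntensity z)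
      = ENNReal.ofReal p.totalRate * (w * (1 + p.coverageInt β)) := by
  have hprob := isProbabilityMeasure_expMeasure one_pos
  have hα : 0 < p.alpha / 2 := by have := hp.alpha_pos; positivity
  have hmeas : Measurable (Function.uncurry fun w' h' => 1 - nexp (p.loss β w w' h')) :=
    measurable_const.sub (measurable_nexp.comp ((p.measurable_loss β).comp
      (measurable_const.prodMk measurable_id)))
  rw [lintegral_dataIntensity_snd hp z (F := fun w' h' => 1 - nexp (p.loss β w w' h')) hmeas
    (by simp [loss_top hp])]
  congr 1
  set w0 := w.toReal with hw0def
  have hpos : 0 < w0 := ENNReal.toReal_pos hw0 hw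
  have hwof : w = ENNReal.ofReal w0 := (ENNReal.ofReal_toReal hw).symm
  -- Stations nearer than the server have infinite loss and contribute the length `w` of the
  -- interval.
  have hnear : ∀ v ∈ Set.Ioo 0 w0, ∫⁻ h, (1 - nexp (p.loss β w (ENNReal.ofReal v)
      (ENNReal.ofReal h))) ∂(expMeasure 1) = 1 := by
    intro v hv
    have : ENNReal.ofReal v < w := by rw [hwof, ENNReal.ofReal_lt_ofReal_iff hpos]; exact hv.2
    simp [loss, this]
  -- Farther stations only interfere; the mean over their fading is the Laplace transform of the
  -- exponential law.
  have hfar : ∀ v ∈ Set.Ici w0, ∫⁻ h, (1 - nexp (p.loss β w (ENNReal.ofReal v)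
      (ENNReal.ofReal h))) ∂(expMeasure 1)
      = 1 - (1 + β * (w / ENNReal.ofReal v) ^ (p.alpha / 2))⁻¹ := by
    intro v hv
    have hle : ¬ ENNReal.ofReal v < w := by
      rw [hwof, not_lt]; exact ENNReal.ofReal_le_ofReal hv
    have hv0 : 0 < v := hpos.trans_le hv
    have hs : β * (w / ENNReal.ofReal v) ^ (p.alpha / 2) ≠ ∞ :=
      ENNReal.mul_ne_top hβ (ENNReal.rpow_ne_top_of_nonneg hα.le
        (ENNReal.div_ne_top hw (by simpa using hv0)))
    have hml : Measurable fun h : ℝ => nexp (p.loss β w (ENNReal.ofReal v) (ENNReal.ofReal h)) :=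
      measurable_nexp.comp ((p.measurable_loss β).comp (f := fun h : ℝ =>
        (w, ENNReal.ofReal v, ENNReal.ofReal h)) (by fun_prop))
    rw [lintegral_sub hml]
    · rw [← lintegral_nexp_mul_expMeasure hs]
      simp only [loss, hle, if_false, zero_add, lintegral_const, measure_univ, mul_one]
      congr 2
      ext h
      congr 1
      ring
    · exact ne_top_of_le_ne_top ENNReal.one_ne_top
        ((lintegral_mono fun h => nexp_le_one _).trans (by simp))
    · exact ae_of_all _ fun h => nexp_le_one _
  rw [← Set.Ioo_union_Ici_eq_Ioi hpos, lintegral_union measurableSet_Ici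
    (Set.disjoint_left.2 fun v hv hv' => (not_lt.2 hv') hv.2),
    setLIntegral_congr_fun measurableSet_Ioo hnear, setLIntegral_congr_fun measurableSet_Ici hfar,
    mul_add, mul_one]
  congr 1
  · simp [hwof]
  -- The substitution `v = w u` pulls out the factor `w` and leaves `coverageInt`.
  · have himg : Set.Ioi w0 = (fun u => w0 * u) '' Set.Ioi 1 := by
      rw [Set.image_mul_left_Ioi hpos, mul_one]
    rw [← restrict_Ioi_eq_restrict_Ici, himg, lintegral_image_eq_lintegral_abs_deriv_mul
      (f' := fun _ => w0) measurableSet_Ioi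
      (fun u _ => by simpa using ((hasDerivAt_id' u).const_mul w0).hasDerivWithinAt)
      (mul_right_injective₀ hpos.ne').injOn, coverageInt, ← lintegral_const_mul' _ _ hw]
    refine setLIntegral_congr_fun measurableSet_Ioi fun u hu => ?_
    have hu0 : 0 < u := one_pos.trans hu
    simp only [abs_of_pos hpos]
    rw [← hwof]
    congr 5
    rw [ENNReal.ofReal_mul hpos.le, ← hwof, ENNReal.rpow_neg, ← ENNReal.inv_rpow]
    congr 1
    rw [ENNReal.div_eq_inv_mul, ENNReal.mul_inv (Or.inl hw0) (Or.inl hw), mul_right_comm,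
      ENNReal.inv_mul_cancel hw0 hw, one_mul]

/-- The integral `coverageInt` in closed form. -/
lemma coverageInt_ofReal (hp : p.Admissible) (hα : 2 < p.alpha) :
    p.coverageInt (ENNReal.ofReal p.beta) = ENNReal.ofReal p.coverageF ∧ 0 ≤ p.coverageF := by
  have hβ := hp.beta_pos
  set δ := 2 / p.alpha with hδ
  have hα0 : 0 < p.alpha := by linarith
  have hδ0 : 0 < δ := by positivity
  have hδ1 : δ < 1 := by rw [hδ, div_lt_one hα0]; exact hα
  -- The substitution `u = t ^ (-δ)` is chosen so that `u ^ (-α/2) = t`; the integral becomes `δ β ∫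
  -- t ^ (-δ) / (1 + β t)` over `(0, 1)`.
  have himg : Set.Ioi (1 : ℝ) = (fun t : ℝ => t ^ (-δ)) '' Set.Ioo 0 1 := by
    ext u
    simp only [Set.mem_Ioi, Set.mem_image, Set.mem_Ioo]
    constructor
    · intro hu
      have hu0 : 0 < u := one_pos.trans hu
      refine ⟨u ^ (-δ)⁻¹, ⟨by positivity, ?_⟩, ?_⟩
      · exact Real.rpow_lt_one_of_one_lt_of_neg hu (by simpa using hδ0)
      · rw [← Real.rpow_mul hu0.le, inv_mul_cancel₀ (by simpa using hδ0.ne'), Real.rpow_one]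
    · rintro ⟨t, ⟨ht0, ht1⟩, rfl⟩
      exact Real.one_lt_rpow_of_pos_of_lt_one_of_neg ht0 ht1 (by simpa using hδ0)
  have hinj : Set.InjOn (fun t : ℝ => t ^ (-δ)) (Set.Ioo 0 1) := fun t ht s hs h =>
    Real.rpow_left_injOn (by simpa using hδ0.ne') ht.1.le hs.1.le h
  have h1 : p.coverageInt (ENNReal.ofReal p.beta) = ∫⁻ t in Set.Ioo (0 : ℝ) 1,
      ENNReal.ofReal (δ * p.beta * (t ^ (-δ) / (1 + t * p.beta))) := by
    rw [coverageInt, himg, lintegral_image_eq_lintegral_abs_deriv_mul measurableSet_Ioo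
      (fun t ht => (Real.hasDerivAt_rpow_const (Or.inl ht.1.ne')).hasDerivWithinAt) hinj]
    refine setLIntegral_congr_fun measurableSet_Ioo fun t ht => ?_
    have ht0 : 0 < t := ht.1
    have hpow : ENNReal.ofReal (t ^ (-δ)) ^ (-(p.alpha / 2)) = ENNReal.ofReal t := by
      rw [ENNReal.ofReal_rpow_of_pos (by positivity), ← Real.rpow_mul ht0.le,
        show -δ * -(p.alpha / 2) = 1 by rw [hδ]; field_simp, Real.rpow_one]
    rw [hpow, ← ENNReal.ofReal_mul hβ.le, ← ENNReal.ofReal_one,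
      ← ENNReal.ofReal_add zero_le_one (by positivity), ← ENNReal.ofReal_inv_of_pos (by positivity),
      ← ENNReal.ofReal_sub _ (by positivity), ← ENNReal.ofReal_mul (abs_nonneg _)]
    congr 1
    rw [abs_mul, abs_neg, abs_of_pos hδ0, abs_of_pos (by positivity), Real.rpow_sub ht0,
      Real.rpow_one]
    field_simp
    ring
  -- Integrability at `0` holds because `δ < 1`, that is, `α > 2`.
  have hint : IntegrableOn (fun t : ℝ => t ^ (-δ) / (1 + t * p.beta)) (Set.Ioo 0 1) := by
    have h2 : IntegrableOn (fun t : ℝ => t ^ (-δ)) (Set.Ioo 0 1) := by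
      have := (intervalIntegral.intervalIntegrable_rpow' (a := 0) (b := 1) (r := -δ) (by linarith))
      rw [intervalIntegrable_iff_integrableOn_Ioo_of_le zero_le_one] at this
      exact this
    refine Integrable.mono h2
      (Measurable.div (by fun_prop) (by fun_prop)).aestronglyMeasurable ?_
    refine (ae_restrict_iff' measurableSet_Ioo).2 (ae_of_all _ fun t ht => ?_)
    have ht0 : 0 < t := ht.1
    rw [norm_div]
    refine div_le_self (norm_nonneg _) ?_
    rw [Real.norm_of_nonneg (by positivity)]
    nlinarith [mul_pos ht0 hβ]
  have hF : p.coverageF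
      = ∫ t in Set.Ioo (0 : ℝ) 1, δ * p.beta * (t ^ (-δ) / (1 + t * p.beta)) := by
    rw [integral_const_mul, coverageF, hyp2F1, intervalIntegral.integral_of_le zero_le_one,
      integral_Ioc_eq_integral_Ioo, ← hδ]
    -- The Gamma factors reduce to `1 - δ = (α - 2) / α`, which turns the prefactor `2 β / (α - 2)`
    -- into `δ β`.
    have hGam : Real.Gamma (2 - δ) = (1 - δ) * Real.Gamma (1 - δ) := by
      rw [← Real.Gamma_add_one (by linarith)]; congr 1; ring
    have hG0 : Real.Gamma (1 - δ) ≠ 0 := (Real.Gamma_pos_of_pos (by linarith)).ne'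
    rw [show (2 - δ - (1 - δ)) = 1 by ring, Real.Gamma_one, hGam]
    have hcongr : ∀ t : ℝ, t ^ (1 - δ - 1) * (1 - t) ^ ((1 : ℝ) - 1) / (1 - t * -p.beta) ^ (1 : ℝ)
        = t ^ (-δ) / (1 + t * p.beta) := fun t => by
      rw [sub_self, Real.rpow_zero, Real.rpow_one, mul_one]
      congr 1
      · congr 1; ring
      · ring
    simp_rw [hcongr]
    rw [← mul_assoc]
    congr 1
    have h2 : p.alpha - 2 ≠ 0 := by linarith
    generalize Real.Gamma (1 - δ) = G at hG0 ⊢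
    have h3 : 1 - δ = (p.alpha - 2) / p.alpha := by rw [hδ]; field_simp
    rw [h3, hδ]
    field_simp
  have hnn : ∀ t ∈ Set.Ioo (0 : ℝ) 1, 0 ≤ δ * p.beta * (t ^ (-δ) / (1 + t * p.beta)) :=
    fun t ht => by have := ht.1; positivity
  constructor
  · rw [h1, hF, ofReal_integral_eq_lintegral_ofReal (hint.const_mul _)]
    exact (ae_restrict_iff' measurableSet_Ioo).2 (ae_of_all _ hnn)
  · rw [hF]
    exact setIntegral_nonneg measurableSet_Ioo hnn

end Params

end HetNet

end

/-! ### Mecke's formula applied to the serving station -/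

noncomputable section

namespace HetNet

open Filter Topology

/-- Mecke's formula for an increasing limit of functions with finite integrals. -/
theorem HasLaplace.mecke_of_monotone {ι Ω T : Type*} [MeasurableSpace Ω] [MeasurableSpace T]
    [Countable ι] {X : ι → Ω → T} {M : Measure T} {μ : Measure Ω} [IsProbabilityMeasure μ] [SFinite M]
    (hX : HasLaplace X M μ) (hm : ∀ b, Measurable (X b)) {f κ : T → ℝ≥0∞} (hκ : Measurable κ)
    {g : ℕ → T → ℝ≥0∞} (hg : ∀ n, Measurable (g n)) (hgmono : ∀ t, Monotone (g · t))
    (hglim : ∀ t, Tendsto (g · t) atTop (𝓝 (f t))) (hfin : ∀ n, ∫⁻ t, g n t ∂M ≠ ∞)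
    {φ : ℝ≥0∞ → T → ℝ≥0∞} (hφ : Measurable (Function.uncurry φ)) (hmono : ∀ t, Monotone (φ · t))
    (hsup : ∀ t (v : ℕ → ℝ≥0∞), Monotone v → φ (⨆ n, v n) t = ⨆ n, φ (v n) t) :
    ∫⁻ ω, ∑' b, f (X b ω) * nexp (∑' b', φ (κ (X b ω)) (X b' ω)) ∂μ
      = ∫⁻ t, f t * (nexp (φ (κ t) t) * nexp (∫⁻ t', (1 - nexp (φ (κ t) t')) ∂M)) ∂M := by
  have hlim : ∀ t {c : ℝ≥0∞}, c ≠ ∞ → Tendsto (fun n => g n t * c) atTop (𝓝 (f t * c)) :=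
    fun t c hc => ENNReal.Tendsto.mul_const (hglim t) (Or.inr hc)
  have hinner : Measurable fun t => nexp (φ (κ t) t) * nexp (∫⁻ t', (1 - nexp (φ (κ t) t')) ∂M) := by
    refine (measurable_nexp.comp (hφ.comp (hκ.prodMk measurable_id))).mul
      (measurable_nexp.comp ?_)
    exact Measurable.lintegral_prod_right' (f := fun q : T × T => 1 - nexp (φ (κ q.1) q.2))
      (measurable_const.sub (measurable_nexp.comp
        (hφ.comp ((hκ.comp measurable_fst).prodMk measurable_snd))))
  have hL := lintegral_tendsto_of_tendsto_of_monotone (μ := μ)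
    (f := fun n ω => ∑' b, g n (X b ω) * nexp (∑' b', φ (κ (X b ω)) (X b' ω)))
    (F := fun ω => ∑' b, f (X b ω) * nexp (∑' b', φ (κ (X b ω)) (X b' ω)))
    (fun n => (Measurable.tsum fun b => ((hg n).comp (hm b)).mul (measurable_nexp.comp
      (Measurable.tsum fun b' => hφ.comp ((hκ.comp (hm b)).prodMk (hm b'))))).aemeasurable)
    (ae_of_all _ fun ω n m h => ENNReal.tsum_le_tsum fun b => mul_le_mul_left (hgmono _ h) _)
    (ae_of_all _ fun ω => tendsto_tsum_of_monotone
      (fun b n m h => mul_le_mul_left (hgmono _ h) _) fun b => hlim _ (nexp_ne_top _))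
  have hR := lintegral_tendsto_of_tendsto_of_monotone (μ := M)
    (f := fun n t => g n t * (nexp (φ (κ t) t) * nexp (∫⁻ t', (1 - nexp (φ (κ t) t')) ∂M)))
    (fun n => ((hg n).mul hinner).aemeasurable)
    (ae_of_all _ fun t n m h => mul_le_mul_left (hgmono _ h) _)
    (ae_of_all _ fun t => hlim t (by rw [← nexp_add]; exact nexp_ne_top _))
  refine tendsto_nhds_unique hL (hR.congr fun n => ?_)
  exact (hX.mecke hm (hg n) hκ (hfin n) hφ hmono hsup).symm

namespace Params

variable {K : ℕ} (p : Params K)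

/-- The data of the available base stations of tier `k` in `A` with finite effective distance. -/
def window (k : Fin K) (A : Set Plane) : Set (Data K) := {t | t.1 = k ∧ t.2.1 ∈ A ∧ t.2.2.1 ≠ ∞}

lemma measurableSet_window (k : Fin K) {A : Set Plane} (hA : MeasurableSet A) :
    MeasurableSet (window k A) := by
  refine (measurable_fst (measurableSet_singleton k)).inter
    (((measurable_fst.comp measurable_snd) hA).inter ?_)
  exact ((measurable_fst.comp (measurable_snd.comp measurable_snd))
    (measurableSet_singleton ∞)).compl

/-- The conditional probability that a base station is the serving one and that the receiver is in
coverage, given its effective distance `w`, times `exp (-β h)`. -/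
def serverWeight (β w h : ℝ≥0∞) : ℝ≥0∞ :=
  if w = ∞ then 0 else
    nexp (β * h) * nexp (ENNReal.ofReal p.totalRate * (w * (1 + p.coverageInt β)))

lemma measurable_serverWeight (β : ℝ≥0∞) : Measurable (Function.uncurry (p.serverWeight β)) := by
  unfold serverWeight Function.uncurry
  exact Measurable.ite (measurable_fst (measurableSet_singleton ∞)) measurable_const (by fun_prop)

/-- The integral of `serverWeight` over the base stations of tier `k` in `A`, for a receiver
at `z`. -/
def serverMean (β : ℝ≥0∞) (k : Fin K) (A : Set Plane) (z : Plane) : ℝ≥0∞ :=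
  ∫⁻ x in A, ∫⁻ q, p.serverWeight β (p.effDist z k x q.1 q.2.1) (ENNReal.ofReal q.2.2)
    ∂(p.linkLaw k) ∂(p.bsIntensity k)

variable {p}

/-- The integral over the fading gives `(1 + β)⁻¹`; the remaining weight is an exponential in `v`,
whose integral is the inverse of its rate. -/
lemma lintegral_serverWeight (hp : p.Admissible) {k : Fin K} (hk : 0 < p.avail k) {β : ℝ≥0∞}
    (hβ : β ≠ ∞) (hJ : p.coverageInt β ≠ ∞) :
    ∫⁻ v in Set.Ioi (0 : ℝ), ∫⁻ h,
        p.serverWeight β (ENNReal.ofReal v) (ENNReal.ofReal h) ∂(expMeasure 1)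
      = (1 + β)⁻¹ * (ENNReal.ofReal p.totalRate * (1 + p.coverageInt β))⁻¹ := by
  have hC : ENNReal.ofReal p.totalRate ≠ 0 := by simpa using totalRate_pos hp hk
  simp only [serverWeight, ENNReal.ofReal_ne_top, if_false]
  simp_rw [lintegral_mul_const _ (by fun_prop : Measurable fun h : ℝ =>
    nexp (β * ENNReal.ofReal h)), lintegral_nexp_mul_expMeasure hβ]
  rw [lintegral_const_mul _ (by fun_prop), ← lintegral_nexp_mul (mul_ne_zero hC (by simp))
    (ENNReal.mul_ne_top ENNReal.ofReal_ne_top (by simpa using hJ))]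
  congr 2
  ext v
  congr 1
  ring

lemma measurable_serverWeight_effDist (β : ℝ≥0∞) (k : Fin K) :
    Measurable fun q : (Plane × Plane) × Bool × ℝ × ℝ =>
      p.serverWeight β (p.effDist q.1.1 k q.1.2 q.2.1 q.2.2.1) (ENNReal.ofReal q.2.2.2) :=
  (p.measurable_serverWeight β).comp (((p.measurable_effDist k).comp
    (f := fun q : (Plane × Plane) × Bool × ℝ × ℝ => (q.1.1, q.1.2, q.2.1, q.2.2.1))
      (by fun_prop)).prodMk (ENNReal.measurable_ofReal.comp (by fun_prop)))

/-- The tier of the server is `j`; the available tier `k` ensures that `totalRate` is positive. -/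
lemma serverMean_univ (hp : p.Admissible) {k : Fin K} (hk : 0 < p.avail k) (j : Fin K) {β : ℝ≥0∞}
    (hβ : β ≠ ∞) (hJ : p.coverageInt β ≠ ∞) (z : Plane) :
    p.serverMean β j Set.univ z = ENNReal.ofReal (p.density j) * (ENNReal.ofReal (p.effRate j) *
      ((1 + β)⁻¹ * (ENNReal.ofReal p.totalRate * (1 + p.coverageInt β))⁻¹)) := by
  rw [serverMean, Measure.restrict_univ, lintegral_smul_measure, smul_eq_mul]
  simp only [effDist_comm p z]
  rw [lintegral_link_effDist hp j z (p.measurable_serverWeight β) (by simp [serverWeight]),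
    lintegral_serverWeight hp hk hβ hJ]

/-- By Tonelli the receiver `z` is integrated out first, and the result is the same for every
station location. The window therefore enters only through its area, which is why the Palm quotients
do not depend on it. -/
lemma lintegral_serverMean (hp : p.Admissible) {k : Fin K} (hk : 0 < p.avail k) (j : Fin K)
    {β : ℝ≥0∞} (hβ : β ≠ ∞) (hJ : p.coverageInt β ≠ ∞) (A : Set Plane) :
    ∫⁻ z, p.serverMean β j A z = ENNReal.ofReal (p.density j) * volume A *
      (ENNReal.ofReal (p.effRate j) *
      ((1 + β)⁻¹ * (ENNReal.ofReal p.totalRate * (1 + p.coverageInt β))⁻¹)) := by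
  have := p.isProbabilityMeasure_linkLaw hp j
  have hm : Measurable fun q : Plane × Plane => ∫⁻ l, p.serverWeight β
      (p.effDist q.1 j q.2 l.1 l.2.1) (ENNReal.ofReal l.2.2) ∂(p.linkLaw j) :=
    (measurable_serverWeight_effDist β j).lintegral_prod_right'
  simp only [serverMean]
  rw [lintegral_lintegral_swap hm.aemeasurable]
  simp_rw [lintegral_link_effDist hp j _ (p.measurable_serverWeight β) (by simp [serverWeight]),
    lintegral_serverWeight hp hk hβ hJ]
  rw [lintegral_const, Measure.restrict_apply_univ, Measure.smul_apply, smul_eq_mul, mul_comm]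

/-- Effective distances are locally finite in mean: the interval `[0, n]` carries the mass `n *
totalRate`. -/
lemma lintegral_indicator_Iic_ne_top (hp : p.Admissible) (z : Plane) (n : ℕ) :
    ∫⁻ t : Data K, (Set.Iic (n : ℝ≥0∞)).indicator 1 t.2.2.1 ∂(p.dataIntensity z) ≠ ∞ := by
  have hexp := isProbabilityMeasure_expMeasure one_pos
  rw [lintegral_dataIntensity_snd hp z (F := fun w _ => (Set.Iic (n : ℝ≥0∞)).indicator 1 w)
    ((measurable_one.indicator measurableSet_Iic).comp measurable_fst) (by simp)]
  refine ENNReal.mul_ne_top ENNReal.ofReal_ne_top ?_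
  have h2 : ∀ v ∈ Set.Ioi (0 : ℝ), ∫⁻ _ : ℝ, (Set.Iic (n : ℝ≥0∞)).indicator 1 (ENNReal.ofReal v)
      ∂(expMeasure 1) = (Set.Iic (n : ℝ)).indicator 1 v := fun v hv => by
    rw [lintegral_const, measure_univ, mul_one]
    by_cases hvn : v ≤ n
    · have : ENNReal.ofReal v ≤ n := by
        rw [← ENNReal.ofReal_natCast]; exact ENNReal.ofReal_le_ofReal hvn
      simp [hvn, this]
    · have : ¬ ENNReal.ofReal v ≤ n := by
        rw [← ENNReal.ofReal_natCast, ENNReal.ofReal_le_ofReal_iff (by positivity)]; exact hvn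
      simp [hvn, this]
  rw [setLIntegral_congr_fun measurableSet_Ioi h2, lintegral_indicator_one measurableSet_Iic,
    Measure.restrict_apply measurableSet_Iic, Set.inter_comm, Set.Ioi_inter_Iic, Real.volume_Ioc]
  exact ENNReal.ofReal_ne_top

end Params

namespace Network

variable {K : ℕ} {Ω S : Type*} {net : Network K Ω S}
variable [MeasurableSpace Ω] [MeasurableSpace S] {p : Params K} {μ : Measure Ω}

/-- Mecke's formula produces the own term `exp (-β h)` and the Laplace exponent of `loss`; their
product is `serverWeight`. -/
lemma IsModel.lintegral_tsum_window (hnet : net.IsModel p μ) [IsProbabilityMeasure μ]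
    (hp : p.Admissible) (z : Plane) (r : Receiver) {β : ℝ≥0∞} (hβ : β ≠ ∞) (k : Fin K)
    {A : Set Plane} (hA : MeasurableSet A) :
    ∫⁻ ω, ∑' b, (Params.window k A).indicator 1 (net.data p z r b ω) *
        nexp (∑' b', p.loss β (net.data p z r b ω).2.2.1 (net.data p z r b' ω).2.2.1
          (net.data p z r b' ω).2.2.2) ∂μ = p.serverMean β k A z := by
  have hsf := p.sFinite_dataIntensity hp z
  have hw : Measurable fun t : Params.Data K => t.2.2.1 := by fun_prop
  have hle : ∀ n : ℕ, MeasurableSet {t : Params.Data K | t.2.2.1 ≤ n} := fun n =>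
    measurableSet_le hw measurable_const
  have hwin := Params.measurableSet_window k hA
  -- The window may have infinite intensity, so it is exhausted by effective distances at most `n`.
  set g : ℕ → Params.Data K → ℝ≥0∞ := fun n =>
    (Params.window k A ∩ {t : Params.Data K | t.2.2.1 ≤ n}).indicator 1 with hg
  have hφ : Measurable (Function.uncurry fun (w : ℝ≥0∞) (t : Params.Data K) =>
      p.loss β w t.2.2.1 t.2.2.2) :=
    (p.measurable_loss β).comp (f := fun q : ℝ≥0∞ × Params.Data K => (q.1, q.2.2.2)) (by fun_prop)
  have hgmono : ∀ t, Monotone (g · t) := fun t n m h => by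
    refine Set.indicator_le_indicator_of_subset (Set.inter_subset_inter_right _ fun t ht => ?_)
      (fun _ => zero_le) t
    have h' : (n : ℝ≥0∞) ≤ m := by exact_mod_cast h
    have ht' : t.2.2.1 ≤ (n : ℝ≥0∞) := ht
    exact ht'.trans h'
  have hmain := (hnet.hasLaplace_data hp z r).mecke_of_monotone (hnet.measurable_data z r)
    (f := (Params.window k A).indicator 1) (g := g)
    (κ := fun t => t.2.2.1) hw (fun n => measurable_one.indicator (hwin.inter (hle n)))
    hgmono
    (fun t => ?_) (fun n => ?_) hφ (fun t => Params.monotone_loss hp _ _ _)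
    (fun t v hv => Params.loss_iSup hp _ _ _ hv)
  · rw [hmain]
    set G : Params.Data K → ℝ≥0∞ := fun t => (Params.window k A).indicator 1 t *
      (nexp (p.loss β t.2.2.1 t.2.2.1 t.2.2.2) * nexp (∫⁻ t', (1 - nexp (p.loss β t.2.2.1
        t'.2.2.1 t'.2.2.2)) ∂(p.dataIntensity z))) with hG
    have hGm : Measurable G := by
      refine (measurable_one.indicator hwin).mul (Measurable.mul ?_ ?_)
      · exact measurable_nexp.comp ((p.measurable_loss β).comp
          (f := fun t : Params.Data K => (t.2.2.1, t.2.2.1, t.2.2.2)) (by fun_prop))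
      · refine measurable_nexp.comp (Measurable.lintegral_prod_right'
          (f := fun q : Params.Data K × Params.Data K =>
            1 - nexp (p.loss β q.1.2.2.1 q.2.2.2.1 q.2.2.2.2)) ?_)
        exact measurable_const.sub (measurable_nexp.comp ((p.measurable_loss β).comp
          (f := fun q : Params.Data K × Params.Data K => (q.1.2.2.1, q.2.2.2.1, q.2.2.2.2))
          (by fun_prop)))
    have hGd : ∀ j x q, G (p.data z j x q) = if j = k then A.indicator (fun x =>
        p.serverWeight β (p.effDist z k x q.1 q.2.1) (ENNReal.ofReal q.2.2)) x else 0 := by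
      intro j x q
      have h0 := Params.effDist_ne_zero hp z j x q.1 q.2.1
      by_cases hj : j = k
      swap
      · have : p.data z j x q ∉ Params.window k A := fun h => hj h.1
        simp [hG, this, hj]
      subst hj
      rw [if_pos rfl]
      by_cases hx : x ∈ A
      swap
      · have : p.data z j x q ∉ Params.window j A := fun h => hx h.2.1
        simp [hG, this, hx]
      rw [Set.indicator_of_mem hx, Params.serverWeight]
      split_ifs with hinf
      · have : p.data z j x q ∉ Params.window j A := fun h => h.2.2 hinf
        simp [hG, this]
      · have : p.data z j x q ∈ Params.window j A := ⟨rfl, hx, hinf⟩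
        have hlint := Params.lintegral_one_sub_nexp_loss hp z hβ hinf h0
        simp only [hG, Set.indicator_of_mem this, Pi.one_apply, one_mul]
        simp only [Params.data] at hlint ⊢
        rw [hlint, Params.loss_self _ _ h0 hinf]
    rw [p.lintegral_dataIntensity hp z hGm, Finset.sum_eq_single_of_mem k (Finset.mem_univ k)]
    · rw [Params.serverMean, ← lintegral_indicator hA]
      refine lintegral_congr fun x => ?_
      simp only [hGd, if_true]
      by_cases hx : x ∈ A <;> simp [hx]
    · intro j _ hj
      simp [hGd, hj]
  · by_cases ht : t ∈ Params.window k A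
    · refine tendsto_const_nhds.congr' ?_
      obtain ⟨n, hn⟩ := ENNReal.exists_nat_gt ht.2.2
      filter_upwards [eventually_ge_atTop n] with m hm
      have : t ∈ Params.window k A ∩ {t : Params.Data K | t.2.2.1 ≤ m} :=
        ⟨ht, hn.le.trans (by exact_mod_cast hm)⟩
      simp only [hg]
      rw [Set.indicator_of_mem this, Set.indicator_of_mem ht]
    · simp [hg, ht]
  · have h1 : ∫⁻ t, g n t ∂(p.dataIntensity z)
        ≤ ∫⁻ t, (Set.Iic (n : ℝ≥0∞)).indicator 1 t.2.2.1 ∂(p.dataIntensity z) := by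
      refine lintegral_mono fun t => ?_
      exact Set.indicator_le_indicator_of_subset Set.inter_subset_right (fun _ => zero_le) t
    exact ne_top_of_le_ne_top (Params.lintegral_indicator_Iic_ne_top hp z n) h1

end Network

end HetNet

end

/-! ### Service and coverage events in terms of effective distances -/

noncomputable section

namespace HetNet

open Filter Topology

namespace Network

variable {K : ℕ} {Ω S : Type*} (net : Network K Ω S)

/-- The effective distance of base station `b` from `z`. -/
def dist (p : Params K) (z : Plane) (b : Fin K × ℕ) (ω : Ω) : ℝ≥0∞ :=
  p.effDist z b.1 (net.bs b.1 b.2 ω) (net.on b.1 b.2 ω)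
    (net.gain b.1 (net.bs b.1 b.2 ω) z (net.env b.1 b.2 ω))

/-- Base station `b` has finite and minimal effective distance from `z`. -/
def Nearest (p : Params K) (z : Plane) (b : Fin K × ℕ) (ω : Ω) : Prop :=
  net.dist p z b ω ≠ ∞ ∧ ∀ b', net.dist p z b ω ≤ net.dist p z b' ω

/-- The threshold for the fading gain of base station `b` above which a receiver at `z` is served by
`b` and in coverage. -/
def threshold (p : Params K) (β : ℝ≥0∞) (z : Plane) (r : Receiver) (b : Fin K × ℕ) (ω : Ω) :
    ℝ≥0∞ :=
  ∑' b' : Fin K × ℕ, if b' = b then 0 else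
    p.loss β (net.dist p z b ω) (net.dist p z b' ω) (ENNReal.ofReal (net.fading b'.1 b'.2 r ω))

/-- The event that base station `b` belongs to tier `k`, is located in `A`, and serves and covers a
receiver at `z`. -/
def coverSet (p : Params K) (β : ℝ≥0∞) (z : Plane) (r : Receiver) (k : Fin K) (A : Set Plane)
    (b : Fin K × ℕ) : Set Ω :=
  {ω | (b.1 = k ∧ net.bs b.1 b.2 ω ∈ A ∧ net.dist p z b ω ≠ ∞) ∧
    net.threshold p β z r b ω < ENNReal.ofReal (net.fading b.1 b.2 r ω)}

variable {net} {p : Params K}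

lemma dist_of_on {b : Fin K × ℕ} {ω : Ω} (h : net.on b.1 b.2 ω = true) (z : Plane) :
    net.dist p z b ω = ENNReal.ofReal (net.longTermPower p b z ω) ^ (-(2 / p.alpha)) := by
  rw [dist, Params.effDist, if_pos h, longTermPower]

lemma dist_of_off {b : Fin K × ℕ} {ω : Ω} (h : net.on b.1 b.2 ω ≠ true) (z : Plane) :
    net.dist p z b ω = ∞ := by
  rw [dist, Params.effDist, if_neg h]

lemma dist_ne_top_iff (hp : p.Admissible) {b : Fin K × ℕ} {ω : Ω} {z : Plane} :
    net.dist p z b ω ≠ ∞ ↔ net.on b.1 b.2 ω = true ∧ 0 < net.longTermPower p b z ω := by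
  have hδ : 0 < 2 / p.alpha := by have := hp.alpha_pos; positivity
  by_cases hon : net.on b.1 b.2 ω = true
  · rw [dist_of_on hon, ENNReal.rpow_neg, Ne, ENNReal.inv_eq_top, ENNReal.rpow_eq_zero_iff_of_pos hδ]
    simp [hon]
  · simp [dist_of_off hon, hon]

lemma dist_ne_zero (hp : p.Admissible) (b : Fin K × ℕ) (ω : Ω) (z : Plane) :
    net.dist p z b ω ≠ 0 := Params.effDist_ne_zero hp _ _ _ _ _

lemma dist_le_dist_iff (hp : p.Admissible) {b b' : Fin K × ℕ} {ω : Ω} {z : Plane}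
    (hb : net.dist p z b ω ≠ ∞) (hb' : net.on b'.1 b'.2 ω = true) :
    net.dist p z b ω ≤ net.dist p z b' ω
      ↔ net.longTermPower p b' z ω ≤ net.longTermPower p b z ω := by
  have hδ : 0 < 2 / p.alpha := by have := hp.alpha_pos; positivity
  obtain ⟨hon, hpos⟩ := (dist_ne_top_iff hp).1 hb
  rw [dist_of_on hon, dist_of_on hb', ENNReal.rpow_neg, ENNReal.rpow_neg, ENNReal.inv_le_inv,
    ENNReal.rpow_le_rpow_iff hδ, ENNReal.ofReal_le_ofReal_iff hpos.le]

/-- Association by long term received power in terms of effective distances. -/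
lemma serves_iff (hp : p.Admissible) {b : Fin K × ℕ} {ω : Ω} {z : Plane}
    (hex : ∃ b', net.dist p z b' ω ≠ ∞) : net.Serves p b z ω ↔ net.Nearest p z b ω := by
  constructor
  · rintro ⟨hon, hmax⟩
    -- If no available station had positive power, one could still serve `z` without having finite
    -- effective distance; `b0` rules this out.
    obtain ⟨b0, hb0⟩ := hex
    obtain ⟨hon0, hpos0⟩ := (dist_ne_top_iff hp).1 hb0
    have hb : net.dist p z b ω ≠ ∞ :=
      (dist_ne_top_iff hp).2 ⟨hon, hpos0.trans_le (hmax b0 hon0)⟩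
    refine ⟨hb, fun b' => ?_⟩
    by_cases hon' : net.on b'.1 b'.2 ω = true
    · exact (dist_le_dist_iff hp hb hon').2 (hmax b' hon')
    · rw [dist_of_off hon']; exact le_top
  · rintro ⟨hb, hmin⟩
    exact ⟨((dist_ne_top_iff hp).1 hb).1, fun b' hon' =>
      (dist_le_dist_iff hp hb hon').1 (hmin b')⟩

/-- This explains the power `α/2` in `loss`: it converts a ratio of effective distances back into
the inverse ratio of received powers. -/
lemma dist_div_dist_rpow (hp : p.Admissible) {b b' : Fin K × ℕ} {ω : Ω} {z : Plane}
    (hb : net.on b.1 b.2 ω = true) (hb' : net.on b'.1 b'.2 ω = true) :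
    (net.dist p z b ω / net.dist p z b' ω) ^ (p.alpha / 2)
      = ENNReal.ofReal (net.longTermPower p b' z ω) / ENNReal.ofReal (net.longTermPower p b z ω) := by
  have hα := hp.alpha_pos
  rw [dist_of_on hb, dist_of_on hb', div_eq_mul_inv, ← ENNReal.rpow_neg, neg_neg,
    ENNReal.mul_rpow_of_nonneg _ _ (by positivity), ← ENNReal.rpow_mul, ← ENNReal.rpow_mul,
    show -(2 / p.alpha) * (p.alpha / 2) = -1 by field_simp,
    show 2 / p.alpha * (p.alpha / 2) = 1 by field_simp, ENNReal.rpow_one, ENNReal.rpow_neg_one,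
    mul_comm, div_eq_mul_inv]

/-- Coverage in terms of effective distances. -/
lemma coveredBy_iff (hp : p.Admissible) {b : Fin K × ℕ} {ω : Ω} {r : Receiver}
    (hex : ∃ b', net.dist p (net.location ω r) b' ω ≠ ∞)
    (hfad : ∀ b : Fin K × ℕ, 0 ≤ net.fading b.1 b.2 r ω) :
    net.CoveredBy p b r ω ↔ net.dist p (net.location ω r) b ω ≠ ∞ ∧
      net.threshold p (ENNReal.ofReal p.beta) (net.location ω r) r b ω
        < ENNReal.ofReal (net.fading b.1 b.2 r ω) := by
  classical
  rw [CoveredBy, serves_iff hp hex]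
  set z := net.location ω r with hz
  set β := ENNReal.ofReal p.beta with hβ
  by_cases hb : net.dist p z b ω = ∞
  · simp [Nearest, hb]
  obtain ⟨hon, hpos⟩ := (dist_ne_top_iff hp).1 hb
  set h := ENNReal.ofReal (net.fading b.1 b.2 r ω) with hh
  set U := ENNReal.ofReal (net.longTermPower p b z ω) with hU
  have hU0 : U ≠ 0 := by simpa [hU] using hpos
  have hUt : U ≠ ∞ := ENNReal.ofReal_ne_top
  have hrec : ∀ b' : Fin K × ℕ, ENNReal.ofReal (net.receivedPower p b' r ω)
      = ENNReal.ofReal (net.fading b'.1 b'.2 r ω) * ENNReal.ofReal (net.longTermPower p b' z ω) :=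
    fun b' => ENNReal.ofReal_mul (hfad b')
  -- A single nearer station makes the threshold infinite, so exceeding it already implies the
  -- association.
  have hnear : net.threshold p β z r b ω < h → net.Nearest p z b ω := by
    intro hlt
    refine ⟨hb, fun b' => ?_⟩
    by_cases hbb : b' = b
    · rw [hbb]
    by_contra hcon
    have h1 : p.loss β (net.dist p z b ω) (net.dist p z b' ω)
        (ENNReal.ofReal (net.fading b'.1 b'.2 r ω)) = ∞ := by
      simp [Params.loss, not_le.1 hcon]
    have h2 := ENNReal.le_tsum (f := fun b' : Fin K × ℕ => if b' = b then 0 else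
      p.loss β (net.dist p z b ω) (net.dist p z b' ω)
        (ENNReal.ofReal (net.fading b'.1 b'.2 r ω))) b'
    rw [if_neg hbb, h1, top_le_iff] at h2
    rw [threshold, h2] at hlt
    exact not_top_lt hlt
  rw [sir, hrec b, ← hh, ← hU]
  set T : ℝ≥0∞ := ∑' b' : Fin K × ℕ, if net.on b'.1 b'.2 ω = true ∧ b' ≠ b then
    ENNReal.ofReal (net.receivedPower p b' r ω) else 0 with hT
  have hthr : net.Nearest p z b ω → net.threshold p β z r b ω = β * T / U := by
    intro hmin
    rw [threshold, hT, ← ENNReal.tsum_mul_left, div_eq_mul_inv, ← ENNReal.tsum_mul_right]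
    refine tsum_congr fun b' => ?_
    by_cases hbb : b' = b
    · simp [hbb]
    rw [if_neg hbb]
    by_cases hon' : net.on b'.1 b'.2 ω = true
    · rw [if_pos ⟨hon', hbb⟩, Params.loss, if_neg (not_lt.2 (hmin.2 b')), zero_add,
        dist_div_dist_rpow hp hon hon', hrec b', div_eq_mul_inv]
      ring
    · rw [dist_of_off hon', Params.loss_top hp]
      simp [hon']
  -- The interference `T` may be `0` or `∞`; the equivalence survives because `β` is neither.
  have hiff : β < h * U / T ↔ β * T / U < h := by
    rw [ENNReal.div_lt_iff (Or.inl hU0) (Or.inl hUt)]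
    exact ENNReal.lt_div_iff_mul_lt (Or.inr ENNReal.ofReal_ne_top)
      (Or.inr (by simpa [hβ] using hp.beta_pos))
  rw [hiff]
  constructor
  · rintro ⟨hmin, hlt⟩
    exact ⟨hb, by rwa [hthr hmin]⟩
  · rintro ⟨_, hlt⟩
    exact ⟨hnear hlt, by rwa [← hthr (hnear hlt)]⟩

section Measurability

variable {Ω' : Type*} [MeasurableSpace Ω'] [MeasurableSpace S]

lemma measurable_dist_uncurry
    (hg : ∀ j, Measurable (fun q : Plane × Plane × S => net.gain j q.1 q.2.1 q.2.2))
    (p : Params K) {z : Ω' → Plane} {b : Fin K × ℕ} {g : Ω' → Ω} (hz : Measurable z)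
    (hbs : Measurable fun ω => net.bs b.1 b.2 (g ω)) (hon : Measurable fun ω => net.on b.1 b.2 (g ω))
    (henv : Measurable fun ω => net.env b.1 b.2 (g ω)) :
    Measurable fun ω => net.dist p (z ω) b (g ω) :=
  (p.measurable_effDist b.1).comp (hz.prodMk (hbs.prodMk (hon.prodMk
    ((hg b.1).comp (hbs.prodMk (hz.prodMk henv))))))

lemma measurable_threshold_uncurry
    (hg : ∀ j, Measurable (fun q : Plane × Plane × S => net.gain j q.1 q.2.1 q.2.2))
    (p : Params K) (β : ℝ≥0∞) {z : Ω' → Plane} {r : Receiver} {b : Fin K × ℕ} {g : Ω' → Ω}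
    (hz : Measurable z)
    (hbs : ∀ b : Fin K × ℕ, Measurable fun ω => net.bs b.1 b.2 (g ω))
    (hon : ∀ b : Fin K × ℕ, Measurable fun ω => net.on b.1 b.2 (g ω))
    (henv : ∀ b : Fin K × ℕ, Measurable fun ω => net.env b.1 b.2 (g ω))
    (hfad : ∀ b', b' ≠ b → Measurable fun ω => net.fading b'.1 b'.2 r (g ω)) :
    Measurable fun ω => net.threshold p β (z ω) r b (g ω) := by
  unfold threshold
  have hd : ∀ b', Measurable fun ω => net.dist p (z ω) b' (g ω) := fun b' =>
    measurable_dist_uncurry hg p hz (hbs b') (hon b') (henv b')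
  refine Measurable.tsum fun b' => ?_
  by_cases hb : b' = b
  · simp only [hb, if_true]; exact measurable_const
  · simp only [hb, if_false]
    exact (p.measurable_loss β).comp ((hd b).prodMk ((hd b').prodMk
      (ENNReal.measurable_ofReal.comp (hfad b' hb))))

end Measurability

variable [MeasurableSpace Ω] [MeasurableSpace S] {μ : Measure Ω}

lemma IsModel.measurable_dist (hnet : net.IsModel p μ) (z : Plane) (b : Fin K × ℕ) :
    Measurable (net.dist p z b) :=
  measurable_dist_uncurry (g := id) hnet.gain_measurable p measurable_const
    ((hnet.bs_poisson _).measurable _) (hnet.on_measurable _ _) (hnet.env_measurable _ _)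

lemma IsModel.lintegral_fading (hnet : net.IsModel p μ) (b : Fin K × ℕ) (r : Receiver)
    {f : ℝ → ℝ≥0∞} (hf : Measurable f) :
    ∫⁻ ω, f (net.fading b.1 b.2 r ω) ∂μ = ∫⁻ h, f h ∂(expMeasure 1) := by
  rw [← hnet.fading_law b.1 b.2 r, lintegral_map hf (hnet.fading_measurable _ _ _)]

lemma IsModel.measurableSet_coverSet (hnet : net.IsModel p μ) (β : ℝ≥0∞) (z : Plane)
    (r : Receiver) (k : Fin K) {A : Set Plane} (hA : MeasurableSet A) (b : Fin K × ℕ) :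
    MeasurableSet (net.coverSet p β z r k A b) := by
  have hbs : ∀ b : Fin K × ℕ, Measurable (net.bs b.1 b.2) := fun b =>
    (hnet.bs_poisson b.1).measurable b.2
  have hlt : MeasurableSet {ω | net.threshold p β z r b ω
      < ENNReal.ofReal (net.fading b.1 b.2 r ω)} := by
    refine measurableSet_lt ?_ ?_
    · exact measurable_threshold_uncurry (g := id) hnet.gain_measurable p β measurable_const hbs
        (fun b => hnet.on_measurable _ _) (fun b => hnet.env_measurable _ _)
        (fun b' _ => hnet.fading_measurable _ _ _)
    · exact ENNReal.measurable_ofReal.comp (hnet.fading_measurable _ _ _)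
  exact ((MeasurableSet.const _).inter ((hbs b hA).inter
    (hnet.measurable_dist z b (measurableSet_singleton ∞)).compl)).inter hlt

/-- Integration over the fading gain of the serving base station. -/
lemma IsModel.measure_coverSet (hnet : net.IsModel p μ) [IsProbabilityMeasure μ]
    (hp : p.Admissible) {β : ℝ≥0∞} (hβ : β ≠ ∞) (z : Plane) (r : Receiver) (k : Fin K)
    {A : Set Plane} (hA : MeasurableSet A) (b : Fin K × ℕ) :
    μ (net.coverSet p β z r k A b)
      = (1 + β) * ∫⁻ ω, (Params.window k A).indicator 1 (net.data p z r b ω) *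
        nexp (∑' b', p.loss β (net.data p z r b ω).2.2.1 (net.data p z r b' ω).2.2.1
          (net.data p z r b' ω).2.2.2) ∂μ := by
  set W : Set Ω := {ω | b.1 = k ∧ net.bs b.1 b.2 ω ∈ A ∧ net.dist p z b ω ≠ ∞} with hW
  set Z := net.threshold p β z r b with hZ
  have hbs : ∀ b' : Fin K × ℕ, Measurable[net.sigmaOf {Source.fading b.1 b.2}ᶜ] (net.bs b'.1 b'.2) := fun b' =>
    net.measurable_bs_sigmaOf (by simp) _
  have hon : ∀ b' : Fin K × ℕ, Measurable[net.sigmaOf {Source.fading b.1 b.2}ᶜ] (net.on b'.1 b'.2) := fun b' =>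
    net.measurable_on_sigmaOf (by simp)
  have henv : ∀ b' : Fin K × ℕ, Measurable[net.sigmaOf {Source.fading b.1 b.2}ᶜ] (net.env b'.1 b'.2) := fun b' =>
    net.measurable_env_sigmaOf (by simp)
  -- The threshold omits the term of `b`, hence does not involve the fading of `b`.
  have hZm : Measurable[net.sigmaOf {Source.fading b.1 b.2}ᶜ] Z := by
    refine @measurable_threshold_uncurry K Ω S net Ω (net.sigmaOf {Source.fading b.1 b.2}ᶜ) _ hnet.gain_measurable p β (fun _ => z) r b id
      measurable_const hbs hon henv fun b' hb' => ?_
    have : ¬ (b'.1 = b.1 ∧ b'.2 = b.2) := fun h => hb' (Prod.ext h.1 h.2)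
    exact net.measurable_fading_sigmaOf (by simpa using this) _
  have hdm : Measurable[net.sigmaOf {Source.fading b.1 b.2}ᶜ] (net.dist p z b) :=
    @measurable_dist_uncurry K Ω S net Ω (net.sigmaOf {Source.fading b.1 b.2}ᶜ) _ hnet.gain_measurable p (fun _ => z) b id
      measurable_const (hbs b) (hon b) (henv b)
  have hWm : MeasurableSet[net.sigmaOf {Source.fading b.1 b.2}ᶜ] W := by
    refine (MeasurableSet.const _).inter ((hbs b hA).inter ?_)
    exact (hdm (measurableSet_singleton ∞)).compl
  have ham : Measurable[net.sigmaOf {Source.fading b.1 b.2}ᶜ] (W.indicator (1 : Ω → ℝ≥0∞)) :=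
    Measurable.indicator (@measurable_one _ _ _ (net.sigmaOf {Source.fading b.1 b.2}ᶜ) _) hWm
  have hfm : Measurable[net.sigmaOf {Source.fading b.1 b.2}] (net.fading b.1 b.2 r) :=
    net.measurable_fading_sigmaOf (by simp) r
  have hVm : Measurable[net.sigmaOf {Source.fading b.1 b.2}ᶜ] fun ω => (W.indicator (1 : Ω → ℝ≥0∞) ω, Z ω) := ham.prodMk hZm
  have hind : IndepFun (fun ω => (W.indicator (1 : Ω → ℝ≥0∞) ω, Z ω)) (net.fading b.1 b.2 r) μ :=
    indep_of_indep_of_le_left (indep_of_indep_of_le_right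
      (hnet.indep_sigmaOf disjoint_compl_left) hfm.comap_le) hVm.comap_le
  have hle := hnet.sigmaOf_le {Source.fading b.1 b.2}ᶜ
  have hint : ∀ {G : (ℝ≥0∞ × ℝ≥0∞) × ℝ → ℝ≥0∞}, Measurable G →
      ∫⁻ ω, G ((W.indicator (1 : Ω → ℝ≥0∞) ω, Z ω), net.fading b.1 b.2 r ω) ∂μ
        = ∫⁻ ω, ∫⁻ h, G ((W.indicator (1 : Ω → ℝ≥0∞) ω, Z ω), h) ∂(expMeasure 1) ∂μ := by
    intro G hG
    rw [lintegral_comp_of_indepFun (hVm.mono hle le_rfl) (hnet.fading_measurable _ _ _) hind hG]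
    exact lintegral_congr fun ω => hnet.lintegral_fading b r (hG.comp measurable_prodMk_left)
  -- Given the threshold `Z`, the exponential fading gain exceeds it with probability `exp (-Z)`.
  have h1 : μ (net.coverSet p β z r k A b) = ∫⁻ ω, W.indicator 1 ω * nexp (Z ω) ∂μ := by
    have hG : Measurable fun q : (ℝ≥0∞ × ℝ≥0∞) × ℝ =>
        q.1.1 * ({q : (ℝ≥0∞ × ℝ≥0∞) × ℝ | q.1.2 < ENNReal.ofReal q.2}.indicator 1 q : ℝ≥0∞) := by
      refine (by fun_prop : Measurable fun q : (ℝ≥0∞ × ℝ≥0∞) × ℝ => q.1.1).mul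
        (measurable_one.indicator (measurableSet_lt (by fun_prop)
          (ENNReal.measurable_ofReal.comp measurable_snd)))
    have h2 := hint hG
    rw [← lintegral_indicator_one (hnet.measurableSet_coverSet β z r k hA b)]
    refine Eq.trans (lintegral_congr fun ω => ?_) (h2.trans (lintegral_congr fun ω => ?_))
    · by_cases hw : ω ∈ W
      · by_cases hlt : Z ω < ENNReal.ofReal (net.fading b.1 b.2 r ω)
        · have h3 : ω ∈ net.coverSet p β z r k A b := ⟨hw, hlt⟩
          simp [h3, hw, hlt]
        · have h3 : ω ∉ net.coverSet p β z r k A b := fun h => hlt h.2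
          simp [h3, hlt]
      · have h3 : ω ∉ net.coverSet p β z r k A b := fun h => hw h.1
        simp [h3, hw]
    · dsimp only
      have hmZ : MeasurableSet {h : ℝ | Z ω < ENNReal.ofReal h} :=
        measurableSet_lt measurable_const ENNReal.measurable_ofReal
      have hind1 : Measurable ({h : ℝ | Z ω < ENNReal.ofReal h}.indicator (1 : ℝ → ℝ≥0∞)) :=
        measurable_one.indicator hmZ
      rw [← expMeasure_one_lt_ofReal (Z ω), ← lintegral_indicator_one hmZ,
        ← lintegral_const_mul _ hind1]
      rfl
  -- Inserting the own term of `b`, as Mecke's formula requires, costs the independent factor `exp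
  -- (-β h)` of mean `(1 + β)⁻¹`.
  have h2 : ∫⁻ ω, W.indicator 1 ω * (nexp (β * ENNReal.ofReal (net.fading b.1 b.2 r ω)) *
      nexp (Z ω)) ∂μ = (1 + β)⁻¹ * ∫⁻ ω, W.indicator 1 ω * nexp (Z ω) ∂μ := by
    have hG : Measurable fun q : (ℝ≥0∞ × ℝ≥0∞) × ℝ =>
        q.1.1 * (nexp (β * ENNReal.ofReal q.2) * nexp q.1.2) := by
      fun_prop
    refine (hint hG).trans ?_
    rw [← lintegral_const_mul' _ _ (by simp)]
    refine lintegral_congr fun ω => ?_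
    dsimp only
    have h3 : Measurable fun h : ℝ => nexp (β * ENNReal.ofReal h) := by fun_prop
    rw [lintegral_const_mul _ (h3.mul_const _), lintegral_mul_const _ h3,
      lintegral_nexp_mul_expMeasure hβ]
    ring
  have h3 : ∀ ω, (Params.window k A).indicator 1 (net.data p z r b ω) *
      nexp (∑' b', p.loss β (net.data p z r b ω).2.2.1 (net.data p z r b' ω).2.2.1
        (net.data p z r b' ω).2.2.2) = W.indicator 1 ω *
      (nexp (β * ENNReal.ofReal (net.fading b.1 b.2 r ω)) * nexp (Z ω)) := by
    intro ω
    by_cases hw : ω ∈ W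
    · have hw' : net.data p z r b ω ∈ Params.window k A := hw
      rw [Set.indicator_of_mem hw, Set.indicator_of_mem hw', ENNReal.tsum_eq_add_tsum_ite b, nexp_add,
        ← Params.loss_self (p := p) β _ (dist_ne_zero hp b ω z) hw.2.2]
      refine congrArg₂ _ rfl (congrArg₂ _ rfl (congrArg nexp (tsum_congr fun b' => ?_)))
      split_ifs <;> rfl
    · have hw' : net.data p z r b ω ∉ Params.window k A := hw
      rw [Set.indicator_of_notMem hw, Set.indicator_of_notMem hw', zero_mul, zero_mul]
  simp_rw [h3]
  rw [h2, ← mul_assoc, ENNReal.mul_inv_cancel (by simp) (by simpa using hβ), one_mul, h1]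

/-- The mean number of base stations of tier `k` in `A` which serve and cover a receiver at `z`. -/
theorem IsModel.tsum_measure_coverSet (hnet : net.IsModel p μ) [IsProbabilityMeasure μ]
    (hp : p.Admissible) {β : ℝ≥0∞} (hβ : β ≠ ∞) (z : Plane) (r : Receiver) (k : Fin K)
    {A : Set Plane} (hA : MeasurableSet A) :
    ∑' b, μ (net.coverSet p β z r k A b) = (1 + β) * p.serverMean β k A z := by
  simp_rw [hnet.measure_coverSet hp hβ z r k hA]
  have hd := hnet.measurable_data z r
  rw [ENNReal.tsum_mul_left, ← hnet.lintegral_tsum_window hp z r hβ k hA, lintegral_tsum]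
  intro b
  refine (((measurable_one.indicator (Params.measurableSet_window k hA)).comp (hd b)).mul
    (measurable_nexp.comp (Measurable.tsum fun b' => ?_))).aemeasurable
  exact (p.measurable_loss β).comp
    (f := fun ω => ((net.data p z r b ω).2.2.1, (net.data p z r b' ω).2.2))
    (((measurable_fst.comp (measurable_snd.comp measurable_snd)).comp (hd b)).prodMk
      ((measurable_snd.comp measurable_snd).comp (hd b')))

end Network

end HetNet

end

/-! ### Almost sure association, coverage probability and Campbell sums -/

noncomputable section

namespace HetNet

open Filter Topology

lemma IsPoissonProcess.hasLaplace {Ω E : Type*} [MeasurableSpace Ω] [MeasurableSpace E]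
    {Y : ℕ → Ω → E} {Λ : Measure E} {μ : Measure Ω} [IsProbabilityMeasure μ] [SigmaFinite Λ]
    (hY : IsPoissonProcess Y Λ μ) : HasLaplace Y Λ μ := fun _ hφ => hY.lintegral_nexp hφ

/-- Summation over the base stations of one tier. -/
lemma tsum_eq_tsum_tier {K : ℕ} {G : Fin K × ℕ → ℝ≥0∞} {k : Fin K} (h : ∀ b, b.1 ≠ k → G b = 0) :
    ∑' b, G b = ∑' n, G (k, n) := by
  rw [ENNReal.tsum_prod' (f := G), tsum_fintype, Finset.sum_eq_single_of_mem k (Finset.mem_univ k)]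
  intro j _ hj
  exact ENNReal.tsum_eq_zero.2 fun n => h _ hj

/-- Summation over the base stations of all tiers. -/
lemma sum_tsum_tier {K : ℕ} {G : Fin K → Fin K × ℕ → ℝ≥0∞} (h : ∀ k b, b.1 ≠ k → G k b = 0) :
    ∑ k, ∑' b, G k b = ∑' b, G b.1 b := by
  rw [← Summable.tsum_finsetSum fun _ _ => ENNReal.summable]
  refine tsum_congr fun b => ?_
  exact Finset.sum_eq_single_of_mem b.1 (Finset.mem_univ _) fun k _ hk => h k b (Ne.symm hk)

namespace Network

variable {K : ℕ} {Ω S : Type*} {net : Network K Ω S}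
variable [MeasurableSpace S] {p : Params K}

lemma measurableSet_coverSet_uncurry {Ω' : Type*} [MeasurableSpace Ω']
    (hg : ∀ j, Measurable (fun q : Plane × Plane × S => net.gain j q.1 q.2.1 q.2.2))
    (p : Params K) (β : ℝ≥0∞) {z : Ω' → Plane} {r : Receiver} {b : Fin K × ℕ} {g : Ω' → Ω}
    (k : Fin K) {A : Set Plane} (hA : MeasurableSet A) (hz : Measurable z)
    (hbs : ∀ b : Fin K × ℕ, Measurable fun ω => net.bs b.1 b.2 (g ω))
    (hon : ∀ b : Fin K × ℕ, Measurable fun ω => net.on b.1 b.2 (g ω))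
    (henv : ∀ b : Fin K × ℕ, Measurable fun ω => net.env b.1 b.2 (g ω))
    (hfad : ∀ b : Fin K × ℕ, Measurable fun ω => net.fading b.1 b.2 r (g ω)) :
    MeasurableSet {ω | g ω ∈ net.coverSet p β (z ω) r k A b} := by
  have hd : Measurable fun ω => net.dist p (z ω) b (g ω) :=
    measurable_dist_uncurry hg p hz (hbs b) (hon b) (henv b)
  have hlt : MeasurableSet {ω | net.threshold p β (z ω) r b (g ω)
      < ENNReal.ofReal (net.fading b.1 b.2 r (g ω))} :=
    measurableSet_lt (measurable_threshold_uncurry hg p β hz hbs hon henv fun b' _ => hfad b')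
      (ENNReal.measurable_ofReal.comp (hfad b))
  exact ((MeasurableSet.const (b.1 = k)).inter ((hbs b hA).inter
    (hd (measurableSet_singleton ∞)).compl)).inter hlt

lemma measurableSet_dist_eq_top_uncurry {Ω' : Type*} [MeasurableSpace Ω']
    (hg : ∀ j, Measurable (fun q : Plane × Plane × S => net.gain j q.1 q.2.1 q.2.2))
    (p : Params K) {z : Ω' → Plane} {g : Ω' → Ω} (hz : Measurable z)
    (hbs : ∀ b : Fin K × ℕ, Measurable fun ω => net.bs b.1 b.2 (g ω))
    (hon : ∀ b : Fin K × ℕ, Measurable fun ω => net.on b.1 b.2 (g ω))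
    (henv : ∀ b : Fin K × ℕ, Measurable fun ω => net.env b.1 b.2 (g ω)) :
    MeasurableSet {ω | ∀ b, net.dist p (z ω) b (g ω) = ∞} := by
  have : {ω | ∀ b, net.dist p (z ω) b (g ω) = ∞}
      = ⋂ b, {ω | net.dist p (z ω) b (g ω) = ∞} := by ext; simp
  rw [this]
  exact MeasurableSet.iInter fun b => measurable_dist_uncurry hg p hz (hbs b) (hon b) (henv b)
    (measurableSet_singleton ∞)

lemma measurableSet_nearest_uncurry {Ω' : Type*} [MeasurableSpace Ω']
    (hg : ∀ j, Measurable (fun q : Plane × Plane × S => net.gain j q.1 q.2.1 q.2.2))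
    (p : Params K) {z : Ω' → Plane} {g : Ω' → Ω} (hz : Measurable z)
    (hbs : ∀ b : Fin K × ℕ, Measurable fun ω => net.bs b.1 b.2 (g ω))
    (hon : ∀ b : Fin K × ℕ, Measurable fun ω => net.on b.1 b.2 (g ω))
    (henv : ∀ b : Fin K × ℕ, Measurable fun ω => net.env b.1 b.2 (g ω)) (b : Fin K × ℕ) :
    MeasurableSet {ω | net.Nearest p (z ω) b (g ω)} := by
  have hd : ∀ b, Measurable fun ω => net.dist p (z ω) b (g ω) := fun b =>
    measurable_dist_uncurry hg p hz (hbs b) (hon b) (henv b)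
  have : {ω | net.Nearest p (z ω) b (g ω)} = {ω | net.dist p (z ω) b (g ω) = ∞}ᶜ ∩
      ⋂ b', {ω | net.dist p (z ω) b (g ω) ≤ net.dist p (z ω) b' (g ω)} := by
    ext; simp [Nearest]
  rw [this]
  exact (hd b (measurableSet_singleton ∞)).compl.inter
    (MeasurableSet.iInter fun b' => measurableSet_le (hd b) (hd b'))

variable [MeasurableSpace Ω] {μ : Measure Ω}

lemma IsModel.measurable_bs (hnet : net.IsModel p μ) (b : Fin K × ℕ) : Measurable (net.bs b.1 b.2) :=
  (hnet.bs_poisson b.1).measurable b.2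

lemma IsModel.measurableSet_nearest (hnet : net.IsModel p μ) (z : Plane) (b : Fin K × ℕ) :
    MeasurableSet {ω | net.Nearest p z b ω} :=
  measurableSet_nearest_uncurry (g := id) hnet.gain_measurable p measurable_const
    hnet.measurable_bs (fun _ => hnet.on_measurable _ _) (fun _ => hnet.env_measurable _ _) b

/-- Almost surely there is a base station at finite effective distance from `z`. -/
lemma IsModel.ae_exists_dist_ne_top (hnet : net.IsModel p μ) [IsProbabilityMeasure μ] (hp : p.Admissible) {k : Fin K}
    (hk : 0 < p.avail k) (z : Plane) : ∀ᵐ ω ∂μ, ∃ b, net.dist p z b ω ≠ ∞ := by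
  have hprob := isProbabilityMeasure_expMeasure one_pos
  -- With infinite weight on finite effective distances the Laplace functional is a void
  -- probability; the intensity is infinite, so it vanishes.
  set φ : Params.Data K → ℝ≥0∞ := fun t => if t.2.2.1 = ∞ then 0 else ∞ with hφdef
  have hφ : Measurable φ := by
    refine Measurable.ite ?_ measurable_const measurable_const
    exact (measurable_fst.comp (measurable_snd.comp measurable_snd)) (measurableSet_singleton ∞)
  have h1 := hnet.hasLaplace_data hp z none φ hφ
  set F : ℝ≥0∞ → ℝ≥0∞ → ℝ≥0∞ := fun w _ => if w = ∞ then 0 else 1 with hF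
  have hFm : Measurable (Function.uncurry F) :=
    Measurable.ite (measurable_fst (measurableSet_singleton ∞)) measurable_const measurable_const
  have h2 : ∫⁻ t, (1 - nexp (φ t)) ∂(p.dataIntensity z) = ∞ := by
    have h3 : ∀ t : Params.Data K, 1 - nexp (φ t) = F t.2.2.1 t.2.2.2 := fun t => by
      simp only [hφdef, hF]; split_ifs <;> simp
    simp_rw [h3]
    rw [Params.lintegral_dataIntensity_snd hp z hFm (by simp [hF])]
    have hC : ENNReal.ofReal p.totalRate ≠ 0 := by simpa using Params.totalRate_pos hp hk
    simp [hF, ENNReal.mul_top hC]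
  rw [h2, nexp_top, lintegral_eq_zero_iff] at h1
  · filter_upwards [h1] with ω hω
    by_contra! hcon
    have h4 : ∀ b, φ (net.data p z none b ω) = 0 := fun b => if_pos (hcon b)
    simp [h4] at hω
  · exact measurable_nexp.comp (Measurable.tsum fun b => hφ.comp (hnet.measurable_data z none b))

lemma IsModel.ae_fading_nonneg (hnet : net.IsModel p μ) (r : Receiver) :
    ∀ᵐ ω ∂μ, ∀ b : Fin K × ℕ, 0 ≤ net.fading b.1 b.2 r ω := by
  refine ae_all_iff.2 fun b => ?_
  have h1 := hnet.lintegral_fading b r (f := (Set.Iio (0 : ℝ)).indicator 1)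
    (measurable_one.indicator measurableSet_Iio)
  have hm : Measurable fun ω => (Set.Iio (0 : ℝ)).indicator (1 : ℝ → ℝ≥0∞) (net.fading b.1 b.2 r ω) :=
    (measurable_one.indicator measurableSet_Iio).comp (hnet.fading_measurable _ _ _)
  rw [lintegral_expMeasure_one (measurable_one.indicator measurableSet_Iio),
    setLIntegral_congr_fun (g := fun _ => 0) measurableSet_Ioi fun h hh => by
      have : h ∉ Set.Iio (0 : ℝ) := fun h' =>
        lt_asymm (show h < 0 from h') (show (0 : ℝ) < h from hh)
      simp [this], lintegral_zero, lintegral_eq_zero_iff hm] at h1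
  filter_upwards [h1] with ω hω
  by_contra hneg
  have : net.fading b.1 b.2 r ω ∈ Set.Iio (0 : ℝ) := not_le.1 hneg
  simp [this] at hω

/-- The mean number of nearest base stations of tier `k` in `A`. -/
lemma IsModel.lintegral_tsum_nearest (hnet : net.IsModel p μ) [IsProbabilityMeasure μ] (hp : p.Admissible) (z : Plane)
    (k : Fin K) {A : Set Plane} (hA : MeasurableSet A) :
    ∫⁻ ω, ∑' b : Fin K × ℕ, {ω | b.1 = k ∧ net.bs b.1 b.2 ω ∈ A ∧ net.Nearest p z b ω}.indicator 1 ω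
      ∂μ = p.serverMean 0 k A z := by
  rw [← hnet.lintegral_tsum_window hp z none ENNReal.zero_ne_top k hA]
  refine lintegral_congr fun ω => tsum_congr fun b => ?_
  -- At `β = 0` only the association part of `loss` remains, so the exponential is the indicator of
  -- being nearest.
  have hloss : ∀ b', p.loss 0 (net.data p z none b ω).2.2.1 (net.data p z none b' ω).2.2.1
      (net.data p z none b' ω).2.2.2
        = if net.dist p z b' ω < net.dist p z b ω then ∞ else 0 := fun b' => by
    simp only [Params.loss, zero_mul, add_zero]; rfl
  simp_rw [hloss]
  by_cases hw : net.data p z none b ω ∈ Params.window k A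
  · by_cases hn : ∀ b', net.dist p z b ω ≤ net.dist p z b' ω
    · have h1 : ω ∈ {ω | b.1 = k ∧ net.bs b.1 b.2 ω ∈ A ∧ net.Nearest p z b ω} :=
        ⟨hw.1, hw.2.1, hw.2.2, hn⟩
      rw [Set.indicator_of_mem h1, Set.indicator_of_mem hw]
      simp [fun b' => not_lt.2 (hn b')]
    · have h1 : ω ∉ {ω | b.1 = k ∧ net.bs b.1 b.2 ω ∈ A ∧ net.Nearest p z b ω} :=
        fun h => hn h.2.2.2
      push Not at hn
      obtain ⟨b', hb'⟩ := hn
      have h2 : ∑' b', (if net.dist p z b' ω < net.dist p z b ω then ∞ else 0 : ℝ≥0∞) = ∞ := by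
        refine top_le_iff.1 (le_trans (by simp [hb']) (ENNReal.le_tsum b'))
      rw [Set.indicator_of_notMem h1, h2, nexp_top, mul_zero]
  · have h1 : ω ∉ {ω | b.1 = k ∧ net.bs b.1 b.2 ω ∈ A ∧ net.Nearest p z b ω} :=
      fun h => hw ⟨h.1, h.2.1, h.2.2.1⟩
    rw [Set.indicator_of_notMem h1, Set.indicator_of_notMem hw, zero_mul]

/-- By Campbell's formula almost surely only finitely many stations lie within each effective
distance, so the minimum is attained. -/
lemma IsModel.ae_exists_nearest (hnet : net.IsModel p μ) [IsProbabilityMeasure μ] (hp : p.Admissible) {k : Fin K}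
    (hk : 0 < p.avail k) (z : Plane) : ∀ᵐ ω ∂μ, ∃ b, net.Nearest p z b ω := by
  have hfin : ∀ n : ℕ, ∀ᵐ ω ∂μ, {b | net.dist p z b ω ≤ n}.Finite := fun n => by
    have hm : Measurable fun t : Params.Data K =>
        (Set.Iic (n : ℝ≥0∞)).indicator (1 : ℝ≥0∞ → ℝ≥0∞) t.2.2.1 :=
      (measurable_one.indicator measurableSet_Iic).comp (by fun_prop)
    have h1 := (hnet.hasLaplace_data hp z none).lintegral_tsum (hnet.measurable_data z none) hm
    have h2 := Params.lintegral_indicator_Iic_ne_top hp z n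
    rw [← h1] at h2
    filter_upwards [ae_lt_top (Measurable.tsum fun b => hm.comp (hnet.measurable_data z none b)) h2]
      with ω hω
    have h3 : ∑' b, (Set.Iic (n : ℝ≥0∞)).indicator (1 : ℝ≥0∞ → ℝ≥0∞) (net.data p z none b ω).2.2.1
        = ({b | net.dist p z b ω ≤ n}.encard : ℝ≥0∞) := by
      rw [← ENNReal.tsum_set_one, tsum_subtype {b | net.dist p z b ω ≤ n} (fun _ => (1 : ℝ≥0∞))]
      rfl
    have hω' : ∑' b, (Set.Iic (n : ℝ≥0∞)).indicator (1 : ℝ≥0∞ → ℝ≥0∞)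
        (net.data p z none b ω).2.2.1 < ∞ := hω
    rw [h3] at hω'
    refine Set.encard_lt_top_iff.1 ?_
    simpa using hω'
  filter_upwards [ae_all_iff.2 hfin, hnet.ae_exists_dist_ne_top hp hk z] with ω hω ⟨b0, hb0⟩
  obtain ⟨n, hn⟩ := ENNReal.exists_nat_gt hb0
  obtain ⟨b, hb, hmin⟩ := Set.exists_min_image _ (fun b => net.dist p z b ω) (hω n) ⟨b0, hn.le⟩
  have hb' : net.dist p z b ω ≤ n := hb
  refine ⟨b, ne_top_of_le_ne_top (ENNReal.natCast_ne_top n) hb', fun b' => ?_⟩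
  by_cases hbb : net.dist p z b' ω ≤ n
  · exact hmin b' hbb
  · exact hb'.trans (not_le.1 hbb).le

/-- Almost surely the serving base station is unique. -/
lemma IsModel.ae_nearest_unique (hnet : net.IsModel p μ) [IsProbabilityMeasure μ] (hp : p.Admissible) {k : Fin K}
    (hk : 0 < p.avail k) (z : Plane) :
    ∀ᵐ ω ∂μ, ∀ b b', net.Nearest p z b ω → net.Nearest p z b' ω → b = b' := by
  set W : Ω → ℝ≥0∞ := fun ω => ∑' b, {ω | net.Nearest p z b ω}.indicator 1 ω with hW
  have hC : ENNReal.ofReal p.totalRate ≠ 0 := by simpa using Params.totalRate_pos hp hk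
  have hmW : Measurable W := Measurable.tsum fun b =>
    measurable_one.indicator (hnet.measurableSet_nearest z b)
  -- The shares of the tiers in `totalRate` add up to one. A number of nearest stations that is at
  -- least one and has mean one equals one almost surely, so ties need no separate analysis.
  have hint : ∫⁻ ω, W ω ∂μ = 1 := by
    have h1 : ∀ ω, W ω = ∑ k, ∑' b : Fin K × ℕ, {ω | b.1 = k ∧ net.bs b.1 b.2 ω ∈ Set.univ ∧
        net.Nearest p z b ω}.indicator 1 ω := fun ω => by
      rw [sum_tsum_tier]
      · simp only [hW, Set.mem_univ, true_and]
      · intro k b hb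
        simp [hb]
    simp_rw [h1]
    rw [lintegral_finsetSum]
    · simp_rw [fun j => hnet.lintegral_tsum_nearest hp z j MeasurableSet.univ,
        fun j => Params.serverMean_univ hp hk j ENNReal.zero_ne_top (by simp) z]
      simp only [Params.coverageInt_zero, add_zero, inv_one, one_mul, mul_one]
      simp_rw [← mul_assoc, fun j => (ENNReal.ofReal_mul (q := p.effRate j)
        (hp.density_pos j).le).symm]
      rw [← Finset.sum_mul, ← ENNReal.ofReal_sum_of_nonneg fun j _ =>
        mul_nonneg (hp.density_pos j).le (Params.effRate_nonneg hp j)]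
      exact ENNReal.mul_inv_cancel hC ENNReal.ofReal_ne_top
    · intro j _
      refine Measurable.tsum fun b => measurable_one.indicator ?_
      exact (MeasurableSet.const (b.1 = j)).inter ((MeasurableSet.const _).inter
        (hnet.measurableSet_nearest z b))
  have hge : ∀ᵐ ω ∂μ, 1 ≤ W ω := by
    filter_upwards [hnet.ae_exists_nearest hp hk z] with ω ⟨b, hb⟩
    refine le_trans ?_ (ENNReal.le_tsum b)
    rw [Set.indicator_of_mem (by exact hb), Pi.one_apply]
  have hae : (fun _ => 1) =ᵐ[μ] W := ae_eq_of_ae_le_of_lintegral_le hge (by simp)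
    hmW.aemeasurable (by simp [hint])
  filter_upwards [hae] with ω hω b b' hb hb'
  by_contra hne
  have h2 : (2 : ℝ≥0∞) ≤ W ω := by
    have := ENNReal.sum_le_tsum (f := fun b => {ω | net.Nearest p z b ω}.indicator
      (1 : Ω → ℝ≥0∞) ω) {b, b'}
    rw [Finset.sum_pair hne, Set.indicator_of_mem (by exact hb),
      Set.indicator_of_mem (by exact hb'), Pi.one_apply, one_add_one_eq_two] at this
    exact this
  rw [← hω] at h2
  norm_num at h2

/-- The coverage probability. -/
lemma IsModel.measure_covered (hnet : net.IsModel p μ) [IsProbabilityMeasure μ] (hp : p.Admissible) {k : Fin K}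
    (hk : 0 < p.avail k) (hJ : p.coverageInt (ENNReal.ofReal p.beta) ≠ ∞) :
    μ {ω | ∃ b, net.CoveredBy p b none ω}
      = (1 + p.coverageInt (ENNReal.ofReal p.beta))⁻¹ := by
  set β := ENNReal.ofReal p.beta with hβ
  have hβt : β ≠ ∞ := ENNReal.ofReal_ne_top
  have hC : ENNReal.ofReal p.totalRate ≠ 0 := by simpa using Params.totalRate_pos hp hk
  set D : Fin K × ℕ → Set Ω := fun b => net.coverSet p β 0 none b.1 Set.univ b with hD
  have hcov : ∀ᵐ ω ∂μ, ∀ b, net.CoveredBy p b none ω ↔ ω ∈ D b := by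
    filter_upwards [hnet.ae_exists_dist_ne_top hp hk 0, hnet.ae_fading_nonneg none] with ω h1 h2 b
    rw [coveredBy_iff hp h1 h2]
    simp [hD, coverSet, location, hβ]
  have h1 : μ {ω | ∃ b, net.CoveredBy p b none ω} = μ (⋃ b, D b) := by
    refine measure_congr ?_
    filter_upwards [hcov] with ω hω
    refine propext ?_
    change (∃ b, net.CoveredBy p b none ω) ↔ ω ∈ ⋃ b, D b
    simp [hω]
  -- The server is almost surely unique, so the probability of coverage is the sum over all
  -- stations.
  have hdisj : Pairwise (Function.onFun (AEDisjoint μ) D) := by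
    intro b b' hne
    refine measure_eq_zero_iff_ae_notMem.2 ?_
    filter_upwards [hcov, hnet.ae_nearest_unique hp hk 0, hnet.ae_exists_dist_ne_top hp hk 0]
      with ω h2 h3 h4 ⟨hb, hb'⟩
    exact hne (h3 b b' ((serves_iff hp h4).1 ((h2 b).2 hb).1) ((serves_iff hp h4).1 ((h2 b').2 hb').1))
  rw [h1, measure_iUnion₀ hdisj fun b =>
    (hnet.measurableSet_coverSet β 0 none b.1 MeasurableSet.univ b).nullMeasurableSet]
  rw [← sum_tsum_tier (G := fun k b => μ (net.coverSet p β 0 none k Set.univ b))]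
  · simp_rw [fun j => hnet.tsum_measure_coverSet hp hβt 0 none j MeasurableSet.univ,
      fun j => Params.serverMean_univ hp hk j hβt hJ 0]
    rw [← Finset.mul_sum]
    simp_rw [← mul_assoc, fun j => (ENNReal.ofReal_mul (q := p.effRate j)
      (hp.density_pos j).le).symm, mul_assoc]
    rw [← Finset.sum_mul, ← ENNReal.ofReal_sum_of_nonneg fun j _ =>
      mul_nonneg (hp.density_pos j).le (Params.effRate_nonneg hp j)]
    -- The sum over tiers restores `totalRate`, which cancels together with `1 + β`; no availability
    -- is left.
    change (1 + β) * (ENNReal.ofReal p.totalRate * _) = _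
    rw [ENNReal.mul_inv (Or.inl hC) (Or.inl ENNReal.ofReal_ne_top), mul_left_comm _ (1 + β)⁻¹,
      ← mul_assoc (1 + β), ENNReal.mul_inv_cancel (by simp) (by simpa using hβt), one_mul,
      ← mul_assoc, ENNReal.mul_inv_cancel hC ENNReal.ofReal_ne_top, one_mul]
  · intro k b hb
    simp [coverSet, hb]

/-- The mean number of available base stations of tier `k` in `B`. -/
lemma IsModel.campbell_one (hnet : net.IsModel p μ) [IsProbabilityMeasure μ] (k : Fin K) {B : Set Plane}
    (hB : MeasurableSet B) : net.campbell μ k B (fun _ _ => 1)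
      = ENNReal.ofReal (p.density k) * volume B * ENNReal.ofReal (p.avail k) := by
  classical
  have hbs : ∀ n, Measurable (net.bs k n) := fun n => hnet.measurable_bs (k, n)
  have hon : ∀ n, Measurable (net.on k n) := fun n => hnet.on_measurable k n
  have hIB : ∀ n, Measurable fun ω => B.indicator (1 : Plane → ℝ≥0∞) (net.bs k n ω) := fun n =>
    (measurable_one.indicator hB).comp (hbs n)
  have hIo : ∀ n, Measurable fun ω => ({true} : Set Bool).indicator (1 : Bool → ℝ≥0∞)
      (net.on k n ω) := fun n => (measurable_one.indicator (measurableSet_singleton _)).comp (hon n)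
  have h1 : ∀ n, ∫⁻ ω, B.indicator (1 : Plane → ℝ≥0∞) (net.bs k n ω) *
      ({true} : Set Bool).indicator (1 : Bool → ℝ≥0∞) (net.on k n ω) ∂μ
      = (∫⁻ ω, B.indicator (1 : Plane → ℝ≥0∞) (net.bs k n ω) ∂μ) * ENNReal.ofReal (p.avail k) := by
    intro n
    have hind : IndepFun (net.bs k n) (net.on k n) μ :=
      indep_of_indep_of_le_left (indep_of_indep_of_le_right
        (hnet.indep_sigmaOf (A := {.bs k}) (B := {.on k n}) (by simp))
        (net.measurable_on_sigmaOf (by simp)).comap_le)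
        (net.measurable_bs_sigmaOf (by simp) n).comap_le
    have h2 : ∫⁻ ω, ({true} : Set Bool).indicator (1 : Bool → ℝ≥0∞) (net.on k n ω) ∂μ
        = ENNReal.ofReal (p.avail k) := by
      have hs : MeasurableSet {ω | net.on k n ω = true} := hon n (measurableSet_singleton true)
      rw [← hnet.on_prob k n, ← lintegral_indicator_one hs]
      rfl
    rw [← h2]
    exact lintegral_mul_eq_lintegral_mul_lintegral_of_indepFun (hIB n) (hIo n)
      (hind.comp (measurable_one.indicator hB) (measurable_one.indicator (measurableSet_singleton _)))
  have h3 : ∀ ω, ∑' n, (if net.bs k n ω ∈ B ∧ net.on k n ω = true then (1 : ℝ≥0∞) else 0)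
      = ∑' n, B.indicator (1 : Plane → ℝ≥0∞) (net.bs k n ω) *
      ({true} : Set Bool).indicator (1 : Bool → ℝ≥0∞) (net.on k n ω) := fun ω =>
    tsum_congr fun n => by
      by_cases h4 : net.bs k n ω ∈ B <;> by_cases h5 : net.on k n ω = true <;> simp [h4, h5]
  unfold campbell
  refine (lintegral_congr h3).trans ?_
  have hprod : ∀ n, AEMeasurable (fun ω => B.indicator (1 : Plane → ℝ≥0∞) (net.bs k n ω) *
      ({true} : Set Bool).indicator (1 : Bool → ℝ≥0∞) (net.on k n ω)) μ := fun n =>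
    ((hIB n).mul (hIo n)).aemeasurable
  rw [lintegral_tsum hprod]
  simp_rw [h1]
  rw [ENNReal.tsum_mul_right, ← lintegral_tsum fun n => (hIB n).aemeasurable,
    (hnet.bs_poisson k).hasLaplace.lintegral_tsum hbs (measurable_one.indicator hB),
    lintegral_indicator_one hB, Measure.smul_apply, smul_eq_mul]

/-- The mean total area of the service regions of the base stations of tier `k` in `B`. -/
lemma IsModel.campbell_volume (hnet : net.IsModel p μ) [IsProbabilityMeasure μ] (hp : p.Admissible) {k : Fin K}
    (hk : 0 < p.avail k) {B : Set Plane} (hB : MeasurableSet B) :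
    net.campbell μ k B (fun n ω => volume (net.serviceRegion p (k, n) ω))
      = ∫⁻ z, p.serverMean 0 k B z := by
  classical
  have hbs2 : ∀ b : Fin K × ℕ, Measurable fun q : Ω × Plane => net.bs b.1 b.2 q.1 := fun b =>
    (hnet.measurable_bs b).comp measurable_fst
  have hon2 : ∀ b : Fin K × ℕ, Measurable fun q : Ω × Plane => net.on b.1 b.2 q.1 := fun b =>
    (hnet.on_measurable _ _).comp measurable_fst
  have henv2 : ∀ b : Fin K × ℕ, Measurable fun q : Ω × Plane => net.env b.1 b.2 q.1 := fun b =>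
    (hnet.env_measurable _ _).comp measurable_fst
  -- The exceptional null event depends on `z`; Fubini turns this into a null set of locations for
  -- almost every outcome, which does not affect areas.
  have hex : ∀ᵐ ω ∂μ, ∀ᵐ z : Plane, ∃ b, net.dist p z b ω ≠ ∞ := by
    refine (Measure.ae_ae_comm ?_).2 (ae_of_all _ fun z => hnet.ae_exists_dist_ne_top hp hk z)
    convert (measurableSet_dist_eq_top_uncurry (g := Prod.fst) hnet.gain_measurable p
      measurable_snd hbs2 hon2 henv2).compl using 1
    ext q
    simp
  set G : ℕ → Ω × Plane → ℝ≥0∞ := fun n => {q | ((k, n) : Fin K × ℕ).1 = k ∧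
    net.bs k n q.1 ∈ B ∧ net.Nearest p q.2 (k, n) q.1}.indicator 1 with hG
  have hGm : ∀ n, Measurable (G n) := fun n => by
    refine measurable_one.indicator ?_
    exact (MeasurableSet.const _).inter ((hbs2 (k, n) hB).inter
      (measurableSet_nearest_uncurry (g := Prod.fst) hnet.gain_measurable p
      measurable_snd hbs2 hon2 henv2 (k, n)))
  have h1 : ∀ᵐ ω ∂μ, ∑' n, (if net.bs k n ω ∈ B ∧ net.on k n ω = true then
      volume (net.serviceRegion p (k, n) ω) else 0) = ∑' n, ∫⁻ z, G n (ω, z) := by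
    filter_upwards [hex] with ω hω
    refine tsum_congr fun n => ?_
    have hvol : volume (net.serviceRegion p (k, n) ω) = volume {z | net.Nearest p z (k, n) ω} := by
      refine measure_congr ?_
      filter_upwards [hω] with z hz
      exact propext (serves_iff hp hz)
    have hmz : MeasurableSet {z | net.Nearest p z (k, n) ω} :=
      measurableSet_nearest_uncurry (g := fun _ : Plane => ω) hnet.gain_measurable p
        measurable_id (fun _ => measurable_const) (fun _ => measurable_const)
        (fun _ => measurable_const) (k, n)
    by_cases hb : net.bs k n ω ∈ B
    · have hGz : ∀ z, G n (ω, z) = {z | net.Nearest p z (k, n) ω}.indicator 1 z := fun z => by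
        by_cases hz : net.Nearest p z (k, n) ω
        · have h2 : (ω, z) ∈ {q : Ω × Plane | ((k, n) : Fin K × ℕ).1 = k ∧ net.bs k n q.1 ∈ B ∧
              net.Nearest p q.2 (k, n) q.1} := ⟨rfl, hb, hz⟩
          exact (Set.indicator_of_mem h2 1).trans (Set.indicator_of_mem (a := z) hz 1).symm
        · have h2 : (ω, z) ∉ {q : Ω × Plane | ((k, n) : Fin K × ℕ).1 = k ∧ net.bs k n q.1 ∈ B ∧
              net.Nearest p q.2 (k, n) q.1} := fun h => hz h.2.2
          exact (Set.indicator_of_notMem h2 1).trans (Set.indicator_of_notMem (a := z) hz 1).symm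
      simp_rw [hGz]
      rw [lintegral_indicator_one hmz]
      by_cases hon : net.on k n ω = true
      · rw [if_pos ⟨hb, hon⟩, hvol]
      · rw [if_neg fun h => hon h.2]
        have : {z | net.Nearest p z (k, n) ω} = ∅ := by
          ext z
          simp [Nearest, dist_of_off (b := ((k, n) : Fin K × ℕ)) hon]
        rw [this, measure_empty]
    · simp [hG, hb]
  unfold campbell
  refine (lintegral_congr_ae h1).trans ?_
  rw [lintegral_tsum fun n => (hGm n).lintegral_prod_right'.aemeasurable]
  -- Tonelli turns total area into the integral over `z` of the mean number of servers of `z` in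
  -- `B`.
  simp_rw [fun n => lintegral_lintegral_swap (μ := μ) (ν := (volume : Measure Plane))
    (f := fun ω z => G n (ω, z)) (hGm n).aemeasurable]
  rw [← lintegral_tsum fun n => ((hGm n).lintegral_prod_left').aemeasurable]
  refine lintegral_congr fun z => ?_
  have hGz : ∀ n, AEMeasurable (fun ω => G n (ω, z)) μ := fun n =>
    ((hGm n).comp measurable_prodMk_right).aemeasurable
  rw [← lintegral_tsum hGz,
    ← hnet.lintegral_tsum_nearest hp z k hB]
  refine lintegral_congr fun ω => ?_
  rw [tsum_eq_tsum_tier (k := k)]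
  · rfl
  · intro b hb
    simp [hb]

/-- The mean total number of covered users of the base stations of tier `k` in `B`. -/
lemma IsModel.campbell_users (hnet : net.IsModel p μ) [IsProbabilityMeasure μ] (hp : p.Admissible) {k : Fin K}
    (hk : 0 < p.avail k) {B : Set Plane} (hB : MeasurableSet B) :
    net.campbell μ k B
        (fun n ω => ({i : ℕ | net.CoveredBy p (k, n) (some i) ω}.encard : ℝ≥0∞))
      = ENNReal.ofReal p.userDensity *
        ∫⁻ z, (1 + ENNReal.ofReal p.beta) * p.serverMean (ENNReal.ofReal p.beta) k B z := by
  classical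
  set β := ENNReal.ofReal p.beta with hβ
  have hβt : β ≠ ∞ := ENNReal.ofReal_ne_top
  have hle := hnet.sigmaOf_le {Source.user}ᶜ
  have hind := hnet.indep_sigmaOf (A := {Source.user}) disjoint_compl_right
  have huser : ∀ i, Measurable[net.sigmaOf {Source.user}] (net.user i) := fun i =>
    net.measurable_user_sigmaOf (by simp) i
  -- Measurability is needed with respect to the σ-algebra without the users, so that a user's
  -- location can be frozen while the network is averaged.
  have hbs : ∀ b : Fin K × ℕ, Measurable[Prod.instMeasurableSpace (m₂ := net.sigmaOf {Source.user}ᶜ)]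
      fun q : Plane × Ω => net.bs b.1 b.2 q.2 := fun b =>
    (net.measurable_bs_sigmaOf (by simp) _).comp (@measurable_snd _ _ _ (net.sigmaOf {Source.user}ᶜ))
  have hon : ∀ b : Fin K × ℕ, Measurable[Prod.instMeasurableSpace (m₂ := net.sigmaOf {Source.user}ᶜ)]
      fun q : Plane × Ω => net.on b.1 b.2 q.2 := fun b =>
    (net.measurable_on_sigmaOf (by simp)).comp (@measurable_snd _ _ _ (net.sigmaOf {Source.user}ᶜ))
  have henv : ∀ b : Fin K × ℕ, Measurable[Prod.instMeasurableSpace (m₂ := net.sigmaOf {Source.user}ᶜ)]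
      fun q : Plane × Ω => net.env b.1 b.2 q.2 := fun b =>
    (net.measurable_env_sigmaOf (by simp)).comp (@measurable_snd _ _ _ (net.sigmaOf {Source.user}ᶜ))
  have hfad : ∀ (r : Receiver) (b : Fin K × ℕ),
      Measurable[Prod.instMeasurableSpace (m₂ := net.sigmaOf {Source.user}ᶜ)]
      fun q : Plane × Ω => net.fading b.1 b.2 r q.2 := fun r b =>
    (net.measurable_fading_sigmaOf (by simp) r).comp
      (@measurable_snd _ _ _ (net.sigmaOf {Source.user}ᶜ))
  have hz : Measurable[Prod.instMeasurableSpace (m₂ := net.sigmaOf {Source.user}ᶜ)]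
      fun q : Plane × Ω => q.1 := @measurable_fst _ _ _ (net.sigmaOf {Source.user}ᶜ)
  have hprodle : Prod.instMeasurableSpace (m₁ := (inferInstance : MeasurableSpace Plane))
      (m₂ := net.sigmaOf {Source.user}ᶜ) ≤ Prod.instMeasurableSpace :=
    sup_le_sup le_rfl (MeasurableSpace.comap_mono hle)
  have hsub : ∀ {A : Set (Plane × Ω)},
      MeasurableSet[Prod.instMeasurableSpace (m₂ := net.sigmaOf {Source.user}ᶜ)] A → ∀ i,
      ∫⁻ ω, A.indicator (1 : Plane × Ω → ℝ≥0∞) (net.user i ω, ω) ∂μ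
        = ∫⁻ ω, μ {ω' | (net.user i ω, ω') ∈ A} ∂μ := by
    intro A hA i
    rw [lintegral_comp_of_indep hle (hnet.sigmaOf_le _) hind (huser i)
      (Measurable.indicator (@measurable_one _ _ _ (Prod.instMeasurableSpace
        (m₂ := net.sigmaOf {Source.user}ᶜ)) _) hA)]
    refine lintegral_congr fun ω => ?_
    have hs : MeasurableSet {ω' | (net.user i ω, ω') ∈ A} := measurable_prodMk_left (hprodle _ hA)
    rw [← lintegral_indicator_one hs]
    rfl
  have hex : ∀ᵐ ω ∂μ, ∀ i, ∃ b, net.dist p (net.user i ω) b ω ≠ ∞ := by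
    refine ae_all_iff.2 fun i => ?_
    have hA := @measurableSet_dist_eq_top_uncurry K Ω S net _ (Plane × Ω)
      (Prod.instMeasurableSpace (m₂ := net.sigmaOf {Source.user}ᶜ)) hnet.gain_measurable p
      (fun q => q.1) (fun q => q.2) hz hbs hon henv
    have h1 := hsub hA i
    have h2 : ∀ z, μ {ω' | (z, ω') ∈ {q : Plane × Ω | ∀ b, net.dist p q.1 b q.2 = ∞}} = 0 :=
      fun z => by
        refine measure_eq_zero_iff_ae_notMem.2 ?_
        filter_upwards [hnet.ae_exists_dist_ne_top hp hk z] with ω ⟨b, hb⟩ hcon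
        exact hb (hcon b)
    rw [lintegral_congr fun ω => h2 (net.user i ω), lintegral_zero, lintegral_eq_zero_iff] at h1
    · filter_upwards [h1] with ω hω
      by_contra! hcon
      have : (net.user i ω, ω) ∈ {q : Plane × Ω | ∀ b, net.dist p q.1 b q.2 = ∞} := hcon
      have h3 : {q : Plane × Ω | ∀ b, net.dist p q.1 b q.2 = ∞}.indicator
          (1 : Plane × Ω → ℝ≥0∞) (net.user i ω, ω) = 0 := hω
      rw [Set.indicator_of_mem this] at h3
      exact one_ne_zero h3
    · exact (measurable_one.indicator (hprodle _ hA)).comp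
        ((hnet.user_poisson.measurable i).prodMk measurable_id)
  set A : ℕ → ℕ → Set (Plane × Ω) := fun n i =>
    {q | q.2 ∈ net.coverSet p β q.1 (some i) k B (k, n)} with hAdef
  have hA : ∀ n i, MeasurableSet[Prod.instMeasurableSpace (m₂ := net.sigmaOf {Source.user}ᶜ)]
      (A n i) := fun n i =>
    @measurableSet_coverSet_uncurry K Ω S net _ (Plane × Ω)
      (Prod.instMeasurableSpace (m₂ := net.sigmaOf {Source.user}ᶜ)) hnet.gain_measurable p β
      (fun q => q.1) (some i) (k, n) (fun q => q.2) k B hB hz hbs hon henv (hfad (some i))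
  have hAm : ∀ n i, Measurable fun ω => (A n i).indicator (1 : Plane × Ω → ℝ≥0∞) (net.user i ω, ω) :=
    fun n i => (measurable_one.indicator (hprodle _ (hA n i))).comp
      ((hnet.user_poisson.measurable i).prodMk measurable_id)
  have h1 : ∀ᵐ ω ∂μ, ∑' n, (if net.bs k n ω ∈ B ∧ net.on k n ω = true then
      ({i : ℕ | net.CoveredBy p (k, n) (some i) ω}.encard : ℝ≥0∞) else 0)
      = ∑' n, ∑' i, (A n i).indicator (1 : Plane × Ω → ℝ≥0∞) (net.user i ω, ω) := by
    filter_upwards [hex, ae_all_iff.2 fun i : ℕ => hnet.ae_fading_nonneg (some i)] with ω h2 h3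
    refine tsum_congr fun n => ?_
    have h4 : ∀ i, (net.CoveredBy p (k, n) (some i) ω) ↔ _ := fun i =>
      coveredBy_iff (r := some i) hp (h2 i) (h3 i)
    by_cases hc : net.bs k n ω ∈ B ∧ net.on k n ω = true
    · rw [if_pos hc, ← ENNReal.tsum_set_one,
        tsum_subtype {i | net.CoveredBy p (k, n) (some i) ω} (fun _ => (1 : ℝ≥0∞))]
      refine tsum_congr fun i => ?_
      by_cases hcov : net.CoveredBy p (k, n) (some i) ω
      · have h5 : (net.user i ω, ω) ∈ A n i :=
          ⟨⟨rfl, hc.1, ((h4 i).1 hcov).1⟩, ((h4 i).1 hcov).2⟩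
        rw [Set.indicator_of_mem h5, Set.indicator_of_mem (by exact hcov), Pi.one_apply]
      · have h5 : (net.user i ω, ω) ∉ A n i := fun h => hcov ((h4 i).2 ⟨h.1.2.2, h.2⟩)
        rw [Set.indicator_of_notMem h5, Set.indicator_of_notMem (by exact hcov)]
    · rw [if_neg hc, eq_comm, ENNReal.tsum_eq_zero]
      intro i
      refine Set.indicator_of_notMem (fun h => hc ⟨h.1.2.1, ?_⟩) _
      exact ((dist_ne_top_iff hp).1 h.1.2.2).1
  -- The mean depends on user `i` only through its location, so the sum over users is a Campbell sum
  -- of one function.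
  have hmean : ∀ i z, ∑' n, μ (net.coverSet p β z (some i) k B (k, n))
      = (1 + β) * p.serverMean β k B z := fun i z => by
    rw [← hnet.tsum_measure_coverSet hp hβt z (some i) k hB, tsum_eq_tsum_tier (k := k)]
    intro b hb
    simp [coverSet, hb]
  have hmm : ∀ n i, Measurable fun z => μ (net.coverSet p β z (some i) k B (k, n)) := fun n i =>
    measurable_measure_prodMk_left (hprodle _ (hA n i))
  have hsm : Measurable fun z => (1 + β) * p.serverMean β k B z := by
    simp_rw [← hmean 0]
    exact Measurable.tsum fun n => hmm n 0
  unfold campbell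
  refine (lintegral_congr_ae h1).trans ?_
  calc ∫⁻ ω, ∑' n, ∑' i, (A n i).indicator (1 : Plane × Ω → ℝ≥0∞) (net.user i ω, ω) ∂μ
      = ∑' i, ∑' n, ∫⁻ ω, (A n i).indicator (1 : Plane × Ω → ℝ≥0∞) (net.user i ω, ω) ∂μ := by
        rw [lintegral_tsum fun n => (Measurable.tsum fun i => hAm n i).aemeasurable,
          ENNReal.tsum_comm]
        exact tsum_congr fun n => lintegral_tsum fun i => (hAm n i).aemeasurable
    _ = ∑' i, ∫⁻ ω, (1 + β) * p.serverMean β k B (net.user i ω) ∂μ := by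
        refine tsum_congr fun i => ?_
        simp_rw [fun n => hsub (hA n i) i, ← hmean i]
        exact (lintegral_tsum fun n => ((hmm n i).comp
          (hnet.user_poisson.measurable i)).aemeasurable).symm
    _ = ∫⁻ ω, ∑' i, (1 + β) * p.serverMean β k B (net.user i ω) ∂μ :=
        (lintegral_tsum fun i => (hsm.comp (hnet.user_poisson.measurable i)).aemeasurable).symm
    _ = _ := by
        rw [hnet.user_poisson.hasLaplace.lintegral_tsum hnet.user_poisson.measurable hsm,
          lintegral_smul_measure, smul_eq_mul]

end Network

end HetNet

end

/-! ### Cancellation of the window and the closed forms -/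

noncomputable section

namespace HetNet

/-- The shared window factors cancel in a mean over the base stations in a window. -/
lemma mul_div_mul_window {l v r a c : ℝ≥0∞} (hl : l ≠ 0) (hl' : l ≠ ∞) (hv : v ≠ 0) (hv' : v ≠ ∞)
    (hr : r ≠ 0) (hr' : r ≠ ∞) : l * v * (r * a * c) / (l * v * r) = a * c := by
  rw [mul_assoc r, ← mul_assoc, mul_comm (l * v * r)]
  exact ENNReal.mul_div_cancel_right (mul_ne_zero (mul_ne_zero hl hv) hr)
    (ENNReal.mul_ne_top (ENNReal.mul_ne_top hl' hv') hr')

namespace Params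

variable {K : ℕ} {p : Params K}

lemma ofReal_effRate (hp : p.Admissible) (k : Fin K) : ENNReal.ofReal (p.effRate k)
    = ENNReal.ofReal (p.avail k) *
      ENNReal.ofReal (Real.pi * (p.moment k * p.power k ^ (2 / p.alpha))) := by
  rw [← ENNReal.ofReal_mul (hp.avail_nonneg k)]
  congr 1
  unfold effRate
  ring

lemma moment_mul_power_div (p : Params K) (k : Fin K) :
    Real.pi * (p.moment k * p.power k ^ (2 / p.alpha)) / p.totalRate
      = p.moment k * p.power k ^ (2 / p.alpha) /
        ∑ j, p.avail j * p.density j * p.moment j * p.power j ^ (2 / p.alpha) := by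
  have : p.totalRate
      = Real.pi * ∑ j, p.avail j * p.density j * p.moment j * p.power j ^ (2 / p.alpha) := by
    rw [totalRate, Finset.mul_sum]
    refine Finset.sum_congr rfl fun j _ => ?_
    unfold effRate
    ring
  rw [this, mul_div_mul_left _ _ Real.pi_ne_zero]

/-- Both claims are instances: `β = 0` gives the mean area, and the target SIR gives the energy
utilization rate per unit of user density. -/
lemma serverMean_div (hp : p.Admissible) {k : Fin K} (hk : 0 < p.avail k) {β : ℝ≥0∞}
    (hβ : β ≠ ∞) (hJ : p.coverageInt β ≠ ∞) {B : Set Plane} (hB0 : volume B ≠ 0)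
    (hB : volume B ≠ ∞) :
    (1 + β) * (∫⁻ z, p.serverMean β k B z) /
        (ENNReal.ofReal (p.density k) * volume B * ENNReal.ofReal (p.avail k))
      = (1 + p.coverageInt β)⁻¹ * ENNReal.ofReal (p.moment k * p.power k ^ (2 / p.alpha) /
        ∑ j, p.avail j * p.density j * p.moment j * p.power j ^ (2 / p.alpha)) := by
  have hC := totalRate_pos hp hk
  have hC0 : ENNReal.ofReal p.totalRate ≠ 0 := by simpa using hC
  have h1 : (1 + β) * (1 + β)⁻¹ = 1 :=
    ENNReal.mul_inv_cancel (by simp) (ENNReal.add_ne_top.2 ⟨ENNReal.one_ne_top, hβ⟩)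
  rw [lintegral_serverMean hp hk k hβ hJ, ofReal_effRate hp, ← moment_mul_power_div,
    ENNReal.ofReal_div_of_pos hC, ENNReal.mul_inv (Or.inl hC0) (Or.inl ENNReal.ofReal_ne_top)]
  set c := ENNReal.ofReal (Real.pi * (p.moment k * p.power k ^ (2 / p.alpha)))
  set J := (1 + p.coverageInt β)⁻¹
  set C := (ENNReal.ofReal p.totalRate)⁻¹
  rw [show ∀ l v r : ℝ≥0∞, (1 + β) * (l * v * (r * c * ((1 + β)⁻¹ * (C * J))))
      = l * v * (r * (c * C) * (((1 + β) * (1 + β)⁻¹) * J)) from fun l v r => by ring, h1, one_mul,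
    mul_div_mul_window (by simpa using hp.density_pos k) ENNReal.ofReal_ne_top hB0 hB
      (by simpa using hk) ENNReal.ofReal_ne_top, mul_comm, div_eq_mul_inv]

end Params

namespace Network

variable {K : ℕ} {Ω S : Type*} {net : Network K Ω S} {p : Params K}
variable [MeasurableSpace Ω] {μ : Measure Ω}

lemma coverageProb_nonneg (net : Network K Ω S) : 0 ≤ net.coverageProb p μ := measureReal_nonneg

variable [MeasurableSpace S]

/-- The mean area of the service region of a typical base station. -/
lemma IsModel.meanServiceArea_eq (hnet : net.IsModel p μ) [IsProbabilityMeasure μ]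
    (hp : p.Admissible) {k : Fin K} (hk : 0 < p.avail k) {B : Set Plane} (hB : MeasurableSet B)
    (hB0 : volume B ≠ 0) (hBt : volume B ≠ ∞) :
    net.meanServiceArea p μ k B = ENNReal.ofReal (p.moment k * p.power k ^ (2 / p.alpha) /
      ∑ j, p.avail j * p.density j * p.moment j * p.power j ^ (2 / p.alpha)) := by
  have h := Params.serverMean_div hp hk ENNReal.zero_ne_top
    (by simp [Params.coverageInt_zero]) hB0 hBt
  rw [Params.coverageInt_zero, add_zero, inv_one, one_mul, one_mul] at h
  rw [meanServiceArea, typicalMean, hnet.campbell_volume hp hk hB, hnet.campbell_one k hB, h]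

/-- The coverage probability of the typical user. -/
lemma IsModel.coverageProb_eq (hnet : net.IsModel p μ) [IsProbabilityMeasure μ]
    (hp : p.Admissible) {k : Fin K} (hk : 0 < p.avail k) (hα : 2 < p.alpha) :
    net.coverageProb p μ = 1 / (1 + p.coverageF) := by
  obtain ⟨hF, hF0⟩ := Params.coverageInt_ofReal hp hα
  rw [coverageProb, Measure.real, hnet.measure_covered hp hk (by simp [hF]), hF, ENNReal.toReal_inv,
    ← ENNReal.ofReal_one, ← ENNReal.ofReal_add zero_le_one hF0,
    ENNReal.toReal_ofReal (add_nonneg zero_le_one hF0), one_div]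

/-- The energy utilization rate is the coverage probability times the mean number of users in the
service region. -/
lemma IsModel.energyUtilization_eq (hnet : net.IsModel p μ) [IsProbabilityMeasure μ]
    (hp : p.Admissible) {k : Fin K} (hk : 0 < p.avail k) (hα : 2 < p.alpha) {B : Set Plane}
    (hB : MeasurableSet B) (hB0 : volume B ≠ 0) (hBt : volume B ≠ ∞) :
    net.energyUtilization p μ k B = ENNReal.ofReal (net.coverageProb p μ * p.userDensity) *
      net.meanServiceArea p μ k B := by
  have hF := (Params.coverageInt_ofReal hp hα).1
  have hJ : p.coverageInt (ENNReal.ofReal p.beta) ≠ ∞ := by simp [hF]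
  have hcov : ENNReal.ofReal (net.coverageProb p μ)
      = (1 + p.coverageInt (ENNReal.ofReal p.beta))⁻¹ := by
    rw [coverageProb, ofReal_measureReal, hnet.measure_covered hp hk hJ]
  rw [energyUtilization, typicalMean, hnet.campbell_users hp hk hB, hnet.campbell_one k hB,
    lintegral_const_mul' _ _ (ENNReal.add_ne_top.2 ⟨ENNReal.one_ne_top, ENNReal.ofReal_ne_top⟩),
    mul_div_assoc, Params.serverMean_div hp hk ENNReal.ofReal_ne_top hJ hB0 hBt,
    hnet.meanServiceArea_eq hp hk hB hB0 hBt, ENNReal.ofReal_mul net.coverageProb_nonneg, hcov,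
    ← mul_assoc, mul_comm (ENNReal.ofReal p.userDensity)]

end Network

end HetNet

end

theorem mainTheorem4 {Ω S : Type*} [MeasurableSpace Ω] [MeasurableSpace S]
    (μ : Measure Ω) [IsProbabilityMeasure μ] {K : ℕ}
    (p : HetNet.Params K) (hp : p.Admissible)
    (net : HetNet.Network K Ω S) (hnet : net.IsModel p μ)
    (k : Fin K) (hk : 0 < p.avail k) :
    (∀ B : Set HetNet.Plane, MeasurableSet B → volume B ≠ 0 → volume B ≠ ∞ →
      net.meanServiceArea p μ k B = ENNReal.ofReal
        (p.moment k * p.power k ^ (2 / p.alpha) /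
          ∑ j, p.avail j * p.density j * p.moment j * p.power j ^ (2 / p.alpha))) ∧
    (2 < p.alpha →
      net.coverageProb p μ = 1 / (1 + p.coverageF) ∧
      ∀ B : Set HetNet.Plane, MeasurableSet B → volume B ≠ 0 → volume B ≠ ∞ →
        net.energyUtilization p μ k B =
          ENNReal.ofReal (net.coverageProb p μ * p.userDensity) * net.meanServiceArea p μ k B ∧
        net.energyUtilization p μ k B = ENNReal.ofReal
          (net.coverageProb p μ * p.userDensity * p.moment k * p.power k ^ (2 / p.alpha) /
            ∑ j, p.avail j * p.density j * p.moment j * p.power j ^ (2 / p.alpha))) := by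
  refine ⟨fun B hB hB0 hBt => hnet.meanServiceArea_eq hp hk hB hB0 hBt, fun hα =>
    ⟨hnet.coverageProb_eq hp hk hα, fun B hB hB0 hBt => ?_⟩⟩
  have h := hnet.energyUtilization_eq hp hk hα hB hB0 hBt
  refine ⟨h, h.trans ?_⟩
  rw [hnet.meanServiceArea_eq hp hk hB hB0 hBt, ← ENNReal.ofReal_mul
    (mul_nonneg net.coverageProb_nonneg hp.userDensity_pos.le)]
  congr 1
  ring
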